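/- Let $\alpha\ge 0$, $\mathbb K=[0,\infty)\times\mathbb R$ with the measure $dm_\alpha(x,t)=\frac{1}{\pi\,\Gamma(\alpha+1)}x^{2\alpha+1}\,dx\,dt$ and $|(x,t)|=(x^4+4t^2)^{1/4}$, and put $Q=2\alpha+4$. Let $L_m^\alpha$ be the Laguerre polynomials and, for $(\lambda,m)\in\widehat{\mathbb K}=\mathbb R\times\mathbb N$ (where $0\in\mathbb N$), $$\varphi_{(\lambda,m)}(x,t)=\frac{m!\,\Gamma(\alpha+1)}{\Gamma(m+\alpha+1)}\,e^{i\lambda t}e^{-|\lambda|x^2/2}L_m^\alpha(|\lambda|x^2).$$ Equip $\widehat{\mathbb K}$ with $|(\lambda,m)|=4|\lambda|\left(m+\frac{\alpha+1}{2}\right)$ and with the Plancherel measure $\gamma_\alpha$ given by $\int g\,d\gamma_\alpha=\sum_{m\ge0}L_m^\alpha(0)\int_{\mathbb R}g(\lambda,m)|\lambda|^{\alpha+1}\,d\lambda$. The Fourier–Laguerre transform of $f\in L^1(\mathbb K)$ is $$\widehat f(\lambda,m)=\int_{\mathbb K}f\,\varphi_{(-\lambda,m)}\,dm_\alpha;$$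 it is extended from $L^1(\mathbb K)\cap L^2(\mathbb K)$ to $L^2(\mathbb K)$ by continuity into $L^2(\widehat{\mathbb K},\gamma_\alpha)$, and then by linearity to $L^1(\mathbb K)+L^2(\mathbb K)$, which contains $L^p(\mathbb K)$ for $1\le p\le 2$. **Theorem.** Let $1\le p<2$ and $p'=p/(p-1)\in(2,\infty]$ (so $p'=\infty$ if $p=1$), and let $0<a,b<\infty$ with $b>Q\left(\frac1p-\frac12\right)$. Then there is a constant $C>0$, depending only on $a,b,p,\alpha$, such that for every $f\in L^p(\mathbb K)$ $$\|f\|_p^{a+b}\le C\,\big\|\,|(x,t)|^a f\,\big\|_p^{\,b}\,\big\|\,|(\lambda,m)|^{b/2}\widehat f\,\big\|_{p'}^{\,a}.$$ Here the first two norms are those of $L^p(\mathbb K,m_\alpha)$, the last is that of $L^{p'}(\widehat{\mathbb K},\gamma_\alpha)$, and a norm on the right-hand side may be $+\infty$ (with $0\cdot\infty=0$). -/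

import Mathlib

open MeasureTheory Filter Topology
open scoped ENNReal

noncomputable section

namespace LaguerreHypergroup

/-- The Radon measure `dm_α(x,t) = x^(2α+1) dx dt / (π Γ(α+1))` of `𝕂 = [0,∞) × ℝ`, as a measure
on `ℝ × ℝ` carried by `𝕂`. Functions on `𝕂` are represented by functions on `ℝ × ℝ`, whose values
outside `𝕂` play no role. -/
def haar (α : ℝ) : Measure (ℝ × ℝ) :=
  ((volume : Measure (ℝ × ℝ)).restrict (Set.Ici 0 ×ˢ Set.univ)).withDensity
    fun z => ENNReal.ofReal (z.1 ^ (2 * α + 1) / (Real.pi * Real.Gamma (α + 1)))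

/-- The homogeneous norm `|(x,t)| = (x⁴ + 4t²)^(1/4)`. -/
def homNorm (z : ℝ × ℝ) : ℝ := (z.1 ^ 4 + 4 * z.2 ^ 2) ^ (1 / 4 : ℝ)

/-- The Laguerre polynomial
`L_m^α(u) = ∑_{k ≤ m} (-1)^k Γ(m+α+1) / (Γ(k+α+1) (m-k)!) u^k / k!`. -/
def laguerre (α : ℝ) (m : ℕ) (u : ℝ) : ℝ :=
  ∑ k ∈ Finset.range (m + 1),
    (-1) ^ k * (Real.Gamma (m + α + 1) / (Real.Gamma (k + α + 1) * (m - k).factorial))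
      * (u ^ k / k.factorial)

/-- The Laguerre function
`φ_{(lam,m)}(x,t) = m! Γ(α+1) / Γ(m+α+1) e^{i lam t} e^{-|lam| x² / 2} L_m^α(|lam| x²)`. -/
def laguerreFun (α lam : ℝ) (m : ℕ) (z : ℝ × ℝ) : ℂ :=
  ((m.factorial * Real.Gamma (α + 1) / Real.Gamma (m + α + 1) : ℝ) : ℂ)
    * Complex.exp (Complex.I * lam * z.2)
    * ((Real.exp (-(|lam| * z.1 ^ 2 / 2)) * laguerre α m (|lam| * z.1 ^ 2) : ℝ) : ℂ)

/-- The Plancherel measure `dγ_α(lam,m) = L_m^α(0) |lam|^(α+1) dlam` on the dual `ℝ × ℕ`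
(Lebesgue measure in `lam`, counting measure in `m`). -/
def plancherel (α : ℝ) : Measure (ℝ × ℕ) :=
  ((volume : Measure ℝ).prod (Measure.count : Measure ℕ)).withDensity
    fun w => ENNReal.ofReal (laguerre α w.2 0 * |w.1| ^ (α + 1))

/-- The quasi-norm `|(lam,m)| = 4 |lam| (m + (α+1)/2)` on the dual. -/
def dualNorm (α : ℝ) (w : ℝ × ℕ) : ℝ := 4 * |w.1| * (w.2 + (α + 1) / 2)

/-- The Fourier–Laguerre integral `∫ f φ_{(-lam,m)} dm_α`, for `f ∈ L¹(𝕂)`. -/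
def fourierIntegral (α : ℝ) (f : ℝ × ℝ → ℂ) (w : ℝ × ℕ) : ℂ :=
  ∫ z, f z * laguerreFun α (-w.1) w.2 z ∂(haar α)

/-- `g` is the Fourier–Laguerre transform of `f ∈ L²(𝕂)`, that is, the value at `f` of the
continuous extension of the transform from `L¹ ∩ L²` to `L²`: the transforms of some sequence in
`L¹ ∩ L²` that converges to `f` in `L²(𝕂)` converge to `g` in `L²` of the dual. -/
def IsFourierL2 (α : ℝ) (f : ℝ × ℝ → ℂ) (g : ℝ × ℕ → ℂ) : Prop :=
  MemLp f 2 (haar α) ∧ MemLp g 2 (plancherel α) ∧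
    ∃ h : ℕ → ℝ × ℝ → ℂ,
      (∀ n, Integrable (h n) (haar α) ∧ MemLp (h n) 2 (haar α)) ∧
      Tendsto (fun n => eLpNorm (h n - f) 2 (haar α)) atTop (𝓝 0) ∧
      Tendsto (fun n => eLpNorm (fourierIntegral α (h n) - g) 2 (plancherel α)) atTop (𝓝 0)

/-- `g` is the Fourier–Laguerre transform of `f ∈ L¹(𝕂) + L²(𝕂)`, the sum of the transforms of an
`L¹` part and an `L²` part of `f`. The space `L¹ + L²` contains `L^p` for `1 ≤ p ≤ 2`. -/
def IsFourier (α : ℝ) (f : ℝ × ℝ → ℂ) (g : ℝ × ℕ → ℂ) : Prop :=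
  ∃ (f₁ f₂ : ℝ × ℝ → ℂ) (g₂ : ℝ × ℕ → ℂ),
    Integrable f₁ (haar α) ∧ IsFourierL2 α f₂ g₂ ∧
    f =ᵐ[haar α] f₁ + f₂ ∧ g =ᵐ[plancherel α] fourierIntegral α f₁ + g₂

open Classical in
/-- The Fourier–Laguerre transform `f̂`: the defining integral for `f ∈ L¹(𝕂)`, and its extension
(a representative of a class modulo null functions) for the other `f ∈ L¹(𝕂) + L²(𝕂)`. The value
`0` is assigned only to functions without a transform. -/
def fourier (α : ℝ) (f : ℝ × ℝ → ℂ) : ℝ × ℕ → ℂ :=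
  if Integrable f (haar α) then fourierIntegral α f
  else if h : ∃ g, IsFourier α f g then h.choose
  else 0

end LaguerreHypergroup

end

open MeasureTheory Filter Topology
open scoped ENNReal ComplexConjugate

noncomputable section

namespace LaguerreHypergroup

/-! Put σ = (α+2)(1/p − 1/2), half of Q(1/p − 1/2), and let A, B, D be the norms of f, of |z|^a f
and of |w|^{b/2} f̂. Constants are dropped in what follows. Cut f at a ball of radius r. The outer
part is at most r^{-a} B, and the inner part, by Hölder and the volume r^Q of the ball, is at most
r^{2σ} ‖f‖₂. Next, ‖f‖₂ ≤ ‖f̂‖₂, and f̂ is cut at dual radius s: the low part is at most s^σ A, and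
the high part at most s^{σ-b/2} D by Hölder, where b > Q(1/p − 1/2) makes the inverse weight
integrable at infinity. With s = ε r^{-2} the low part contributes ε^σ A, absorbed on the left for
small ε. What remains is A ≤ K (r^b D + r^{-a} B) (`exists_eLpNorm_le_radius`), and balancing the
two terms in r gives the product (`rpow_le_of_forall_radius`).

Hausdorff–Young is not used. The low-frequency bound `eLpNorm_low_le` rests only on the L¹ and L²
theories, f being truncated at a height adapted to s. The L¹ theory is |φ| ≤ 1
(`norm_laguerreFun_le`): in order 0 a Laguerre value is one coefficient of a Fock space vector of
known norm, and higher orders are nonnegative combinations of order 0. The L² theory is the isometry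
of the adjoint transform on test functions (`IsTest.lintegral_adjointTransform_sq`), from Laguerre
orthogonality in x and Plancherel in t; by duality it yields Bessel's inequality.

The bound ‖f‖₂ ≤ ‖f̂‖₂ (`IsWeakFourier.eLpNorm_two_le`) also needs completeness
(`add_ae_eq_zero_of_annihilates`). The Laguerre generating function shows that a function
annihilating all adjoint transforms annihilates exp(-c x²) times inverse Fourier integrals in t.
Taking c = 1 + iη produces a Gaussian times every character of (x², t), and uniqueness of
characteristic functions finishes. Riesz representation then supplies an L² function with the same
pairings as f, which must equal f.

The transform enters only through its pairings with test functions (`IsWeakFourier`), so the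
representative chosen in `fourier` is irrelevant. -/

/-! ### Rising binomial coefficients -/

/-- The coefficient `(a)_n / n!` of `r ^ n` in `(1 - r) ^ (-a)`. -/
def risingBinom (a : ℝ) (n : ℕ) : ℝ := (ascPochhammer ℝ n).eval a / n.factorial

@[simp] lemma risingBinom_zero_right (a : ℝ) : risingBinom a 0 = 1 := by simp [risingBinom]

lemma risingBinom_succ (a : ℝ) (n : ℕ) :
    (n + 1) * risingBinom a (n + 1) = (a + n) * risingBinom a n := by
  have : (n.factorial : ℝ) ≠ 0 := by positivity
  have : (n + 1 : ℝ) ≠ 0 := by positivity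
  simp only [risingBinom, ascPochhammer_succ_eval, Nat.factorial_succ, Nat.cast_mul, Nat.cast_add,
    Nat.cast_one]
  field_simp

lemma risingBinom_pos {a : ℝ} (ha : 0 < a) (n : ℕ) : 0 < risingBinom a n :=
  div_pos (ascPochhammer_pos n a ha) (by positivity)

lemma risingBinom_nonneg {a : ℝ} (ha : 0 ≤ a) (n : ℕ) : 0 ≤ risingBinom a n := by
  induction n with
  | zero => simp
  | succ n ih =>
    have h := risingBinom_succ a n
    have : 0 ≤ (n + 1) * risingBinom a (n + 1) := by rw [h]; positivity
    exact nonneg_of_mul_nonneg_right this (by positivity)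

lemma risingBinom_one (n : ℕ) : risingBinom 1 n = 1 := by
  simp [risingBinom, ascPochhammer_eval_one, Nat.factorial_ne_zero]

/-- The Chu–Vandermonde identity for rising binomial coefficients. -/
lemma sum_risingBinom_mul (a b : ℝ) (n : ℕ) :
    ∑ x ∈ Finset.HasAntidiagonal.antidiagonal n, risingBinom a x.1 * risingBinom b x.2 = risingBinom (a + b) n := by
  induction n with
  | zero => simp
  | succ n ih =>
    have hn : (n + 1 : ℝ) ≠ 0 := by positivity
    apply mul_left_cancel₀ hn
    rw [risingBinom_succ, ← ih, Finset.mul_sum, Finset.mul_sum]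
    -- The factor n + 1 is the sum of the two indices. Each index is absorbed by the recursion,
    -- which lowers it by one, and the two sums recombine with the factor (a + i) + (b + j) = (a +
    -- b) + n.
    have h1 : ∑ x ∈ Finset.HasAntidiagonal.antidiagonal (n + 1), (n + 1 : ℝ) * (risingBinom a x.1 * risingBinom b x.2)
        = ∑ x ∈ Finset.HasAntidiagonal.antidiagonal (n + 1), (x.1 * risingBinom a x.1) * risingBinom b x.2
          + ∑ x ∈ Finset.HasAntidiagonal.antidiagonal (n + 1), risingBinom a x.1 * (x.2 * risingBinom b x.2) := by
      rw [← Finset.sum_add_distrib]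
      refine Finset.sum_congr rfl fun x hx => ?_
      have : (x.1 + x.2 : ℝ) = n + 1 := by exact_mod_cast Finset.HasAntidiagonal.mem_antidiagonal.1 hx
      rw [← this]; ring
    rw [h1, Finset.Nat.sum_antidiagonal_succ, Finset.Nat.sum_antidiagonal_succ']
    simp only [Nat.cast_zero, zero_mul, zero_add, Nat.cast_add, Nat.cast_one, risingBinom_succ,
      mul_zero]
    rw [← Finset.sum_add_distrib]
    refine Finset.sum_congr rfl fun x hx => ?_
    have : (x.1 + x.2 : ℝ) = n := by exact_mod_cast Finset.HasAntidiagonal.mem_antidiagonal.1 hx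
    rw [← this]; ring

lemma Gamma_add_nat {x : ℝ} (hx : 0 < x) (n : ℕ) :
    Real.Gamma (x + n) = (ascPochhammer ℝ n).eval x * Real.Gamma x := by
  induction n with
  | zero => simp
  | succ n ih =>
    rw [Nat.cast_succ, ← add_assoc, Real.Gamma_add_one (by positivity), ih,
      ascPochhammer_succ_eval]
    ring

lemma Gamma_div_eq_risingBinom {x : ℝ} (hx : 0 < x) (n : ℕ) :
    Real.Gamma (x + n) / (Real.Gamma x * n.factorial) = risingBinom x n := by
  have := (Real.Gamma_pos_of_pos hx).ne'
  rw [Gamma_add_nat hx, risingBinom]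
  field_simp

/-- The Gamma quotient is a rising binomial coefficient. In this form Laguerre polynomials are
convolutions, so Chu–Vandermonde and rearrangements of double series apply. -/
lemma laguerre_eq_sum_antidiagonal {α : ℝ} (hα : 0 ≤ α) (m : ℕ) (u : ℝ) :
    laguerre α m u = ∑ x ∈ Finset.HasAntidiagonal.antidiagonal m,
      (-u) ^ x.1 / x.1.factorial * risingBinom (α + 1 + x.1) x.2 := by
  rw [Finset.Nat.sum_antidiagonal_eq_sum_range_succ_mk, laguerre]
  refine Finset.sum_congr rfl fun k hk => ?_
  have hk : k ≤ m := by simpa [Nat.lt_succ_iff] using hk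
  rw [← Gamma_div_eq_risingBinom (by positivity)]
  have h1 : α + 1 + (k : ℝ) + ((m - k : ℕ) : ℝ) = m + α + 1 := by push_cast [hk]; ring
  have h2 : α + 1 + (k : ℝ) = k + α + 1 := by ring
  rw [h1, h2, neg_pow]
  ring

lemma laguerre_zero_right {α : ℝ} (hα : 0 ≤ α) (m : ℕ) :
    laguerre α m 0 = risingBinom (α + 1) m := by
  rw [laguerre_eq_sum_antidiagonal hα, Finset.Nat.sum_antidiagonal_eq_sum_range_succ_mk,
    Finset.sum_range_succ']
  simp

lemma laguerre_zero_right_pos {α : ℝ} (hα : 0 ≤ α) (m : ℕ) : 0 < laguerre α m 0 := by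
  rw [laguerre_zero_right hα]; exact risingBinom_pos (by positivity) m

/-- The normalising factor of the Laguerre functions. -/
lemma normalization_eq {α : ℝ} (hα : 0 ≤ α) (m : ℕ) :
    m.factorial * Real.Gamma (α + 1) / Real.Gamma (m + α + 1) = (laguerre α m 0)⁻¹ := by
  rw [laguerre_zero_right hα, ← Gamma_div_eq_risingBinom (by positivity), inv_div]
  congr 1
  · ring
  · congr 1; ring

/-- Laguerre polynomials of order `α` as positive combinations of those of order `0`. -/
lemma laguerre_eq_sum_laguerre_zero {α : ℝ} (hα : 0 ≤ α) (m : ℕ) (u : ℝ) :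
    laguerre α m u = ∑ x ∈ Finset.HasAntidiagonal.antidiagonal m, laguerre 0 x.1 u * risingBinom α x.2 := by
  have h1 : ∀ x ∈ Finset.HasAntidiagonal.antidiagonal m, laguerre 0 x.1 u * risingBinom α x.2 =
      ∑ y ∈ Finset.HasAntidiagonal.antidiagonal x.1, (-u) ^ y.1 / y.1.factorial *
        (risingBinom (1 + y.1) y.2 * risingBinom α x.2) := by
    intro x _
    rw [laguerre_eq_sum_antidiagonal le_rfl, Finset.sum_mul]
    simp only [zero_add, mul_assoc]
  rw [Finset.sum_congr rfl h1, laguerre_eq_sum_antidiagonal hα]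
  -- Chu–Vandermonde for α + 1 + k = (1 + k) + α. Both sides are then sums over triples of indices
  -- with total m, grouped differently.
  have h2 : ∀ x ∈ Finset.HasAntidiagonal.antidiagonal m,
      (-u) ^ x.1 / x.1.factorial * risingBinom (α + 1 + x.1) x.2 =
      ∑ y ∈ Finset.HasAntidiagonal.antidiagonal x.2, (-u) ^ x.1 / x.1.factorial *
        (risingBinom (1 + x.1) y.1 * risingBinom α y.2) := by
    intro x _
    rw [← Finset.mul_sum, sum_risingBinom_mul, show α + 1 + (x.1 : ℝ) = 1 + x.1 + α by ring]
  rw [Finset.sum_congr rfl h2, Finset.sum_sigma', Finset.sum_sigma']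
  refine Finset.sum_nbij' (fun x => ⟨(x.1.1 + x.2.1, x.2.2), (x.1.1, x.2.1)⟩)
    (fun x => ⟨(x.2.1, x.2.2 + x.1.2), (x.2.2, x.1.2)⟩) ?_ ?_ ?_ ?_ ?_
  · rintro ⟨⟨i, j⟩, ⟨k, l⟩⟩ h
    simp only [Finset.mem_sigma, Finset.HasAntidiagonal.mem_antidiagonal, and_true] at h ⊢
    lia
  · rintro ⟨⟨i, j⟩, ⟨k, l⟩⟩ h
    simp only [Finset.mem_sigma, Finset.HasAntidiagonal.mem_antidiagonal, and_true] at h ⊢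
    lia
  · rintro ⟨⟨i, j⟩, ⟨k, l⟩⟩ h
    simp only [Finset.mem_sigma, Finset.HasAntidiagonal.mem_antidiagonal] at h
    simp [h.2]
  · rintro ⟨⟨i, j⟩, ⟨k, l⟩⟩ h
    simp only [Finset.mem_sigma, Finset.HasAntidiagonal.mem_antidiagonal] at h
    simp [h.2]
  · rintro ⟨⟨i, j⟩, ⟨k, l⟩⟩ h
    rfl

/-! ### The uniform bound for Laguerre functions -/

/-- The coefficient of `z ^ n` in `(z - s) ^ m * exp (s * z)`. -/
def fockCoeff (s : ℝ) : ℕ → ℕ → ℝ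
  | 0, n => s ^ n / n.factorial
  | m + 1, 0 => -s * fockCoeff s m 0
  | m + 1, n + 1 => fockCoeff s m n - s * fockCoeff s m (n + 1)

/-- Coefficient form of the product rule for the derivative of (z - s)^(m+1) exp(s z). -/
lemma fockCoeff_deriv (s : ℝ) (m n : ℕ) :
    (n + 1) * fockCoeff s (m + 1) (n + 1) =
      (m + 1) * fockCoeff s m n + s * fockCoeff s (m + 1) n := by
  have h0 : ∀ n : ℕ, (n + 1) * fockCoeff s 0 (n + 1) = s * fockCoeff s 0 n := by
    intro n
    have : (n + 1 : ℝ) ≠ 0 := by positivity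
    have : (n.factorial : ℝ) ≠ 0 := by positivity
    simp only [fockCoeff, Nat.factorial_succ, Nat.cast_mul, Nat.cast_add, Nat.cast_one, pow_succ]
    field_simp
  induction m generalizing n with
  | zero =>
    cases n with
    | zero =>
      have := h0 0
      simp only [fockCoeff] at *
      linear_combination (-s) * this
    | succ n =>
      have h1 := h0 n
      have h2 := h0 (n + 1)
      simp only [fockCoeff, Nat.cast_add, Nat.cast_one] at *
      linear_combination h1 - s * h2
  | succ m ih =>
    cases n with
    | zero =>
      have := ih 0
      simp only [fockCoeff, Nat.cast_zero, Nat.cast_add, Nat.cast_one] at *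
      linear_combination (-s) * this
    | succ n =>
      have h1 := ih n
      have h2 := ih (n + 1)
      rw [fockCoeff, fockCoeff.eq_3 s (m + 1) n]
      rw [fockCoeff.eq_3 s m n] at h2 ⊢
      rw [fockCoeff.eq_3 s m n] at h1
      rw [fockCoeff.eq_3 s m (n+1)] at h2 ⊢
      push_cast at *
      linear_combination h1 - s * h2

lemma fockCoeff_bound (s : ℝ) (m : ℕ) :
    ∃ K R : ℝ, 0 ≤ K ∧ 1 ≤ R ∧ ∀ n : ℕ, |fockCoeff s m n| * n.factorial ≤ K * R ^ n := by
  induction m with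
  | zero =>
    refine ⟨1, 1 + |s|, zero_le_one, by linarith [abs_nonneg s], fun n => ?_⟩
    have : (n.factorial : ℝ) ≠ 0 := by positivity
    rw [fockCoeff, abs_div, Nat.abs_cast, div_mul_cancel₀ _ this, abs_pow, one_mul]
    gcongr; linarith [abs_nonneg s]
  | succ m ih =>
    obtain ⟨K, R, hK, hR, h⟩ := ih
    -- Passing from n! to (n+1)! costs a factor n + 1 ≤ 2^(n+1), hence the doubled ratio.
    refine ⟨K * (1 + |s|), 2 * R, by positivity, by linarith, fun n => ?_⟩
    have hR0 : 0 ≤ R := by linarith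
    cases n with
    | zero =>
      have := h 0
      simp only [fockCoeff, abs_mul, abs_neg, pow_zero, mul_one, Nat.factorial_zero,
        Nat.cast_one] at *
      nlinarith [abs_nonneg s, mul_le_mul_of_nonneg_left this (abs_nonneg s)]
    | succ n =>
      have h1 := h n
      have h2 := h (n + 1)
      have h3 : (n + 1 : ℝ) ≤ 2 ^ (n + 1) := by
        exact_mod_cast (Nat.lt_two_pow_self (n := n + 1)).le
      have h4 : R ^ n ≤ R ^ (n + 1) := pow_le_pow_right₀ hR (Nat.le_succ n)
      calc |fockCoeff s (m + 1) (n + 1)| * (n + 1).factorial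
          ≤ (|fockCoeff s m n| + |s| * |fockCoeff s m (n + 1)|) * (n + 1).factorial := by
            gcongr
            rw [fockCoeff, ← abs_mul]
            exact abs_sub _ _
        _ = (n + 1) * (|fockCoeff s m n| * n.factorial)
            + |s| * (|fockCoeff s m (n + 1)| * (n + 1).factorial) := by
            rw [Nat.factorial_succ]; push_cast; ring
        _ ≤ 2 ^ (n + 1) * (K * R ^ (n + 1)) + |s| * (2 ^ (n + 1) * (K * R ^ (n + 1))) := by
            refine add_le_add (mul_le_mul h3 (h1.trans (by gcongr)) (by positivity)
              (by positivity)) (mul_le_mul_of_nonneg_left (h2.trans ?_) (abs_nonneg s))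
            exact le_mul_of_one_le_left (by positivity) (one_le_pow₀ (by norm_num))
        _ = _ := by rw [mul_pow]; ring

lemma fockCoeff_summable (s : ℝ) (m k : ℕ) :
    Summable fun n : ℕ => n.factorial * (fockCoeff s m n * fockCoeff s k n) := by
  obtain ⟨K, R, hK, hR, h⟩ := fockCoeff_bound s m
  obtain ⟨K', R', hK', hR', h'⟩ := fockCoeff_bound s k
  refine Summable.of_norm_bounded (g := fun n : ℕ => K * K' * ((R * R') ^ n / n.factorial))
    ((Real.summable_pow_div_factorial _).mul_left _) fun n => ?_
  have hn : (0 : ℝ) < n.factorial := by positivity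
  rw [Real.norm_eq_abs, abs_mul, abs_mul, Nat.abs_cast, mul_div_assoc', le_div_iff₀ hn]
  calc _ = (|fockCoeff s m n| * n.factorial) * (|fockCoeff s k n| * n.factorial) := by ring
    _ ≤ (K * R ^ n) * (K' * R' ^ n) := mul_le_mul (h n) (h' n) (by positivity) (by positivity)
    _ = _ := by rw [mul_pow]; ring

/-- The Fock norm gives z^n the squared norm n!, and exp(s z - s²/2) g(z - s) has the same norm as
g; here g = z^m. The proof is by induction, using that multiplication by z and differentiation are
mutually adjoint. -/
lemma tsum_fockCoeff_sq (s : ℝ) (m : ℕ) :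
    ∑' n : ℕ, n.factorial * (fockCoeff s m n * fockCoeff s m n)
      = m.factorial * Real.exp (s ^ 2) := by
  induction m with
  | zero =>
    rw [Real.exp_eq_exp_ℝ, NormedSpace.exp_eq_tsum_div]
    simp only [Nat.factorial_zero, Nat.cast_one, one_mul]
    refine tsum_congr fun n => ?_
    have : (n.factorial : ℝ) ≠ 0 := by positivity
    rw [fockCoeff, ← pow_mul, mul_comm 2 n, pow_mul]
    field_simp
  | succ m ih =>
    have hS := fockCoeff_summable s (m + 1) (m + 1)
    have hC := fockCoeff_summable s (m + 1) m
    have hC' := fockCoeff_summable s m m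
    -- One factor is expanded by the recursion in m, the other absorbs n + 1 through the derivative
    -- rule. After summation the two cross sums differ only in their term n = 0, which cancels the
    -- separated first term of the square sum.
    have key : ∀ n : ℕ, ((n + 1).factorial : ℝ)
        * (fockCoeff s (m + 1) (n + 1) * fockCoeff s (m + 1) (n + 1))
        = ((m + 1) * (n.factorial * (fockCoeff s m n * fockCoeff s m n))
          + s * (n.factorial * (fockCoeff s (m + 1) n * fockCoeff s m n)))
          - s * ((n + 1).factorial * (fockCoeff s (m + 1) (n + 1) * fockCoeff s m (n + 1))) := by
      intro n
      have h := fockCoeff_deriv s m n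
      conv_lhs => rw [fockCoeff.eq_3 s m n]
      rw [Nat.factorial_succ, fockCoeff.eq_3 s m n] at *
      push_cast
      linear_combination (n.factorial * fockCoeff s m n : ℝ) * h
    have hC1 := (summable_nat_add_iff 1).2 hC
    rw [hS.tsum_eq_zero_add, tsum_congr key, Summable.tsum_sub, Summable.tsum_add,
      tsum_mul_left, tsum_mul_left, tsum_mul_left, ih]
    · rw [hC.tsum_eq_zero_add, Nat.factorial_succ]
      simp only [fockCoeff]
      push_cast
      ring
    · exact hC'.mul_left _
    · exact hC.mul_left _
    · exact (hC'.mul_left _).add (hC.mul_left _)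
    · exact hC1.mul_left _

lemma fockCoeff_eq_coeff (s : ℝ) (m n : ℕ) :
    fockCoeff s m n = PowerSeries.coeff n
      ((((Polynomial.X + Polynomial.C (-s)) ^ m : Polynomial ℝ) : PowerSeries ℝ)
        * PowerSeries.mk fun n => s ^ n / n.factorial) := by
  induction m generalizing n with
  | zero => simp [fockCoeff]
  | succ m ih =>
    have : ((((Polynomial.X + Polynomial.C (-s)) ^ (m + 1) : Polynomial ℝ)) : PowerSeries ℝ)
        = (PowerSeries.X - PowerSeries.C s) *
          (((Polynomial.X + Polynomial.C (-s)) ^ m : Polynomial ℝ) : PowerSeries ℝ) := by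
      rw [pow_succ']
      simp [sub_eq_add_neg]
    rw [this, mul_assoc, sub_mul, map_sub, PowerSeries.coeff_C_mul]
    cases n with
    | zero => rw [PowerSeries.coeff_zero_X_mul, ← ih, fockCoeff]; ring
    | succ n => rw [PowerSeries.coeff_succ_X_mul, ← ih, ← ih, fockCoeff]

lemma fockCoeff_diag (s : ℝ) (m : ℕ) : fockCoeff s m m = laguerre 0 m (s ^ 2) := by
  rw [fockCoeff_eq_coeff, PowerSeries.coeff_mul, laguerre_eq_sum_antidiagonal le_rfl,
    ← Finset.Nat.sum_antidiagonal_swap]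
  refine Finset.sum_congr rfl fun x hx => ?_
  have hx' : x.1 + x.2 = m := Finset.HasAntidiagonal.mem_antidiagonal.1 hx
  have h1 : m - x.2 = x.1 := by lia
  have h2 : risingBinom (0 + 1 + x.1) x.2 = m.choose x.2 := by
    rw [← Gamma_div_eq_risingBinom (by positivity), show (0 + 1 + (x.1 : ℝ)) = x.1 + 1 by ring,
      show ((x.1 : ℝ) + 1 + x.2) = m + 1 by rw [← hx']; push_cast; ring,
      Real.Gamma_nat_eq_factorial, Real.Gamma_nat_eq_factorial,
      Nat.cast_choose ℝ (by lia : x.2 ≤ m), h1, mul_comm (x.1.factorial : ℝ)]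
  rw [Polynomial.coeff_coe, Polynomial.coeff_X_add_C_pow, PowerSeries.coeff_mk,
    Prod.fst_swap, Prod.snd_swap, h1, h2, show -s ^ 2 = -s * s by ring, mul_pow]
  ring

/-- With s = √u, the diagonal coefficient alone contributes m! L_m(u)² to a sum of nonnegative terms
equal to m! e^u. -/
lemma abs_laguerre_zero_le (m : ℕ) {u : ℝ} (hu : 0 ≤ u) :
    |laguerre 0 m u| ≤ Real.exp (u / 2) := by
  have h := (fockCoeff_summable (√u) m m).le_tsum m
    (fun j _ => mul_nonneg (by positivity) (mul_self_nonneg _))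
  rw [tsum_fockCoeff_sq, fockCoeff_diag, Real.sq_sqrt hu] at h
  have h2 : laguerre 0 m u * laguerre 0 m u ≤ Real.exp u :=
    le_of_mul_le_mul_left h (by positivity)
  refine abs_le_of_sq_le_sq ?_ (by positivity)
  rw [← Real.exp_nat_mul]
  calc _ ≤ _ := (sq _).trans_le h2
    _ = _ := by congr 1; push_cast; ring

/-- The expansion in order 0 has nonnegative coefficients because α ≥ 0, and L_k^0(0) = 1, so the
coefficients add up to the value at 0. -/
lemma abs_laguerre_le {α : ℝ} (hα : 0 ≤ α) (m : ℕ) {u : ℝ} (hu : 0 ≤ u) :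
    |laguerre α m u| ≤ Real.exp (u / 2) * laguerre α m 0 := by
  rw [laguerre_eq_sum_laguerre_zero hα, laguerre_eq_sum_laguerre_zero hα m 0, Finset.mul_sum]
  refine (Finset.abs_sum_le_sum_abs _ _).trans (Finset.sum_le_sum fun x _ => ?_)
  have h0 : laguerre 0 x.1 0 = 1 := by
    rw [laguerre_zero_right le_rfl, zero_add, risingBinom_one]
  rw [abs_mul, abs_of_nonneg (risingBinom_nonneg hα _), h0, one_mul]
  exact mul_le_mul_of_nonneg_right (abs_laguerre_zero_le _ hu) (risingBinom_nonneg hα _)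

lemma norm_laguerreFun_le {α : ℝ} (hα : 0 ≤ α) (lam : ℝ) (m : ℕ) (z : ℝ × ℝ) :
    ‖laguerreFun α lam m z‖ ≤ 1 := by
  have h0 := laguerre_zero_right_pos hα m
  rw [laguerreFun, normalization_eq hα, norm_mul, norm_mul, Complex.norm_real, Complex.norm_real,
    show Complex.I * lam * z.2 = ((lam * z.2 : ℝ) : ℂ) * Complex.I by push_cast; ring,
    Complex.norm_exp_ofReal_mul_I, mul_one, norm_mul, Real.norm_of_nonneg (by positivity),
    Real.norm_of_nonneg (Real.exp_pos _).le, Real.norm_eq_abs]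
  have h := abs_laguerre_le hα m (u := |lam| * z.1 ^ 2) (by positivity)
  calc _ ≤ (laguerre α m 0)⁻¹ * (Real.exp (-(|lam| * z.1 ^ 2 / 2))
        * (Real.exp (|lam| * z.1 ^ 2 / 2) * laguerre α m 0)) := by gcongr
    _ = 1 := by rw [← mul_assoc (Real.exp _), ← Real.exp_add]; simp; field_simp

/-! ### Orthogonality and generating function of Laguerre polynomials -/

/-- The coefficient of `u ^ k` in `laguerre α m u`. -/
def laguerreCoeff (α : ℝ) (m k : ℕ) : ℝ :=
  (-1) ^ k * (Real.Gamma (m + α + 1) / (Real.Gamma (k + α + 1) * (m - k).factorial)) / k.factorial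

lemma laguerre_eq_sum_coeff (α : ℝ) (m : ℕ) (u : ℝ) :
    laguerre α m u = ∑ k ∈ Finset.range (m + 1), laguerreCoeff α m k * u ^ k := by
  refine Finset.sum_congr rfl fun k _ => ?_
  rw [laguerreCoeff]; ring

/-- These are the moments of the Laguerre polynomial against u^α e^{-u}. As Γ(α+1+k+j)/Γ(α+1+k) is a
monic polynomial of degree j in k, the alternating sum is an m-th finite difference: zero for j < m
and m! for j = m, up to the prefactor. -/
lemma sum_laguerreCoeff_mul_Gamma {α : ℝ} (hα : 0 ≤ α) (m j : ℕ) (hj : j ≤ m) :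
    ∑ k ∈ Finset.range (m + 1), laguerreCoeff α m k * Real.Gamma (α + 1 + k + j)
      = if j = m then (-1) ^ m * Real.Gamma (m + α + 1) else 0 := by
  have hm : (m.factorial : ℝ) ≠ 0 := by positivity
  have key : ∑ k ∈ Finset.range (m + 1), laguerreCoeff α m k * Real.Gamma (α + 1 + k + j) =
      (-1) ^ m * Real.Gamma (m + α + 1) / m.factorial *
        (fwdDiff 1)^[m] (ascPochhammer ℝ j).eval (α + 1) := by
    rw [fwdDiff_iter_eq_sum_shift, Finset.mul_sum]
    refine Finset.sum_congr rfl fun k hk => ?_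
    have hk : k ≤ m := by simpa [Nat.lt_succ_iff] using hk
    have hG := (Real.Gamma_pos_of_pos (by positivity : 0 < α + 1 + k)).ne'
    rw [Gamma_add_nat (by positivity), laguerreCoeff, show (k : ℝ) + α + 1 = α + 1 + k by ring,
      zsmul_eq_mul, nsmul_one]
    push_cast
    rw [Nat.cast_choose ℝ hk]
    have h1 : (-1 : ℝ) ^ m * (-1) ^ (m - k) = (-1) ^ k := by
      rw [← pow_add, show m + (m - k) = k + 2 * (m - k) by lia, pow_add, pow_mul]; simp
    rw [← h1]
    field_simp
  rw [key]
  split_ifs with h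
  · subst h
    have := Polynomial.fwdDiff_iter_degree_eq_factorial (ascPochhammer ℝ j)
    rw [ascPochhammer_natDegree, (monic_ascPochhammer ℝ j).leadingCoeff] at this
    rw [this]
    simp [hm]
  · rw [Polynomial.fwdDiff_iter_eq_zero_of_degree_lt
      (by rw [ascPochhammer_natDegree]; lia)]
    simp

lemma sum_laguerreCoeff_bilinear {α : ℝ} (hα : 0 ≤ α) (m n : ℕ) :
    ∑ k ∈ Finset.range (m + 1), ∑ j ∈ Finset.range (n + 1),
      laguerreCoeff α m k * laguerreCoeff α n j * Real.Gamma (α + 1 + k + j)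
      = if m = n then Real.Gamma (m + α + 1) / m.factorial else 0 := by
  -- By symmetry the lower degree may be expanded into monomials; only the monomial of degree m can
  -- then survive.
  wlog h : n ≤ m generalizing m n
  · rw [Finset.sum_comm]
    have := this n m (by lia)
    rw [show (if m = n then Real.Gamma (m + α + 1) / (m.factorial : ℝ) else 0) =
      if n = m then Real.Gamma (m + α + 1) / (m.factorial : ℝ) else 0 by
        simp only [eq_comm (a := m)], show (if n = m then Real.Gamma (m + α + 1) / (m.factorial : ℝ) else 0) =
      if n = m then Real.Gamma (n + α + 1) / (n.factorial : ℝ) else 0 by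
        split_ifs with h' <;> simp [h'], ← this]
    refine Finset.sum_congr rfl fun j _ => Finset.sum_congr rfl fun k _ => ?_
    rw [show α + 1 + (k : ℝ) + j = α + 1 + j + k by ring]; ring
  · rw [Finset.sum_comm]
    have h1 : ∀ j ∈ Finset.range (n + 1), ∑ k ∈ Finset.range (m + 1),
        laguerreCoeff α m k * laguerreCoeff α n j * Real.Gamma (α + 1 + k + j) =
        if j = m then laguerreCoeff α n j * ((-1) ^ m * Real.Gamma (m + α + 1)) else 0 := by
      intro j hj
      have hj : j ≤ n := by simpa [Nat.lt_succ_iff] using hj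
      rw [← mul_ite_zero, ← sum_laguerreCoeff_mul_Gamma hα m j (hj.trans h), Finset.mul_sum]
      exact Finset.sum_congr rfl fun k _ => by ring
    rw [Finset.sum_congr rfl h1, Finset.sum_ite_eq']
    have hG := (Real.Gamma_pos_of_pos (by positivity : 0 < (m : ℝ) + α + 1)).ne'
    by_cases hmn : m = n
    · subst hmn
      rw [if_pos (by simp), if_pos rfl, laguerreCoeff, Nat.sub_self]
      have : (-1 : ℝ) ^ m * (-1) ^ m = 1 := by rw [← mul_pow]; simp
      simp only [Nat.factorial_zero, Nat.cast_one, mul_one]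
      rw [div_self hG]
      linear_combination (Real.Gamma (m + α + 1) / m.factorial) * this
    · rw [if_neg (by simp; lia), if_neg hmn]

lemma integral_rpow_mul_exp {α : ℝ} (hα : 0 ≤ α) {b : ℝ} (hb : 0 < b) (k : ℕ) :
    IntegrableOn (fun x : ℝ => x ^ (2 * α + 1) * Real.exp (-(b * x ^ 2)) * (b * x ^ 2) ^ k)
        (Set.Ioi 0) ∧
      ∫ x in Set.Ioi (0 : ℝ), x ^ (2 * α + 1) * Real.exp (-(b * x ^ 2)) * (b * x ^ 2) ^ k
        = b ^ (-(α + 1)) / 2 * Real.Gamma (α + 1 + k) := by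
  have hcongr : Set.EqOn (fun x : ℝ => b ^ k * (x ^ (2 * α + 1 + 2 * k) * Real.exp (-b * x ^ (2 : ℝ))))
      (fun x : ℝ => x ^ (2 * α + 1) * Real.exp (-(b * x ^ 2)) * (b * x ^ 2) ^ k) (Set.Ioi 0) := by
    intro x hx
    have hx : 0 < x := hx
    simp only
    rw [Real.rpow_two, Real.rpow_add hx, show (2 * k : ℝ) = (2 * k : ℕ) by push_cast; rfl,
      Real.rpow_natCast, pow_mul, mul_pow, neg_mul]
    ring
  constructor
  · refine IntegrableOn.congr_fun ?_ hcongr measurableSet_Ioi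
    refine Integrable.const_mul ?_ _
    exact integrableOn_rpow_mul_exp_neg_mul_rpow (by linarith [(k.cast_nonneg : (0:ℝ) ≤ k)]) two_pos hb
  · rw [← setIntegral_congr_fun measurableSet_Ioi hcongr, integral_const_mul,
      integral_rpow_mul_exp_neg_mul_rpow two_pos (by linarith [(k.cast_nonneg : (0:ℝ) ≤ k)]) hb,
      show -(2 * α + 1 + 2 * (k : ℝ) + 1) / 2 = -(α + 1) - k by ring,
      show (2 * α + 1 + 2 * (k : ℝ) + 1) / 2 = α + 1 + k by ring, Real.rpow_sub hb,
      Real.rpow_natCast]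
    field_simp

lemma integral_laguerre_mul_laguerre {α : ℝ} (hα : 0 ≤ α) {b : ℝ} (hb : 0 < b) (m n : ℕ) :
    IntegrableOn (fun x : ℝ => x ^ (2 * α + 1) * Real.exp (-(b * x ^ 2))
        * (laguerre α m (b * x ^ 2) * laguerre α n (b * x ^ 2))) (Set.Ioi 0) ∧
      ∫ x in Set.Ioi (0 : ℝ), x ^ (2 * α + 1) * Real.exp (-(b * x ^ 2))
        * (laguerre α m (b * x ^ 2) * laguerre α n (b * x ^ 2))
        = if m = n then b ^ (-(α + 1)) / 2 * (Real.Gamma (m + α + 1) / m.factorial) else 0 := by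
  have hexp : ∀ x : ℝ, x ^ (2 * α + 1) * Real.exp (-(b * x ^ 2))
        * (laguerre α m (b * x ^ 2) * laguerre α n (b * x ^ 2)) =
      ∑ k ∈ Finset.range (m + 1), ∑ j ∈ Finset.range (n + 1),
        laguerreCoeff α m k * laguerreCoeff α n j *
          (x ^ (2 * α + 1) * Real.exp (-(b * x ^ 2)) * (b * x ^ 2) ^ (k + j)) := by
    intro x
    rw [laguerre_eq_sum_coeff, laguerre_eq_sum_coeff, Finset.sum_mul_sum, Finset.mul_sum]
    refine Finset.sum_congr rfl fun k _ => ?_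
    rw [Finset.mul_sum]
    refine Finset.sum_congr rfl fun j _ => ?_
    rw [pow_add]; ring
  have hint := fun k => (integral_rpow_mul_exp hα hb k).1
  have hval := fun k => (integral_rpow_mul_exp hα hb k).2
  simp only [hexp]
  constructor
  · exact integrable_finsetSum _ fun k _ => integrable_finsetSum _ fun j _ =>
      (hint (k + j)).const_mul _
  · rw [integral_finsetSum _ fun k _ => integrable_finsetSum _ fun j _ =>
      (hint (k + j)).const_mul _]
    simp only [integral_finsetSum _ fun j _ => (hint (_ + j)).const_mul _, integral_const_mul, hval]
    rw [← mul_ite_zero, ← sum_laguerreCoeff_bilinear hα, Finset.mul_sum]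
    refine Finset.sum_congr rfl fun k _ => ?_
    rw [Finset.mul_sum]
    refine Finset.sum_congr rfl fun j _ => ?_
    push_cast
    rw [add_assoc (α + 1) (k : ℝ)]
    ring

lemma hasSum_risingBinom (a : ℝ) {r : ℂ} (hr : ‖r‖ < 1) :
    HasSum (fun n => (risingBinom a n : ℂ) * r ^ n) (1 / (1 - r) ^ (a : ℂ)) := by
  have h := (Complex.one_div_one_sub_cpow_hasFPowerSeriesOnBall_zero a).hasSum (y := r)
    (by simpa [enorm_eq_nnnorm, ← NNReal.coe_lt_coe] using hr)
  simp only [FormalMultilinearSeries.ofScalars_apply_eq, zero_add] at h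
  have hcoef : ∀ n : ℕ, (risingBinom a n : ℂ) * r ^ n = Ring.choose ((a : ℂ) + n - 1) n • r ^ n := by
    intro n
    rw [← Ring.multichoose_eq, smul_eq_mul]
    congr 1
    have h1 := Ring.factorial_nsmul_multichoose_eq_ascPochhammer (a : ℂ) n
    have hn : (n.factorial : ℂ) ≠ 0 := by exact_mod_cast Nat.factorial_ne_zero n
    rw [nsmul_eq_mul, Polynomial.ascPochhammer_smeval_eq_eval,
      ascPochhammer_eval₂ Complex.ofRealHom n (a : ℂ), ← Complex.ofRealHom_eq_coe,
      Polynomial.eval₂_at_apply] at h1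
    rw [risingBinom, Complex.ofReal_div, Complex.ofReal_natCast, div_eq_iff hn, mul_comm]
    exact h1.symm
  simpa only [hcoef] using h

lemma hasSum_risingBinom_real (a : ℝ) {r : ℝ} (h0 : 0 ≤ r) (h1 : r < 1) :
    HasSum (fun n => risingBinom a n * r ^ n) (1 / (1 - r) ^ a) := by
  have h := hasSum_risingBinom a (r := (r : ℂ)) (by simpa [abs_of_nonneg h0] using h1)
  rw [← Complex.hasSum_ofReal]
  have hv : (1 / (1 - (r : ℂ)) ^ (a : ℂ)) = ((1 / (1 - r) ^ a : ℝ) : ℂ) := by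
    rw [Complex.ofReal_div, Complex.ofReal_cpow (by linarith)]
    push_cast; rfl
  rw [← hv]
  simpa using h

/-- The generating function of the Laguerre polynomials. -/
lemma hasSum_laguerre {α : ℝ} (hα : 0 ≤ α) {r : ℂ} (hr : ‖r‖ < 1) (u : ℝ) :
    HasSum (fun m => (laguerre α m u : ℂ) * r ^ m)
      (1 / (1 - r) ^ ((α + 1 : ℝ) : ℂ) * Complex.exp (-(u * r / (1 - r)))) := by
  have hr1 : (1 : ℂ) - r ≠ 0 := by
    intro h
    rw [← sub_eq_zero.1 h] at hr
    simp at hr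
  -- Summed over the second index first, this family gives binomial series and then an exponential
  -- series; summed along antidiagonals it gives the Laguerre series. The same computation with ‖r‖
  -- and |u| gives absolute summability.
  let F : ℕ × ℕ → ℂ := fun x =>
    ((-u * r) ^ x.1 / x.1.factorial) * (risingBinom (α + 1 + x.1) x.2 * r ^ x.2)
  have hrow : ∀ k : ℕ, HasSum (fun j => F (k, j))
      (((-u * r / (1 - r)) ^ k / k.factorial) * (1 / (1 - r) ^ ((α + 1 : ℝ) : ℂ))) := by
    intro k
    have := (hasSum_risingBinom (α + 1 + k) hr).mul_left ((-u * r) ^ k / k.factorial : ℂ)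
    have hv : (-u * r / (1 - r)) ^ k / k.factorial * (1 / (1 - r) ^ ((α + 1 : ℝ) : ℂ)) =
        (-u * r) ^ k / k.factorial * (1 / (1 - r) ^ ((α + 1 + k : ℝ) : ℂ)) := by
      rw [Complex.ofReal_add (α + 1) k, Complex.cpow_add _ _ hr1, Complex.ofReal_natCast,
        Complex.cpow_natCast, div_pow]
      field_simp
    rw [hv]
    exact this
  have hsum : Summable F := by
    rw [← summable_norm_iff, summable_prod_of_nonneg (fun _ => norm_nonneg _)]
    have hrow' : ∀ k : ℕ, HasSum (fun j => ‖F (k, j)‖)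
        ((|u| * ‖r‖ / (1 - ‖r‖)) ^ k / k.factorial * (1 / (1 - ‖r‖) ^ (α + 1))) := by
      intro k
      have := (hasSum_risingBinom_real (α + 1 + k) (norm_nonneg r) hr).mul_left
        ((|u| * ‖r‖) ^ k / k.factorial)
      have h0 : 0 < 1 - ‖r‖ := by linarith
      have hv : (|u| * ‖r‖ / (1 - ‖r‖)) ^ k / k.factorial * (1 / (1 - ‖r‖) ^ (α + 1)) =
          (|u| * ‖r‖) ^ k / k.factorial * (1 / (1 - ‖r‖) ^ (α + 1 + k)) := by
        rw [Real.rpow_add h0 (α + 1) k, Real.rpow_natCast, div_pow]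
        field_simp
      rw [hv]
      refine this.congr_fun fun j => ?_
      simp [F, abs_of_nonneg (risingBinom_nonneg (by positivity : 0 ≤ α + 1 + k) j)]
    refine ⟨fun k => (hrow' k).summable, ?_⟩
    simp only [fun k => (hrow' k).tsum_eq]
    exact (Real.summable_pow_div_factorial _).mul_right _
  have htot : HasSum F (1 / (1 - r) ^ ((α + 1 : ℝ) : ℂ) * Complex.exp (-(u * r / (1 - r)))) := by
    have h1 := hsum.hasSum.prod_fiberwise hrow
    have h2 : HasSum (fun k : ℕ => ((-u * r / (1 - r)) ^ k / k.factorial)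
        * (1 / (1 - r) ^ ((α + 1 : ℝ) : ℂ)))
        (Complex.exp (-(u * r / (1 - r))) * (1 / (1 - r) ^ ((α + 1 : ℝ) : ℂ))) := by
      refine HasSum.mul_right _ ?_
      rw [show -(u * r / (1 - r)) = -u * r / (1 - r) by ring, Complex.exp_eq_exp_ℂ]
      exact NormedSpace.expSeries_div_hasSum_exp _
    rw [mul_comm, ← h1.unique h2]
    exact hsum.hasSum
  have h3 := (Finset.HasAntidiagonal.sigmaAntidiagonalEquivProd.hasSum_iff.2 htot).sigma
    fun n => hasSum_fintype _
  refine h3.congr_fun fun m => ?_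
  rw [laguerre_eq_sum_antidiagonal hα, Finset.univ_eq_attach]
  refine Eq.trans ?_ (Finset.sum_attach (Finset.HasAntidiagonal.antidiagonal m) F).symm
  push_cast
  rw [Finset.sum_mul]
  refine Finset.sum_congr rfl fun x hx => ?_
  have hx' : x.1 + x.2 = m := Finset.HasAntidiagonal.mem_antidiagonal.1 hx
  simp only [F]
  rw [← hx', pow_add, mul_pow]
  ring

/-! ### Plancherel's theorem on the line -/

lemma eLpNorm_two_sq {X E : Type*} [MeasurableSpace X] [NormedAddCommGroup E] (f : X → E)
    (μ : Measure X) : eLpNorm f 2 μ ^ 2 = ∫⁻ x, ‖f x‖ₑ ^ 2 ∂μ := by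
  have := eLpNorm_nnreal_pow_eq_lintegral (μ := μ) (f := f) (p := 2) two_ne_zero
  simpa using this

lemma eLpNorm_two_le_of_sq_le {X Y E F : Type*} [MeasurableSpace X] [NormedAddCommGroup E]
    [MeasurableSpace Y] [NormedAddCommGroup F] {f : X → E} {g : Y → F}
    {μ : Measure X} {ν : Measure Y} (h : ∫⁻ x, ‖f x‖ₑ ^ 2 ∂μ ≤ ∫⁻ x, ‖g x‖ₑ ^ 2 ∂ν) :
    eLpNorm f 2 μ ≤ eLpNorm g 2 ν := by
  rw [← eLpNorm_two_sq, ← eLpNorm_two_sq] at h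
  exact (ENNReal.pow_le_pow_left_iff two_ne_zero).1 h

-- For functions in L¹ ∩ L² the Fourier integral has to be identified with the abstract L²
-- transform. Both give the same integrals against smooth compactly supported functions, by moving
-- the transform onto the test function.
open scoped FourierTransform SchwartzMap in
lemma eLpNorm_fourier_eq {a : ℝ → ℂ} (h1 : Integrable a) (h2 : MemLp a 2) :
    eLpNorm (𝓕 a) 2 volume = eLpNorm a 2 volume := by
  set A : Lp ℂ 2 (volume : Measure ℝ) := h2.toLp a with hA
  have hAa : A =ᵐ[volume] a := h2.coeFn_toLp
  have hcont : Continuous (𝓕 a) :=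
    VectorFourier.fourierIntegral_continuous Real.continuous_fourierChar
      (by exact continuous_inner) h1
  have hae : ∀ᵐ x ∂(volume : Measure ℝ), (𝓕 A : Lp ℂ 2 (volume : Measure ℝ)) x = 𝓕 a x := by
    refine ae_eq_of_integral_contDiff_smul_eq
      ((Lp.memLp _).locallyIntegrable (by norm_num)) hcont.locallyIntegrable fun g hg hgc => ?_
    have hg' : ContDiff ℝ ((⊤ : ℕ∞) : WithTop ℕ∞) fun x => (g x : ℂ) :=
      Complex.ofRealCLM.contDiff.comp hg
    have hgc' : HasCompactSupport fun x => (g x : ℂ) :=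
      hgc.comp_left (g := fun y : ℝ => (y : ℂ)) (by simp)
    let G : 𝓢(ℝ, ℂ) := hgc'.toSchwartzMap hg'
    have hG : ∀ x, G x = (g x : ℂ) := fun x => rfl
    have e1 : ∫ x, G x • (𝓕 A : Lp ℂ 2 (volume : Measure ℝ)) x = ∫ x, (𝓕 G) x • A x := by
      rw [← Lp.toTemperedDistribution_apply, ← Lp.toTemperedDistribution_apply,
        ← Lp.fourier_toTemperedDistribution_eq]
      rfl
    have e2 : ∫ x, (𝓕 G) x • A x = ∫ x, (𝓕 G) x • a x :=
      integral_congr_ae (hAa.mono fun x hx => by simp only [hx])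
    have e3 : ∫ x, (𝓕 G) x • a x = ∫ x, G x • 𝓕 a x := by
      rw [SchwartzMap.fourier_coe]
      have h := VectorFourier.integral_fourierIntegral_smul_eq_flip (L := innerₗ ℝ)
        Real.continuous_fourierChar (by exact continuous_inner) (G.integrable (μ := volume)) h1
      rw [flip_innerₗ] at h
      exact h
    have e4 := e1.trans (e2.trans e3)
    simpa [hG, Complex.real_smul] using e4
  rw [← eLpNorm_congr_ae hae, ← eLpNorm_congr_ae hAa]
  have := Lp.norm_fourier_eq A
  rw [Lp.norm_def, Lp.norm_def] at this
  exact (ENNReal.toReal_eq_toReal_iff' (Lp.eLpNorm_ne_top _) (Lp.eLpNorm_ne_top _)).1 this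

/-- The unnormalised inverse Fourier integral on the line. -/
def invFourier (a : ℝ → ℂ) (t : ℝ) : ℂ := ∫ lam : ℝ, a lam * Complex.exp (Complex.I * lam * t)

open scoped FourierTransform in
lemma invFourier_eq_fourier (a : ℝ → ℂ) (t : ℝ) :
    invFourier a t = 𝓕 a (-(2 * Real.pi)⁻¹ * t) := by
  rw [invFourier, Real.fourier_real_eq_integral_exp_smul]
  refine integral_congr_ae (ae_of_all _ fun lam => ?_)
  simp only [smul_eq_mul]
  rw [mul_comm]
  congr 2
  have : (Real.pi : ℂ) ≠ 0 := by exact_mod_cast Real.pi_ne_zero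
  push_cast
  field_simp

lemma continuous_invFourier {a : ℝ → ℂ} (h1 : Integrable a) : Continuous (invFourier a) := by
  have hcont : Continuous (FourierTransform.fourier a) :=
    VectorFourier.fourierIntegral_continuous Real.continuous_fourierChar
      (by exact continuous_inner) h1
  have : invFourier a = fun t => FourierTransform.fourier a (-(2 * Real.pi)⁻¹ * t) :=
    funext fun t => invFourier_eq_fourier a t
  rw [this]
  exact hcont.comp (by fun_prop)

lemma norm_invFourier_le (a : ℝ → ℂ) (t : ℝ) : ‖invFourier a t‖ ≤ ∫ lam, ‖a lam‖ := by
  refine (norm_integral_le_integral_norm _).trans (le_of_eq ?_)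
  refine integral_congr_ae (ae_of_all _ fun lam => ?_)
  simp only [norm_mul]
  rw [show Complex.I * lam * t = ((lam * t : ℝ) : ℂ) * Complex.I by push_cast; ring,
    Complex.norm_exp_ofReal_mul_I, mul_one]

lemma lintegral_invFourier_sq {a : ℝ → ℂ} (h1 : Integrable a) (h2 : MemLp a 2) :
    ∫⁻ t, ‖invFourier a t‖ₑ ^ 2 = ENNReal.ofReal (2 * Real.pi) * ∫⁻ lam, ‖a lam‖ₑ ^ 2 := by
  have hc : -(2 * Real.pi)⁻¹ ≠ 0 := by simp [Real.pi_ne_zero]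
  have hme : MeasurableEmbedding fun t : ℝ => -(2 * Real.pi)⁻¹ * t :=
    (Homeomorph.mulLeft₀ _ hc).measurableEmbedding
  simp only [invFourier_eq_fourier]
  rw [← hme.lintegral_map (fun y => ‖FourierTransform.fourier a y‖ₑ ^ 2), Real.map_volume_mul_left hc, lintegral_smul_measure,
    ← eLpNorm_two_sq, eLpNorm_fourier_eq h1 h2, eLpNorm_two_sq, smul_eq_mul]
  congr 2
  rw [inv_neg, inv_inv, abs_neg, abs_of_pos (by positivity)]

/-! ### The two measures -/

instance (α : ℝ) : SFinite (haar α) := by unfold haar; infer_instance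

instance (α : ℝ) : SFinite (plancherel α) := by unfold plancherel; infer_instance

/-- The radial factor of the measure `haar α`. -/
def radialMeasure (α : ℝ) : Measure ℝ :=
  ((volume : Measure ℝ).restrict (Set.Ici 0)).withDensity
    fun x => ENNReal.ofReal (x ^ (2 * α + 1) / (Real.pi * Real.Gamma (α + 1)))

instance (α : ℝ) : SFinite (radialMeasure α) := by unfold radialMeasure; infer_instance

lemma haar_eq_prod (α : ℝ) : haar α = (radialMeasure α).prod volume := by
  rw [radialMeasure, prod_withDensity_left (by fun_prop), haar,
    Measure.volume_eq_prod, ← Measure.prod_restrict, Measure.restrict_univ]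

lemma continuous_laguerre (α : ℝ) (m : ℕ) : Continuous (laguerre α m) := by
  unfold laguerre; fun_prop

lemma continuous_laguerreFun (α : ℝ) (m : ℕ) :
    Continuous fun q : ℝ × (ℝ × ℝ) => laguerreFun α q.1 m q.2 := by
  have := continuous_laguerre α m
  unfold laguerreFun
  fun_prop

lemma measurable_of_continuous_section {F : ℝ → ℕ → ℝ × ℝ → ℂ}
    (hF : ∀ m, Continuous fun q : ℝ × (ℝ × ℝ) => F q.1 m q.2) :
    Measurable fun q : (ℝ × ℕ) × (ℝ × ℝ) => F q.1.1 q.1.2 q.2 := by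
  have h : Measurable fun q : (ℝ × (ℝ × ℝ)) × ℕ => F q.1.1 q.2 q.1.2 :=
    measurable_from_prod_countable_left fun m => (hF m).measurable
  exact h.comp (((measurable_fst.comp measurable_fst).prodMk measurable_snd).prodMk
    (measurable_snd.comp measurable_fst))

lemma measurable_laguerreFun (α : ℝ) :
    Measurable fun q : (ℝ × ℕ) × (ℝ × ℝ) => laguerreFun α q.1.1 q.1.2 q.2 :=
  measurable_of_continuous_section (continuous_laguerreFun α)

lemma measurable_plancherel_density (α : ℝ) :
    Measurable fun w : ℝ × ℕ => laguerre α w.2 0 * |w.1| ^ (α + 1) := by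
  refine measurable_from_prod_countable_left fun m => ?_
  fun_prop

lemma conj_laguerreFun (α lam : ℝ) (m : ℕ) (z : ℝ × ℝ) :
    (starRingEnd ℂ) (laguerreFun α lam m z) = laguerreFun α (-lam) m z := by
  rw [laguerreFun, laguerreFun, map_mul, map_mul, Complex.conj_ofReal, Complex.conj_ofReal,
    ← Complex.exp_conj]
  simp

lemma integral_count_nat {f : ℕ → ℂ} (hf : Integrable f Measure.count) :
    ∫ m, f m ∂Measure.count = ∑' m, f m := by
  rw [integral_countable hf]
  simp [measureReal_def]

lemma lintegral_plancherel (α : ℝ) {F : ℝ × ℕ → ℝ≥0∞} (hF : Measurable F) :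
    ∫⁻ w, F w ∂(plancherel α) =
      ∫⁻ lam : ℝ, ∑' m : ℕ, ENNReal.ofReal (laguerre α m 0 * |lam| ^ (α + 1)) * F (lam, m) := by
  have hd := (measurable_plancherel_density α).ennreal_ofReal
  rw [plancherel, lintegral_withDensity_eq_lintegral_mul _ hd hF,
    lintegral_prod _ (hd.mul hF).aemeasurable]
  simp only [lintegral_count, Pi.mul_apply]

lemma integral_plancherel {α : ℝ} (hα : 0 ≤ α) {F : ℝ × ℕ → ℂ} (hF : Integrable F (plancherel α)) :
    ∫ w, F w ∂(plancherel α) =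
      ∫ lam : ℝ, ∑' m : ℕ, ((laguerre α m 0 * |lam| ^ (α + 1) : ℝ) : ℂ) * F (lam, m) := by
  have hd := (measurable_plancherel_density α).ennreal_ofReal
  have hd' : ∀ w : ℝ × ℕ, (ENNReal.ofReal (laguerre α w.2 0 * |w.1| ^ (α + 1))).toReal =
      laguerre α w.2 0 * |w.1| ^ (α + 1) := fun w => ENNReal.toReal_ofReal
    (mul_nonneg (laguerre_zero_right_pos hα _).le (by positivity))
  have hF' := hF
  rw [plancherel, integrable_withDensity_iff_integrable_smul' hd (by simp)] at hF'
  simp only [hd'] at hF'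
  rw [plancherel, integral_withDensity_eq_integral_toReal_smul hd (by simp)]
  simp only [hd']
  rw [integral_prod _ hF']
  refine integral_congr_ae ?_
  filter_upwards [hF'.prod_right_ae] with lam hlam
  rw [integral_count_nat hlam]
  simp only [Complex.real_smul]

/-! ### The adjoint transform -/

/-- The adjoint `∫ g φ dγ` of the Fourier–Laguerre transform. -/
def adjointTransform (α : ℝ) (g : ℝ × ℕ → ℂ) (z : ℝ × ℝ) : ℂ :=
  ∫ w, g w * laguerreFun α w.1 w.2 z ∂(plancherel α)

/-- The partial transform in the discrete variable. -/
def slice (α : ℝ) (g : ℝ × ℕ → ℂ) (x lam : ℝ) : ℂ :=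
  ((|lam| ^ (α + 1) * Real.exp (-(|lam| * x ^ 2 / 2)) : ℝ) : ℂ)
    * ∑' m : ℕ, g (lam, m) * laguerre α m (|lam| * x ^ 2)

lemma integrable_mul_laguerreFun {α : ℝ} (hα : 0 ≤ α) {g : ℝ × ℕ → ℂ}
    (hg : Integrable g (plancherel α)) (z : ℝ × ℝ) :
    Integrable (fun w => g w * laguerreFun α w.1 w.2 z) (plancherel α) := by
  refine Integrable.mul_bdd (c := 1) hg ?_ (ae_of_all _ fun w => norm_laguerreFun_le hα _ _ _)
  exact ((measurable_laguerreFun α).comp (measurable_prodMk_right (y := z))).aestronglyMeasurable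

/-- The normalisation 1/L_m(0) of φ cancels the weight L_m(0) of the Plancherel measure. The adjoint
transform thus separates into a Laguerre series in m and an inverse Fourier integral in λ. -/
lemma adjointTransform_eq {α : ℝ} (hα : 0 ≤ α) {g : ℝ × ℕ → ℂ}
    (hg : Integrable g (plancherel α)) (z : ℝ × ℝ) :
    adjointTransform α g z = invFourier (slice α g z.1) z.2 := by
  rw [adjointTransform, integral_plancherel hα (integrable_mul_laguerreFun hα hg z), invFourier]
  refine integral_congr_ae (ae_of_all _ fun lam => ?_)
  simp only [slice]
  rw [mul_right_comm, ← tsum_mul_left]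
  refine tsum_congr fun m => ?_
  have h0 : ((laguerre α m 0 : ℝ) : ℂ) ≠ 0 :=
    Complex.ofReal_ne_zero.2 (laguerre_zero_right_pos hα m).ne'
  rw [laguerreFun, normalization_eq hα]
  push_cast
  field_simp

lemma adjointTransform_norm_le {α : ℝ} (hα : 0 ≤ α) {g : ℝ × ℕ → ℂ}
    (hg : Integrable g (plancherel α)) (z : ℝ × ℝ) :
    ‖adjointTransform α g z‖ ≤ ∫ w, ‖g w‖ ∂(plancherel α) := by
  refine (norm_integral_le_integral_norm _).trans (integral_mono_of_nonneg
    (ae_of_all _ fun _ => norm_nonneg _) hg.norm (ae_of_all _ fun w => ?_))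
  simp only [norm_mul]
  exact mul_le_of_le_one_right (norm_nonneg _) (norm_laguerreFun_le hα _ _ _)

lemma stronglyMeasurable_adjointTransform (α : ℝ) {g : ℝ × ℕ → ℂ} (hg : Measurable g) :
    StronglyMeasurable (adjointTransform α g) := by
  refine StronglyMeasurable.integral_prod_left (f := fun w z => g w * laguerreFun α w.1 w.2 z) ?_
  exact ((hg.comp measurable_fst).mul (measurable_laguerreFun α)).stronglyMeasurable

/-- Bounded measurable functions of bounded support on the dual. -/
structure IsTest (g : ℝ × ℕ → ℂ) : Prop where
  measurable : Measurable g
  bounded : ∃ C : ℝ, ∀ w, ‖g w‖ ≤ C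
  support : ∃ N : ℕ, ∀ w, g w ≠ 0 → |w.1| ≤ N ∧ w.2 ≤ N

/-- An exhausting sequence of sets of finite Plancherel measure. -/
def box (N : ℕ) : Set (ℝ × ℕ) := {w | |w.1| ≤ N ∧ w.2 ≤ N}

lemma measurableSet_box (N : ℕ) : MeasurableSet (box N) := by
  exact (measurableSet_le (continuous_abs.measurable.comp measurable_fst) measurable_const).inter
    (measurableSet_le measurable_snd measurable_const)

lemma plancherel_box_lt_top {α : ℝ} (hα : 0 ≤ α) (N : ℕ) : plancherel α (box N) < ∞ := by
  rw [plancherel, withDensity_apply _ (measurableSet_box N)]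
  have hb : ((volume : Measure ℝ).prod (Measure.count : Measure ℕ)) (box N) < ∞ := by
    have : box N = Set.Icc (-(N : ℝ)) N ×ˢ Set.Iic N := by
      ext w; simp [box, abs_le]
    rw [this, Measure.prod_prod, Real.volume_Icc]
    exact ENNReal.mul_lt_top ENNReal.ofReal_lt_top
      (Measure.count_apply_lt_top.2 (Set.finite_Iic N))
  refine (setLIntegral_mono' (g := fun _ => ENNReal.ofReal
    ((∑ m ∈ Finset.range (N + 1), laguerre α m 0) * (N : ℝ) ^ (α + 1))) (measurableSet_box N)
    fun w hw => ?_).trans_lt ?_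
  · refine ENNReal.ofReal_le_ofReal (mul_le_mul ?_ ?_ (by positivity) ?_)
    · exact Finset.single_le_sum (f := fun m => laguerre α m 0)
        (fun m _ => (laguerre_zero_right_pos hα m).le) (by simpa [Nat.lt_succ_iff] using hw.2)
    · exact Real.rpow_le_rpow (abs_nonneg _) hw.1 (by positivity)
    · exact Finset.sum_nonneg fun m _ => (laguerre_zero_right_pos hα m).le
  · rw [setLIntegral_const]
    exact ENNReal.mul_lt_top ENNReal.ofReal_lt_top hb

lemma IsTest.memLp {α : ℝ} (hα : 0 ≤ α) {g : ℝ × ℕ → ℂ} (hg : IsTest g) (p : ℝ≥0∞) :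
    MemLp g p (plancherel α) := by
  obtain ⟨C, hC⟩ := hg.bounded
  obtain ⟨N, hN⟩ := hg.support
  have h : (box N).indicator g = g := by
    rw [Set.indicator_eq_self]
    exact fun w hw => hN w hw
  rw [← h, memLp_indicator_iff_restrict (measurableSet_box N)]
  have : IsFiniteMeasure ((plancherel α).restrict (box N)) :=
    ⟨by rw [Measure.restrict_apply_univ]; exact plancherel_box_lt_top hα N⟩
  exact MemLp.of_bound hg.measurable.aestronglyMeasurable C (ae_of_all _ hC)

lemma IsTest.integrable {α : ℝ} (hα : 0 ≤ α) {g : ℝ × ℕ → ℂ} (hg : IsTest g) :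
    Integrable g (plancherel α) := memLp_one_iff_integrable.1 (hg.memLp hα 1)

lemma IsTest.tsum_eq {α : ℝ} {g : ℝ × ℕ → ℂ} {N : ℕ} (hN : ∀ w, g w ≠ 0 → |w.1| ≤ N ∧ w.2 ≤ N)
    (lam u : ℝ) : ∑' m : ℕ, g (lam, m) * (laguerre α m u : ℂ) =
      ∑ m ∈ Finset.range (N + 1), g (lam, m) * (laguerre α m u : ℂ) := by
  refine tsum_eq_sum fun m hm => ?_
  have : g (lam, m) = 0 := by
    by_contra h
    have := (hN _ h).2
    simp at hm
    lia
  rw [this, zero_mul]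

lemma IsTest.measurable_slice {α : ℝ} {g : ℝ × ℕ → ℂ} (hg : IsTest g) :
    Measurable fun q : ℝ × ℝ => slice α g q.1 q.2 := by
  obtain ⟨N, hN⟩ := hg.support
  simp only [slice, IsTest.tsum_eq hN]
  have h1 : ∀ m, Measurable fun q : ℝ × ℝ => g (q.2, m) := fun m =>
    hg.measurable.comp (measurable_snd.prodMk measurable_const)
  have h2 : ∀ m, Measurable fun q : ℝ × ℝ => laguerre α m (|q.2| * q.1 ^ 2) := fun m =>
    (continuous_laguerre α m).measurable.comp (by fun_prop)
  refine Measurable.mul (by fun_prop) ?_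
  exact Finset.measurable_sum _ fun m _ => (h1 m).mul (Complex.measurable_ofReal.comp (h2 m))

lemma IsTest.memLp_slice {α : ℝ} (hα : 0 ≤ α) {g : ℝ × ℕ → ℂ} (hg : IsTest g) (x : ℝ) (p : ℝ≥0∞) :
    MemLp (slice α g x) p := by
  obtain ⟨C, hC⟩ := hg.bounded
  obtain ⟨N, hN⟩ := hg.support
  have hC0 : 0 ≤ C := (norm_nonneg _).trans (hC 0)
  have h : (Set.Icc (-(N : ℝ)) N).indicator (slice α g x) = slice α g x := by
    rw [Set.indicator_eq_self]
    intro lam hlam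
    by_contra hl
    refine hlam ?_
    have : ∀ m, g (lam, m) = 0 := fun m => by
      by_contra h
      exact hl (abs_le.1 (hN _ h).1)
    simp [slice, this]
  rw [← h, memLp_indicator_iff_restrict measurableSet_Icc]
  refine MemLp.of_bound (hg.measurable_slice.comp
    (measurable_prodMk_left (x := x))).aestronglyMeasurable
    ((N : ℝ) ^ (α + 1) * ∑ m ∈ Finset.range (N + 1), C * laguerre α m 0) ?_
  refine (ae_restrict_iff' measurableSet_Icc).2 (ae_of_all _ fun lam hlam => ?_)
  have hlam' : |lam| ≤ N := abs_le.2 hlam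
  simp only [slice, IsTest.tsum_eq hN]
  rw [norm_mul, Complex.norm_real, Real.norm_of_nonneg (by positivity), mul_assoc]
  refine mul_le_mul (Real.rpow_le_rpow (abs_nonneg _) hlam' (by positivity)) ?_ (by positivity)
    (by positivity)
  refine (mul_le_mul_of_nonneg_left (norm_sum_le _ _) (Real.exp_pos _).le).trans ?_
  rw [Finset.mul_sum]
  refine Finset.sum_le_sum fun m _ => ?_
  rw [norm_mul, Complex.norm_real, Real.norm_eq_abs]
  have h1 := abs_laguerre_le hα m (u := |lam| * x ^ 2) (by positivity)
  calc _ ≤ Real.exp (-(|lam| * x ^ 2 / 2)) * (C * (Real.exp (|lam| * x ^ 2 / 2) * laguerre α m 0)) := by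
        gcongr; exact hC _
    _ = (Real.exp (-(|lam| * x ^ 2 / 2)) * Real.exp (|lam| * x ^ 2 / 2)) * (C * laguerre α m 0) := by
        ring
    _ = _ := by rw [← Real.exp_add]; simp

/-- At fixed frequency orthogonality removes the mixed terms. The factor 1/(2π) will cancel the 2π
of Plancherel's theorem in t. -/
lemma lintegral_radial_laguerre_sq {α : ℝ} (hα : 0 ≤ α) {b : ℝ} (hb : 0 < b) (c : ℕ → ℂ) (N : ℕ) :
    ∫⁻ x, ‖((Real.exp (-(b * x ^ 2 / 2)) : ℝ) : ℂ)
        * ∑ m ∈ Finset.range N, c m * (laguerre α m (b * x ^ 2) : ℂ)‖ₑ ^ 2 ∂(radialMeasure α) =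
      ENNReal.ofReal (b ^ (-(α + 1)) / (2 * Real.pi) *
        ∑ m ∈ Finset.range N, laguerre α m 0 * ‖c m‖ ^ 2) := by
  have hG := Real.Gamma_pos_of_pos (by positivity : 0 < α + 1)
  have hcont : ∀ m, Continuous fun x : ℝ => laguerre α m (b * x ^ 2) := fun m =>
    (continuous_laguerre α m).comp (by fun_prop)
  have hsq : ∀ x : ℝ, ‖∑ m ∈ Finset.range N, c m * (laguerre α m (b * x ^ 2) : ℂ)‖ ^ 2 =
      ∑ m ∈ Finset.range N, ∑ n ∈ Finset.range N, (c m * (starRingEnd ℂ) (c n)).re *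
        (laguerre α m (b * x ^ 2) * laguerre α n (b * x ^ 2)) := by
    intro x
    rw [← Complex.normSq_eq_norm_sq, ← Complex.ofReal_re (Complex.normSq _), ← Complex.mul_conj,
      map_sum, Finset.sum_mul_sum, Complex.re_sum]
    refine Finset.sum_congr rfl fun m _ => ?_
    rw [Complex.re_sum]
    refine Finset.sum_congr rfl fun n _ => ?_
    rw [map_mul, Complex.conj_ofReal, ← Complex.re_mul_ofReal]
    congr 1
    push_cast
    ring
  let h : ℝ → ℝ := fun x => (Real.pi * Real.Gamma (α + 1))⁻¹ *
    ∑ m ∈ Finset.range N, ∑ n ∈ Finset.range N, (c m * (starRingEnd ℂ) (c n)).re *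
      (x ^ (2 * α + 1) * Real.exp (-(b * x ^ 2))
        * (laguerre α m (b * x ^ 2) * laguerre α n (b * x ^ 2)))
  have hh : ∀ x : ℝ, 0 ≤ x → ENNReal.ofReal (x ^ (2 * α + 1) / (Real.pi * Real.Gamma (α + 1))) *
      ‖((Real.exp (-(b * x ^ 2 / 2)) : ℝ) : ℂ)
        * ∑ m ∈ Finset.range N, c m * (laguerre α m (b * x ^ 2) : ℂ)‖ₑ ^ 2 = ENNReal.ofReal (h x)
      ∧ 0 ≤ h x := by
    intro x hx
    have e : h x = x ^ (2 * α + 1) / (Real.pi * Real.Gamma (α + 1)) *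
        (Real.exp (-(b * x ^ 2 / 2)) * ‖∑ m ∈ Finset.range N, c m * (laguerre α m (b * x ^ 2) : ℂ)‖) ^ 2 := by
      rw [mul_pow, hsq, ← Real.exp_nat_mul]
      simp only [h, Finset.mul_sum]
      refine Finset.sum_congr rfl fun m _ => Finset.sum_congr rfl fun n _ => ?_
      rw [show ((2 : ℕ) : ℝ) * (-(b * x ^ 2 / 2)) = -(b * x ^ 2) by push_cast; ring]
      ring
    refine ⟨?_, by rw [e]; positivity⟩
    rw [e, ENNReal.ofReal_mul (by positivity), ENNReal.ofReal_pow (by positivity), enorm_mul,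
      ENNReal.ofReal_mul (by positivity), ofReal_norm, ← ofReal_norm (Complex.ofReal _),
      Complex.norm_real, Real.norm_of_nonneg (Real.exp_pos _).le]
  have hint := fun m n => (integral_laguerre_mul_laguerre hα hb m n).1
  have hval := fun m n => (integral_laguerre_mul_laguerre hα hb m n).2
  have hInt : IntegrableOn h (Set.Ioi 0) := by
    refine Integrable.const_mul ?_ _
    exact integrable_finsetSum _ fun m _ => integrable_finsetSum _ fun n _ =>
      (hint m n).const_mul _
  rw [radialMeasure, lintegral_withDensity_eq_lintegral_mul _ (by fun_prop) (by fun_prop)]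
  simp only [Pi.mul_apply]
  rw [← restrict_Ioi_eq_restrict_Ici, setLIntegral_congr_fun measurableSet_Ioi
    (fun x hx => (hh x (le_of_lt hx)).1), ← ofReal_integral_eq_lintegral_ofReal hInt
    ((ae_restrict_iff' measurableSet_Ioi).2 (ae_of_all _ fun x hx => (hh x (le_of_lt hx)).2))]
  congr 1
  simp only [h, integral_const_mul]
  rw [integral_finsetSum _ fun m _ => integrable_finsetSum _ fun n _ => (hint m n).const_mul _]
  simp only [integral_finsetSum _ fun n _ => (hint _ n).const_mul _, integral_const_mul, hval]
  simp only [mul_ite, mul_zero, Finset.sum_ite_eq]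
  rw [Finset.mul_sum, Finset.mul_sum]
  refine Finset.sum_congr rfl fun m hm => ?_
  rw [if_pos hm, laguerre_zero_right hα, ← Gamma_div_eq_risingBinom (by positivity),
    Complex.mul_conj, Complex.ofReal_re, Complex.normSq_eq_norm_sq,
    show α + 1 + (m : ℝ) = m + α + 1 by ring]
  have hpi := Real.pi_pos.ne'
  field_simp

/-- The adjoint transform is isometric on test functions. -/
lemma IsTest.lintegral_adjointTransform_sq {α : ℝ} (hα : 0 ≤ α) {g : ℝ × ℕ → ℂ} (hg : IsTest g) :
    ∫⁻ z, ‖adjointTransform α g z‖ₑ ^ 2 ∂(haar α) = ∫⁻ w, ‖g w‖ₑ ^ 2 ∂(plancherel α) := by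
  obtain ⟨N, hN⟩ := hg.support
  have hmeas := (stronglyMeasurable_adjointTransform α hg.measurable).measurable
  have hsl := hg.measurable_slice (α := α)
  rw [haar_eq_prod, lintegral_prod _ (by fun_prop)]
  simp only [adjointTransform_eq hα (hg.integrable hα)]
  simp only [fun x => lintegral_invFourier_sq
    (memLp_one_iff_integrable.1 (hg.memLp_slice hα x 1)) (hg.memLp_slice hα x 2)]
  have hsl2 : Measurable fun x => ∫⁻ lam, ‖slice α g x lam‖ₑ ^ 2 :=
    Measurable.lintegral_prod_right' (f := fun q : ℝ × ℝ => ‖slice α g q.1 q.2‖ₑ ^ 2) (by fun_prop)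
  have hsl3 : Measurable fun lam => ∫⁻ x, ‖slice α g x lam‖ₑ ^ 2 ∂(radialMeasure α) :=
    Measurable.lintegral_prod_left' (f := fun q : ℝ × ℝ => ‖slice α g q.1 q.2‖ₑ ^ 2) (by fun_prop)
  -- After Plancherel in t, the x-integral is done at fixed λ. The powers combine to |λ|^{2(α+1)}
  -- |λ|^{-(α+1)} = |λ|^{α+1}, the Plancherel density.
  rw [lintegral_const_mul _ hsl2, lintegral_lintegral_swap (by
    exact (hsl.enorm.pow_const 2).aemeasurable),
    ← lintegral_const_mul _ hsl3, lintegral_plancherel α (by have := hg.measurable; fun_prop)]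
  refine lintegral_congr_ae ?_
  -- The radial formula needs a positive frequency, so the null set λ = 0 is discarded.
  filter_upwards [compl_mem_ae_iff.2 (measure_singleton (0 : ℝ))] with lam hlam
  have hb : 0 < |lam| := abs_pos.2 hlam
  have hfac : ∀ x, ‖slice α g x lam‖ₑ ^ 2 = ENNReal.ofReal ((|lam| ^ (α + 1)) ^ 2) *
      ‖((Real.exp (-(|lam| * x ^ 2 / 2)) : ℝ) : ℂ)
        * ∑ m ∈ Finset.range (N + 1), g (lam, m) * (laguerre α m (|lam| * x ^ 2) : ℂ)‖ₑ ^ 2 := by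
    intro x
    rw [slice, IsTest.tsum_eq hN, Complex.ofReal_mul, mul_assoc, enorm_mul, mul_pow,
      ENNReal.ofReal_pow (by positivity), ← ofReal_norm (Complex.ofReal _),
      Complex.norm_real, Real.norm_of_nonneg (by positivity)]
  simp only [hfac]
  have hcont : ∀ m, Continuous fun x : ℝ => laguerre α m (|lam| * x ^ 2) := fun m =>
    (continuous_laguerre α m).comp (by fun_prop)
  rw [lintegral_const_mul _ (by fun_prop), lintegral_radial_laguerre_sq hα hb,
    ← ENNReal.ofReal_mul (by positivity), ← ENNReal.ofReal_mul (by positivity)]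
  rw [tsum_eq_sum (s := Finset.range (N + 1))]
  · have hnn : ∀ m, 0 ≤ laguerre α m 0 * |lam| ^ (α + 1) := fun m =>
      mul_nonneg (laguerre_zero_right_pos hα _).le (by positivity)
    simp only [← ofReal_norm, ← ENNReal.ofReal_pow (norm_nonneg _),
      fun m => ENNReal.ofReal_mul (hnn m) (q := ‖g (lam, m)‖ ^ 2) |>.symm]
    rw [← ENNReal.ofReal_sum_of_nonneg fun m _ => mul_nonneg (hnn m) (by positivity)]
    congr 1
    rw [Real.rpow_neg hb.le, Finset.mul_sum, Finset.mul_sum, Finset.mul_sum]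
    refine Finset.sum_congr rfl fun m _ => ?_
    have hpi := Real.pi_pos.ne'
    have : |lam| ^ (α + 1) ≠ 0 := by positivity
    field_simp
  · intro m hm
    have : g (lam, m) = 0 := by
      by_contra h
      have := (hN _ h).2
      simp at hm
      lia
    simp [this]

lemma IsTest.eLpNorm_adjointTransform {α : ℝ} (hα : 0 ≤ α) {g : ℝ × ℕ → ℂ} (hg : IsTest g) :
    eLpNorm (adjointTransform α g) 2 (haar α) = eLpNorm g 2 (plancherel α) :=
  le_antisymm (eLpNorm_two_le_of_sq_le (hg.lintegral_adjointTransform_sq hα).le)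
    (eLpNorm_two_le_of_sq_le (hg.lintegral_adjointTransform_sq hα).ge)

/-! ### Truncation -/

/-- The truncation of `g` to a box and to the set where it is bounded by `n`. -/
def cutoff (g : ℝ × ℕ → ℂ) (n : ℕ) : ℝ × ℕ → ℂ := (box n ∩ {w | ‖g w‖ ≤ n}).indicator g

lemma isTest_cutoff {g : ℝ × ℕ → ℂ} (hg : Measurable g) (n : ℕ) : IsTest (cutoff g n) where
  measurable := hg.indicator ((measurableSet_box n).inter (measurableSet_le hg.norm measurable_const))
  bounded := by
    refine ⟨n, fun w => ?_⟩
    by_cases h : w ∈ box n ∩ {w | ‖g w‖ ≤ n}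
    · rw [cutoff, Set.indicator_of_mem h]; exact h.2
    · rw [cutoff, Set.indicator_of_notMem h]; simp
  support := ⟨n, fun w hw => (Set.mem_of_indicator_ne_zero hw).1⟩

lemma norm_cutoff_le (g : ℝ × ℕ → ℂ) (n : ℕ) (w : ℝ × ℕ) : ‖cutoff g n w‖ ≤ ‖g w‖ :=
  norm_indicator_le_norm_self _ _

lemma cutoff_eventually_eq (g : ℝ × ℕ → ℂ) (w : ℝ × ℕ) : ∀ᶠ n in atTop, cutoff g n w = g w := by
  have h1 : ∀ᶠ n : ℕ in atTop, |w.1| ≤ n := eventually_atTop.2 ⟨⌈|w.1|⌉₊, fun n hn =>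
    (Nat.le_ceil _).trans (by exact_mod_cast hn)⟩
  have h2 : ∀ᶠ n : ℕ in atTop, ‖g w‖ ≤ n := eventually_atTop.2 ⟨⌈‖g w‖⌉₊, fun n hn =>
    (Nat.le_ceil _).trans (by exact_mod_cast hn)⟩
  filter_upwards [h1, h2, eventually_ge_atTop w.2] with n h1 h2 h3
  exact Set.indicator_of_mem (show w ∈ box n ∩ {w | ‖g w‖ ≤ n} from ⟨⟨h1, h3⟩, h2⟩) g

lemma tendsto_cutoff (g : ℝ × ℕ → ℂ) (w : ℝ × ℕ) :
    Tendsto (fun n => cutoff g n w) atTop (𝓝 (g w)) :=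
  tendsto_const_nhds.congr' ((cutoff_eventually_eq g w).mono fun _ h => h.symm)

lemma tendsto_adjointTransform_cutoff {α : ℝ} (hα : 0 ≤ α) {g : ℝ × ℕ → ℂ} (hg : Measurable g)
    (hgi : Integrable g (plancherel α)) (z : ℝ × ℝ) :
    Tendsto (fun n => adjointTransform α (cutoff g n) z) atTop (𝓝 (adjointTransform α g z)) := by
  refine tendsto_integral_of_dominated_convergence (fun w => ‖g w‖)
    (fun n => (integrable_mul_laguerreFun hα ((isTest_cutoff hg n).integrable hα) z).1)
    hgi.norm (fun n => ae_of_all _ fun w => ?_) (ae_of_all _ fun w => ?_)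
  · rw [norm_mul]
    exact (mul_le_of_le_one_right (norm_nonneg _) (norm_laguerreFun_le hα _ _ _)).trans
      (norm_cutoff_le g n w)
  · exact (tendsto_cutoff g w).mul_const _

/-- Fatou's lemma along the cutoffs, for which equality is known; the inequality suffices later. -/
lemma eLpNorm_adjointTransform_le {α : ℝ} (hα : 0 ≤ α) {g : ℝ × ℕ → ℂ} (hg : Measurable g)
    (hgi : Integrable g (plancherel α)) :
    eLpNorm (adjointTransform α g) 2 (haar α) ≤ eLpNorm g 2 (plancherel α) := by
  refine (Lp.eLpNorm_lim_le_liminf_eLpNorm (f := fun n => adjointTransform α (cutoff g n))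
    (fun n => (stronglyMeasurable_adjointTransform α
      (isTest_cutoff hg n).measurable).aestronglyMeasurable) _
    (ae_of_all _ fun z => tendsto_adjointTransform_cutoff hα hg hgi z)).trans ?_
  refine liminf_le_of_le (by isBoundedDefault) fun b hb => ?_
  obtain ⟨n, hn⟩ := hb.exists
  refine hn.trans ?_
  rw [(isTest_cutoff hg n).eLpNorm_adjointTransform hα]
  exact eLpNorm_mono (norm_cutoff_le g n)

lemma memLp_adjointTransform {α : ℝ} (hα : 0 ≤ α) {g : ℝ × ℕ → ℂ} (hg : Measurable g)
    (hgi : Integrable g (plancherel α)) (hg2 : MemLp g 2 (plancherel α)) :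
    MemLp (adjointTransform α g) 2 (haar α) :=
  ⟨(stronglyMeasurable_adjointTransform α hg).aestronglyMeasurable,
    (eLpNorm_adjointTransform_le hα hg hgi).trans_lt hg2.2⟩

lemma IsTest.memLp_adjointTransform {α : ℝ} (hα : 0 ≤ α) {g : ℝ × ℕ → ℂ} (hg : IsTest g) :
    MemLp (adjointTransform α g) 2 (haar α) :=
  LaguerreHypergroup.memLp_adjointTransform hα hg.measurable (hg.integrable hα) (hg.memLp hα 2)

/-! ### The pairing of a function with its transform -/

lemma enorm_integral_mul_conj_le {X : Type*} [MeasurableSpace X] {μ : Measure X} {f g : X → ℂ}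
    (hf : AEStronglyMeasurable f μ) (hg : AEStronglyMeasurable g μ) :
    ‖∫ x, f x * conj (g x) ∂μ‖ₑ ≤ eLpNorm f 2 μ * eLpNorm g 2 μ := by
  refine (enorm_integral_le_lintegral_enorm _).trans ?_
  rw [← eLpNorm_one_eq_lintegral_enorm]
  have := eLpNorm_smul_le_mul_eLpNorm (p := 2) (q := 2) (r := 1)
    (Complex.continuous_conj.comp_aestronglyMeasurable hg) hf
  refine this.trans (le_of_eq ?_)
  congr 1
  exact eLpNorm_congr_norm_ae (ae_of_all _ fun x => by simp)

lemma integrable_mul_conj {X : Type*} [MeasurableSpace X] {μ : Measure X} {f g : X → ℂ}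
    (hf : MemLp f 2 μ) (hg : MemLp g 2 μ) : Integrable (fun x => f x * conj (g x)) μ := by
  refine hf.integrable_mul (q := 2) ⟨Complex.continuous_conj.comp_aestronglyMeasurable hg.1, ?_⟩
  rw [eLpNorm_congr_norm_ae (g := g) (ae_of_all _ fun x => by simp)]
  exact hg.2

lemma tendsto_integral_mul_conj {X : Type*} [MeasurableSpace X] {μ : Measure X} {f g : X → ℂ}
    {h : ℕ → X → ℂ} (hh : ∀ n, MemLp (h n) 2 μ) (hf : MemLp f 2 μ) (hg : MemLp g 2 μ)
    (hlim : Tendsto (fun n => eLpNorm (h n - f) 2 μ) atTop (𝓝 0)) :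
    Tendsto (fun n => ∫ x, h n x * conj (g x) ∂μ) atTop (𝓝 (∫ x, f x * conj (g x) ∂μ)) := by
  rw [tendsto_iff_edist_tendsto_0]
  have h0 : Tendsto (fun n => eLpNorm (h n - f) 2 μ * eLpNorm g 2 μ) atTop (𝓝 0) := by
    simpa using ENNReal.Tendsto.mul_const hlim (Or.inr hg.2.ne)
  refine tendsto_of_tendsto_of_tendsto_of_le_of_le tendsto_const_nhds h0 (fun _ => zero_le)
    fun n => ?_
  rw [edist_eq_enorm_sub, ← integral_sub (integrable_mul_conj (hh n) hg) (integrable_mul_conj hf hg)]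
  simp only [← sub_mul]
  exact enorm_integral_mul_conj_le ((hh n).sub hf).1 hg.1

lemma aestronglyMeasurable_fourierIntegral {α : ℝ} {f : ℝ × ℝ → ℂ}
    (hf : AEStronglyMeasurable f (haar α)) :
    AEStronglyMeasurable (fourierIntegral α f) (plancherel α) := by
  have hm : Measurable fun q : (ℝ × ℕ) × (ℝ × ℝ) => laguerreFun α (-q.1.1) q.1.2 q.2 :=
    (measurable_laguerreFun α).comp (f := fun q : (ℝ × ℕ) × (ℝ × ℝ) => ((-q.1.1, q.1.2), q.2))
      (by fun_prop)
  exact AEStronglyMeasurable.integral_prod_right'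
    (f := fun q : (ℝ × ℕ) × (ℝ × ℝ) => f q.2 * laguerreFun α (-q.1.1) q.1.2 q.2)
    (hf.comp_snd.mul hm.aestronglyMeasurable)

lemma norm_fourierIntegral_le {α : ℝ} (hα : 0 ≤ α) {f : ℝ × ℝ → ℂ} (hf : Integrable f (haar α))
    (w : ℝ × ℕ) : ‖fourierIntegral α f w‖ ≤ ∫ z, ‖f z‖ ∂(haar α) := by
  refine (norm_integral_le_integral_norm _).trans (integral_mono_of_nonneg
    (ae_of_all _ fun _ => norm_nonneg _) hf.norm (ae_of_all _ fun z => ?_))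
  simp only [norm_mul]
  exact mul_le_of_le_one_right (norm_nonneg _) (norm_laguerreFun_le hα _ _ _)

lemma conj_adjointTransform (α : ℝ) (g : ℝ × ℕ → ℂ) (z : ℝ × ℝ) :
    conj (adjointTransform α g z) =
      ∫ w, conj (g w) * laguerreFun α (-w.1) w.2 z ∂(plancherel α) := by
  rw [adjointTransform, ← integral_conj]
  simp only [map_mul, conj_laguerreFun]

/-- Fubini, justified by |φ| ≤ 1. Conjugation replaces λ by -λ, which matches the kernel of
`fourierIntegral`. -/
lemma integral_mul_conj_adjointTransform {α : ℝ} (hα : 0 ≤ α) {f : ℝ × ℝ → ℂ} {g : ℝ × ℕ → ℂ}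
    (hf : Integrable f (haar α)) (hg : Integrable g (plancherel α)) :
    ∫ z, f z * conj (adjointTransform α g z) ∂(haar α) =
      ∫ w, fourierIntegral α f w * conj (g w) ∂(plancherel α) := by
  have hm : Measurable fun q : (ℝ × ℝ) × (ℝ × ℕ) => laguerreFun α (-q.2.1) q.2.2 q.1 :=
    (measurable_laguerreFun α).comp (f := fun q : (ℝ × ℝ) × (ℝ × ℕ) => ((-q.2.1, q.2.2), q.1))
      (by fun_prop)
  have hgc : Integrable (fun w => conj (g w)) (plancherel α) :=
    (Complex.conjLIE : ℂ ≃ₗᵢ[ℝ] ℂ).toContinuousLinearEquiv.toContinuousLinearMap.integrable_comp hg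
  have hint : Integrable (Function.uncurry fun (z : ℝ × ℝ) (w : ℝ × ℕ) =>
      f z * (conj (g w) * laguerreFun α (-w.1) w.2 z)) ((haar α).prod (plancherel α)) := by
    have h := (hf.mul_prod hgc).mul_bdd (c := 1) hm.aestronglyMeasurable
      (ae_of_all _ fun q => norm_laguerreFun_le hα _ _ _)
    refine h.congr (ae_of_all _ fun q => ?_)
    simp [Function.uncurry, mul_assoc]
  simp only [conj_adjointTransform, ← integral_const_mul]
  rw [integral_integral_swap hint]
  refine integral_congr_ae (ae_of_all _ fun w => ?_)
  simp only [fourierIntegral]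
  rw [← integral_mul_const]
  refine integral_congr_ae (ae_of_all _ fun z => ?_)
  simp only
  ring

/-- `g` is the transform of `f` in the sense of pairings with test functions. -/
structure IsWeakFourier (α : ℝ) (f : ℝ × ℝ → ℂ) (g : ℝ × ℕ → ℂ) : Prop where
  aestronglyMeasurable : AEStronglyMeasurable g (plancherel α)
  integrable : ∀ e, IsTest e → Integrable (fun w => g w * conj (e w)) (plancherel α)
  pairing : ∀ e, IsTest e → ∫ z, f z * conj (adjointTransform α e z) ∂(haar α) =
    ∫ w, g w * conj (e w) ∂(plancherel α)

lemma isWeakFourier_fourierIntegral {α : ℝ} (hα : 0 ≤ α) {f : ℝ × ℝ → ℂ}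
    (hf : Integrable f (haar α)) : IsWeakFourier α f (fourierIntegral α f) where
  aestronglyMeasurable := aestronglyMeasurable_fourierIntegral hf.1
  integrable e he := by
    refine Integrable.bdd_mul (c := ∫ z, ‖f z‖ ∂(haar α)) ?_
      (aestronglyMeasurable_fourierIntegral hf.1)
      (ae_of_all _ fun w => norm_fourierIntegral_le hα hf w)
    exact (Complex.conjLIE : ℂ ≃ₗᵢ[ℝ] ℂ).toContinuousLinearEquiv.toContinuousLinearMap.integrable_comp
      (he.integrable hα)
  pairing e he := integral_mul_conj_adjointTransform hα hf (he.integrable hα)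

lemma integrable_mul_conj_adjointTransform {α : ℝ} (hα : 0 ≤ α) {f : ℝ × ℝ → ℂ} {e : ℝ × ℕ → ℂ}
    (hf : Integrable f (haar α)) (he : Measurable e) (hei : Integrable e (plancherel α)) :
    Integrable (fun z => f z * conj (adjointTransform α e z)) (haar α) := by
  refine hf.mul_bdd (c := ∫ w, ‖e w‖ ∂(plancherel α))
    (Complex.continuous_conj.comp_aestronglyMeasurable
      (stronglyMeasurable_adjointTransform α he).aestronglyMeasurable) (ae_of_all _ fun z => ?_)
  rw [Complex.norm_conj]
  exact adjointTransform_norm_le hα hei z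

/-! ### Bessel's inequality and existence of the transform -/

/-- The `L²` norm on the dual is controlled by pairings with test functions. -/
lemma eLpNorm_two_le_of_pairing {α : ℝ} (hα : 0 ≤ α) {u : ℝ × ℕ → ℂ} {A : ℝ≥0∞}
    (hu : AEStronglyMeasurable u (plancherel α))
    (h : ∀ e, IsTest e → ‖∫ w, u w * conj (e w) ∂(plancherel α)‖ₑ ≤ A * eLpNorm e 2 (plancherel α)) :
    eLpNorm u 2 (plancherel α) ≤ A := by
  set v := hu.mk u with hv
  have huv : u =ᵐ[plancherel α] v := hu.ae_eq_mk
  have hvm : Measurable v := hu.stronglyMeasurable_mk.measurable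
  -- The truncation of u is itself a test function; pairing u with it gives the square of its norm,
  -- and one factor is divided out. Fatou then removes the truncation.
  have key : ∀ n, eLpNorm (cutoff v n) 2 (plancherel α) ≤ A := by
    intro n
    have he := isTest_cutoff hvm n
    have h1 := h _ he
    have h2 : ∫ w, u w * conj (cutoff v n w) ∂(plancherel α) =
        ((∫ w, ‖cutoff v n w‖ ^ 2 ∂(plancherel α) : ℝ) : ℂ) := by
      rw [← integral_complex_ofReal]
      refine integral_congr_ae (huv.mono fun w hw => ?_)
      simp only [hw]
      rw [← Complex.normSq_eq_norm_sq, ← Complex.mul_conj]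
      by_cases hc : w ∈ box n ∩ {w | ‖v w‖ ≤ n}
      · simp [cutoff, Set.indicator_of_mem hc]
      · simp [cutoff, Set.indicator_of_notMem hc]
    have h3 : ‖∫ w, u w * conj (cutoff v n w) ∂(plancherel α)‖ₑ =
        eLpNorm (cutoff v n) 2 (plancherel α) ^ 2 := by
      rw [h2, eLpNorm_two_sq, ← ofReal_norm, Complex.norm_real, Real.norm_of_nonneg
        (integral_nonneg fun _ => by positivity), ofReal_integral_eq_lintegral_ofReal
        ((he.memLp hα 2).integrable_norm_pow two_ne_zero) (ae_of_all _ fun _ => by positivity)]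
      simp only [ENNReal.ofReal_pow (norm_nonneg _), ofReal_norm]
    rw [h3, sq] at h1
    rcases eq_or_ne (eLpNorm (cutoff v n) 2 (plancherel α)) 0 with h0 | h0
    · simp [h0]
    · exact (ENNReal.mul_le_mul_iff_left h0 (he.memLp hα 2).2.ne).1 h1
  rw [eLpNorm_congr_ae huv]
  refine (Lp.eLpNorm_lim_le_liminf_eLpNorm (f := fun n => cutoff v n)
    (fun n => (isTest_cutoff hvm n).measurable.aestronglyMeasurable) _
    (ae_of_all _ fun w => tendsto_cutoff v w)).trans ?_
  refine liminf_le_of_le (by isBoundedDefault) fun b hb => ?_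
  obtain ⟨n, hn⟩ := hb.exists
  exact hn.trans (key n)

/-- Bessel's inequality: pairing the transform with e is pairing f with the adjoint transform of e,
whose L² norm is that of e. No density of the range is involved. -/
lemma eLpNorm_fourierIntegral_le {α : ℝ} (hα : 0 ≤ α) {f : ℝ × ℝ → ℂ}
    (hf : Integrable f (haar α)) :
    eLpNorm (fourierIntegral α f) 2 (plancherel α) ≤ eLpNorm f 2 (haar α) := by
  refine eLpNorm_two_le_of_pairing hα (aestronglyMeasurable_fourierIntegral hf.1) fun e he => ?_
  rw [← (isWeakFourier_fourierIntegral hα hf).pairing e he, ← he.eLpNorm_adjointTransform hα]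
  exact enorm_integral_mul_conj_le hf.1 (he.memLp_adjointTransform hα).1

lemma fourierIntegral_sub {α : ℝ} (hα : 0 ≤ α) {f g : ℝ × ℝ → ℂ}
    (hf : Integrable f (haar α)) (hg : Integrable g (haar α)) :
    fourierIntegral α (f - g) = fourierIntegral α f - fourierIntegral α g := by
  have h : ∀ f : ℝ × ℝ → ℂ, Integrable f (haar α) → ∀ w : ℝ × ℕ,
      Integrable (fun z => f z * laguerreFun α (-w.1) w.2 z) (haar α) := fun f hf w =>
    hf.mul_bdd (c := 1) ((measurable_laguerreFun α).comp
      (measurable_prodMk_left (x := (-w.1, w.2)))).aestronglyMeasurable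
      (ae_of_all _ fun z => norm_laguerreFun_le hα _ _ _)
  funext w
  simp only [fourierIntegral, Pi.sub_apply, sub_mul]
  exact integral_sub (h f hf w) (h g hg w)

/-- Approximation by integrable simple functions; Bessel's inequality makes their transforms a
Cauchy sequence. -/
lemma exists_isFourierL2 {α : ℝ} (hα : 0 ≤ α) {f : ℝ × ℝ → ℂ} (hf : MemLp f 2 (haar α)) :
    ∃ g, IsFourierL2 α f g := by
  have happ : ∀ n : ℕ, ∃ s : SimpleFunc (ℝ × ℝ) ℂ, eLpNorm (f - ⇑s) 2 (haar α) < ((n : ℝ≥0∞) + 1)⁻¹ ∧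
      MemLp s 2 (haar α) := fun n =>
    hf.exists_simpleFunc_eLpNorm_sub_lt (by norm_num) (by simp)
  choose s hs hs2 using happ
  have hs1 : ∀ n, Integrable (s n) (haar α) := fun n =>
    (SimpleFunc.memLp_iff_integrable two_ne_zero (by norm_num)).1 (hs2 n)
  have hlim : Tendsto (fun n => eLpNorm (⇑(s n) - f) 2 (haar α)) atTop (𝓝 0) := by
    refine tendsto_of_tendsto_of_tendsto_of_le_of_le tendsto_const_nhds
      (ENNReal.tendsto_inv_nat_nhds_zero.comp (tendsto_add_atTop_nat 1)) (fun _ => zero_le)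
      fun n => ?_
    rw [eLpNorm_sub_comm]
    simpa using (hs n).le
  have hF2 : ∀ n, MemLp (fourierIntegral α (s n)) 2 (plancherel α) := fun n =>
    ⟨aestronglyMeasurable_fourierIntegral (hs1 n).1,
      (eLpNorm_fourierIntegral_le hα (hs1 n)).trans_lt (hs2 n).2⟩
  have hS : CauchySeq fun n => (hs2 n).toLp (s n) := by
    refine Tendsto.cauchySeq (x := hf.toLp f) ?_
    rw [tendsto_iff_edist_tendsto_0]
    simpa only [Lp.edist_toLp_toLp] using hlim
  have hT : CauchySeq fun n => (hF2 n).toLp (fourierIntegral α (s n)) := by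
    rw [EMetric.cauchySeq_iff] at hS ⊢
    intro ε hε
    obtain ⟨N, hN⟩ := hS ε hε
    refine ⟨N, fun m hm n hn => lt_of_le_of_lt ?_ (hN m hm n hn)⟩
    rw [Lp.edist_toLp_toLp, Lp.edist_toLp_toLp, ← fourierIntegral_sub hα (hs1 m) (hs1 n)]
    exact eLpNorm_fourierIntegral_le hα ((hs1 m).sub (hs1 n))
  obtain ⟨G, hG⟩ := cauchySeq_tendsto_of_complete hT
  refine ⟨G, hf, Lp.memLp G, fun n => s n, fun n => ⟨hs1 n, hs2 n⟩, hlim, ?_⟩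
  rw [tendsto_iff_edist_tendsto_0] at hG
  refine hG.congr fun n => ?_
  rw [Lp.edist_def]
  exact eLpNorm_congr_ae ((hF2 n).coeFn_toLp.sub (ae_eq_refl _))

lemma IsFourierL2.isWeakFourier {α : ℝ} (hα : 0 ≤ α) {f : ℝ × ℝ → ℂ} {g : ℝ × ℕ → ℂ}
    (h : IsFourierL2 α f g) : IsWeakFourier α f g where
  aestronglyMeasurable := h.2.1.1
  integrable e he := integrable_mul_conj h.2.1 (he.memLp hα 2)
  pairing e he := by
    obtain ⟨hf, hg, s, hs, h1, h2⟩ := h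
    have hF2 : ∀ n, MemLp (fourierIntegral α (s n)) 2 (plancherel α) := fun n =>
      ⟨aestronglyMeasurable_fourierIntegral (hs n).1.1,
        (eLpNorm_fourierIntegral_le hα (hs n).1).trans_lt (hs n).2.2⟩
    have t1 := tendsto_integral_mul_conj (fun n => (hs n).2) hf (he.memLp_adjointTransform hα) h1
    have t2 := tendsto_integral_mul_conj hF2 hg (he.memLp hα 2) h2
    refine tendsto_nhds_unique t1 (t2.congr fun n => ?_)
    exact ((isWeakFourier_fourierIntegral hα (hs n).1).pairing e he).symm

lemma IsFourier.isWeakFourier {α : ℝ} (hα : 0 ≤ α) {f : ℝ × ℝ → ℂ} {g : ℝ × ℕ → ℂ}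
    (h : IsFourier α f g) : IsWeakFourier α f g := by
  obtain ⟨f₁, f₂, g₂, h1, h2, hf, hg⟩ := h
  have w1 := isWeakFourier_fourierIntegral hα h1
  have w2 := h2.isWeakFourier hα
  have hg' : ∀ e : ℝ × ℕ → ℂ, (fun w => fourierIntegral α f₁ w * conj (e w) + g₂ w * conj (e w))
      =ᵐ[plancherel α] fun w => g w * conj (e w) := fun e =>
    hg.mono fun w hw => by simp only [hw, Pi.add_apply, add_mul]
  refine ⟨(w1.1.add w2.1).congr hg.symm, fun e he => ?_, fun e he => ?_⟩
  · exact ((w1.integrable e he).add (w2.integrable e he)).congr (hg' e)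
  · rw [← integral_congr_ae (hg' e), integral_add (w1.integrable e he) (w2.integrable e he),
      ← w1.pairing e he, ← w2.pairing e he,
      ← integral_add (integrable_mul_conj_adjointTransform hα h1 he.measurable (he.integrable hα))
        (integrable_mul_conj h2.1 (he.memLp_adjointTransform hα))]
    exact integral_congr_ae (hf.mono fun z hz => by simp only [hz, Pi.add_apply, add_mul])

/-! ### Truncation in `L^p` and the transform on `L^p` -/

/-- Cut at height h: above it |f| ≤ h^{1-p} |f|^p, below it |f|² ≤ h^{2-p} |f|^p. The height stays
free, to be adapted to the frequency cutoff in `eLpNorm_low_le`. -/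
lemma exists_truncation {X : Type*} [MeasurableSpace X] {μ : Measure X} {f : X → ℂ} {p h : ℝ}
    (hp1 : 1 ≤ p) (hp2 : p ≤ 2) (hh : 0 < h) (hf : AEStronglyMeasurable f μ) :
    ∃ f₁ f₂ : X → ℂ, AEStronglyMeasurable f₁ μ ∧ AEStronglyMeasurable f₂ μ ∧ f =ᵐ[μ] f₁ + f₂ ∧
      ∫⁻ x, ‖f₁ x‖ₑ ∂μ ≤ ENNReal.ofReal (h ^ (1 - p)) * ∫⁻ x, ‖f x‖ₑ ^ p ∂μ ∧
      ∫⁻ x, ‖f₂ x‖ₑ ^ 2 ∂μ ≤ ENNReal.ofReal (h ^ (2 - p)) * ∫⁻ x, ‖f x‖ₑ ^ p ∂μ := by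
  set v := hf.mk f
  have hv : StronglyMeasurable v := hf.stronglyMeasurable_mk
  have hfv : f =ᵐ[μ] v := hf.ae_eq_mk
  have hS : MeasurableSet {x | h < ‖v x‖} := measurableSet_lt measurable_const hv.measurable.norm
  have hp : ∫⁻ x, ‖f x‖ₑ ^ p ∂μ = ∫⁻ x, ‖v x‖ₑ ^ p ∂μ :=
    lintegral_congr_ae (hfv.mono fun x hx => by simp only [hx])
  have hmeas : Measurable fun x => ‖v x‖ₑ ^ p := hv.measurable.enorm.pow_const p
  have conv : ∀ x (c : ℝ), 0 ≤ c → ENNReal.ofReal c * ‖v x‖ₑ ^ p = ENNReal.ofReal (c * ‖v x‖ ^ p) := by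
    intro x c hc
    rw [ENNReal.ofReal_mul hc, ← ENNReal.ofReal_rpow_of_nonneg (norm_nonneg _) (by linarith),
      ofReal_norm]
  refine ⟨{x | h < ‖v x‖}.indicator v, {x | h < ‖v x‖}ᶜ.indicator v,
    (hv.indicator hS).aestronglyMeasurable, (hv.indicator hS.compl).aestronglyMeasurable,
    ?_, ?_, ?_⟩
  · rw [Set.indicator_self_add_compl]; exact hfv
  · rw [hp, ← lintegral_const_mul _ hmeas]
    refine lintegral_mono fun x => ?_
    by_cases hx : x ∈ {x | h < ‖v x‖}
    · rw [Set.indicator_of_mem hx, conv _ _ (by positivity), ← ofReal_norm]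
      refine ENNReal.ofReal_le_ofReal ?_
      have hx : h < ‖v x‖ := hx
      have hy : 0 < ‖v x‖ := hh.trans hx
      calc ‖v x‖ = ‖v x‖ ^ (1 - p) * ‖v x‖ ^ p := by rw [← Real.rpow_add hy]; simp
        _ ≤ h ^ (1 - p) * ‖v x‖ ^ p := mul_le_mul_of_nonneg_right
            (Real.rpow_le_rpow_of_nonpos hh hx.le (by linarith)) (by positivity)
    · rw [Set.indicator_of_notMem hx]; simp
  · rw [hp, ← lintegral_const_mul _ hmeas]
    refine lintegral_mono fun x => ?_
    by_cases hx : x ∈ {x | h < ‖v x‖}ᶜ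
    · rw [Set.indicator_of_mem hx, conv _ _ (by positivity), ← ofReal_norm,
        ← ENNReal.ofReal_pow (norm_nonneg _)]
      refine ENNReal.ofReal_le_ofReal ?_
      have hx : ‖v x‖ ≤ h := not_lt.1 hx
      rcases (norm_nonneg (v x)).eq_or_lt with h0 | hy
      · rw [← h0]; simp only [ne_eq, OfNat.ofNat_ne_zero, not_false_eq_true, zero_pow]; positivity
      calc ‖v x‖ ^ 2 = ‖v x‖ ^ (2 - p) * ‖v x‖ ^ p := by rw [← Real.rpow_add hy]; simp
        _ ≤ h ^ (2 - p) * ‖v x‖ ^ p := mul_le_mul_of_nonneg_right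
            (Real.rpow_le_rpow hy.le hx (by linarith)) (by positivity)
    · rw [Set.indicator_of_notMem hx]; simp

lemma lintegral_rpow_eq_eLpNorm_rpow {X : Type*} [MeasurableSpace X] {μ : Measure X} (f : X → ℂ)
    {p : ℝ} (hp : 0 < p) : ∫⁻ x, ‖f x‖ₑ ^ p ∂μ = eLpNorm f (ENNReal.ofReal p) μ ^ p := by
  rw [eLpNorm_eq_lintegral_rpow_enorm_toReal (by simpa using hp) (by simp),
    ENNReal.toReal_ofReal hp.le, ← ENNReal.rpow_mul, one_div, inv_mul_cancel₀ hp.ne',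
    ENNReal.rpow_one]

/-- A function in `L^p`, `1 ≤ p ≤ 2`, is the sum of an integrable and a square integrable one. -/
lemma exists_integrable_add_memLp_two {X : Type*} [MeasurableSpace X] {μ : Measure X} {f : X → ℂ}
    {p : ℝ} (hp1 : 1 ≤ p) (hp2 : p ≤ 2) (hf : MemLp f (ENNReal.ofReal p) μ) :
    ∃ f₁ f₂ : X → ℂ, Integrable f₁ μ ∧ MemLp f₂ 2 μ ∧ f =ᵐ[μ] f₁ + f₂ := by
  obtain ⟨f₁, f₂, m1, m2, h, i1, i2⟩ := exists_truncation hp1 hp2 one_pos hf.1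
  rw [lintegral_rpow_eq_eLpNorm_rpow f (by linarith)] at i1 i2
  have hfin : eLpNorm f (ENNReal.ofReal p) μ ^ p < ∞ :=
    ENNReal.rpow_lt_top_of_nonneg (by linarith) hf.2.ne
  refine ⟨f₁, f₂, ⟨m1, i1.trans_lt (ENNReal.mul_lt_top ENNReal.ofReal_lt_top hfin)⟩, ⟨m2, ?_⟩, h⟩
  rw [← eLpNorm_two_sq] at i2
  have := i2.trans_lt (ENNReal.mul_lt_top ENNReal.ofReal_lt_top hfin)
  simpa using this

/-- The one place where the case distinction and the choice in `fourier` are opened. -/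
lemma isWeakFourier_fourier {α p : ℝ} (hα : 0 ≤ α) (hp1 : 1 ≤ p) (hp2 : p ≤ 2) {f : ℝ × ℝ → ℂ}
    (hf : MemLp f (ENNReal.ofReal p) (haar α)) : IsWeakFourier α f (fourier α f) := by
  by_cases hi : Integrable f (haar α)
  · rw [fourier, if_pos hi]
    exact isWeakFourier_fourierIntegral hα hi
  · have hex : ∃ g, IsFourier α f g := by
      obtain ⟨f₁, f₂, h1, h2, h⟩ := exists_integrable_add_memLp_two hp1 hp2 hf
      obtain ⟨g₂, hg⟩ := exists_isFourierL2 hα h2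
      exact ⟨_, f₁, f₂, g₂, h1, hg, h, ae_eq_refl _⟩
    rw [fourier, if_neg hi, dif_pos hex]
    exact hex.choose_spec.isWeakFourier hα

/-! ### Distribution of the dual quasi-norm -/

/-- The coefficient is the product of the factors 1 + α/k ≤ exp(α/k), hence at most the exponential
of α times a harmonic number. -/
lemma risingBinom_le {α : ℝ} (hα : 0 ≤ α) (m : ℕ) :
    risingBinom (α + 1) m ≤ Real.exp α * (m + 1 : ℝ) ^ α := by
  have h1 : risingBinom (α + 1) m ≤ Real.exp (α * (harmonic m : ℝ)) := by
    induction m with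
    | zero => simp
    | succ m ih =>
      have hm : (0 : ℝ) < m + 1 := by positivity
      have h := risingBinom_succ (α + 1) m
      have e : risingBinom (α + 1) (m + 1) = (α / (m + 1) + 1) * risingBinom (α + 1) m := by
        field_simp; linarith
      rw [e, harmonic_succ]
      push_cast
      rw [mul_add, Real.exp_add, mul_comm (Real.exp _)]
      exact mul_le_mul (by simpa [div_eq_mul_inv] using Real.add_one_le_exp (α / (m + 1))) ih
        (risingBinom_nonneg (by positivity) _) (Real.exp_pos _).le
  have h2 : (harmonic m : ℝ) ≤ 1 + Real.log (m + 1) := by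
    refine (harmonic_le_one_add_log m).trans ?_
    rcases Nat.eq_zero_or_pos m with h | h
    · simp [h]
    · gcongr; linarith
  refine h1.trans ((Real.exp_le_exp.2 (mul_le_mul_of_nonneg_left h2 hα)).trans (le_of_eq ?_))
  rw [mul_add, mul_one, Real.exp_add, Real.rpow_def_of_pos (by positivity), mul_comm α (Real.log _)]

/-- The constant in the distribution of `dualNorm` under the Plancherel measure. -/
def dualConst (α : ℝ) : ℝ≥0∞ :=
  ∑' m : ℕ, ENNReal.ofReal (laguerre α m 0 * (4 * (m + (α + 1) / 2)) ^ (-(α + 2)))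

/-- The terms are O(m^α m^{-(α+2)}) = O(m^{-2}). -/
lemma dualConst_lt_top {α : ℝ} (hα : 0 ≤ α) : dualConst α < ∞ := by
  refine lt_top_iff_ne_top.2 ?_
  have hsum : Summable fun m : ℕ => laguerre α m 0 * (4 * (m + (α + 1) / 2)) ^ (-(α + 2)) := by
    have hs : Summable fun m : ℕ => Real.exp α * (((m + 1 : ℕ) : ℝ) ^ 2)⁻¹ :=
      ((summable_nat_add_iff 1).2 (Real.summable_nat_pow_inv.2 one_lt_two)).mul_left _
    refine Summable.of_nonneg_of_le (fun m => ?_) (fun m => ?_) hs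
    · exact mul_nonneg (laguerre_zero_right_pos hα m).le (by positivity)
    · have hm : (0 : ℝ) < m + 1 := by positivity
      rw [laguerre_zero_right hα]
      calc _ ≤ (Real.exp α * (m + 1 : ℝ) ^ α) * ((m : ℝ) + 1) ^ (-(α + 2)) :=
            mul_le_mul (risingBinom_le hα m) (Real.rpow_le_rpow_of_nonpos hm
              (by linarith [(m.cast_nonneg : (0 : ℝ) ≤ m)]) (by linarith)) (by positivity)
              (by positivity)
        _ = _ := by
          rw [mul_assoc, ← Real.rpow_add hm, show α + -(α + 2) = -(2 : ℕ) by push_cast; ring,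
            Real.rpow_neg hm.le, Real.rpow_natCast]
          push_cast; rfl
  exact hsum.tsum_ofReal_ne_top

lemma measurable_dualNorm (α : ℝ) : Measurable (dualNorm α) := by
  refine measurable_from_prod_countable_left fun m => ?_
  unfold dualNorm
  fun_prop

/-- For each m substitute v = 4(m + (α+1)/2) λ: up to the constant, the quasi-norm is distributed as
|v| under |v|^{α+1} dv. The dual therefore has homogeneous dimension α + 2 = Q/2. -/
lemma lintegral_comp_dualNorm {α : ℝ} (hα : 0 ≤ α) {ψ : ℝ → ℝ≥0∞} (hψ : Measurable ψ) :
    ∫⁻ w, ψ (dualNorm α w) ∂(plancherel α) =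
      dualConst α * ∫⁻ v : ℝ, ENNReal.ofReal (|v| ^ (α + 1)) * ψ |v| := by
  rw [lintegral_plancherel α (F := fun w => ψ (dualNorm α w)) (hψ.comp (measurable_dualNorm α)), lintegral_tsum (fun m => by
    have : Measurable fun lam : ℝ => dualNorm α (lam, m) := by unfold dualNorm; fun_prop
    have := hψ.comp this
    exact (Measurable.mul (by fun_prop) this).aemeasurable), dualConst, ← ENNReal.tsum_mul_right]
  refine tsum_congr fun m => ?_
  set c : ℝ := 4 * (m + (α + 1) / 2) with hc
  have hc0 : 0 < c := by positivity
  have hme : MeasurableEmbedding fun t : ℝ => c * t :=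
    (Homeomorph.mulLeft₀ _ hc0.ne').measurableEmbedding
  have hL := (laguerre_zero_right_pos hα m).le
  have e : ∀ lam : ℝ, ENNReal.ofReal (laguerre α m 0 * |lam| ^ (α + 1)) * ψ (dualNorm α (lam, m)) =
      ENNReal.ofReal (laguerre α m 0 * c ^ (-(α + 1))) *
        (ENNReal.ofReal (|c * lam| ^ (α + 1)) * ψ |c * lam|) := by
    intro lam
    have h1 : dualNorm α (lam, m) = |c * lam| := by
      rw [dualNorm, abs_mul, abs_of_pos hc0, hc]; ring
    rw [h1, ← mul_assoc, ← ENNReal.ofReal_mul (mul_nonneg hL (by positivity)), abs_mul,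
      abs_of_pos hc0, Real.mul_rpow hc0.le (abs_nonneg _), Real.rpow_neg hc0.le]
    congr 2
    have : c ^ (α + 1) ≠ 0 := by positivity
    field_simp
  have hmeas : Measurable fun v : ℝ => ENNReal.ofReal (|v| ^ (α + 1)) * ψ |v| :=
    Measurable.mul (by fun_prop) (hψ.comp (by fun_prop))
  have hmeas' : Measurable fun v : ℝ => ENNReal.ofReal (|c * v| ^ (α + 1)) * ψ |c * v| :=
    hmeas.comp (measurable_const_mul c)
  simp only [e]
  rw [lintegral_const_mul _ hmeas',
    ← hme.lintegral_map (fun v => ENNReal.ofReal (|v| ^ (α + 1)) * ψ |v|),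
    Real.map_volume_mul_left hc0.ne', lintegral_smul_measure, smul_eq_mul, ← mul_assoc,
    ← ENNReal.ofReal_mul (mul_nonneg hL (by positivity))]
  congr 2
  rw [abs_of_pos (by positivity), show -(α + 2) = -(α + 1) - 1 by ring, Real.rpow_sub hc0,
    Real.rpow_one]
  field_simp

lemma plancherel_dualNorm_le {α s : ℝ} (hα : 0 ≤ α) (hs : 0 < s) :
    plancherel α {w | dualNorm α w ≤ s} ≤ dualConst α * ENNReal.ofReal (2 * s ^ (α + 2)) := by
  have hS : MeasurableSet {w | dualNorm α w ≤ s} :=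
    measurableSet_le (measurable_dualNorm α) measurable_const
  have h := lintegral_comp_dualNorm hα (ψ := (Set.Iic s).indicator 1)
    (measurable_one.indicator measurableSet_Iic)
  have e : ∫⁻ w, (Set.Iic s).indicator (1 : ℝ → ℝ≥0∞) (dualNorm α w) ∂(plancherel α) =
      plancherel α {w | dualNorm α w ≤ s} := by
    rw [← lintegral_indicator_one hS]
    rfl
  rw [← e, h]
  gcongr
  calc ∫⁻ v : ℝ, ENNReal.ofReal (|v| ^ (α + 1)) * (Set.Iic s).indicator 1 |v|
      ≤ ∫⁻ v : ℝ, (Set.Icc (-s) s).indicator (fun _ => ENNReal.ofReal (s ^ (α + 1))) v := by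
        refine lintegral_mono fun v => ?_
        by_cases hv : |v| ≤ s
        · rw [Set.indicator_of_mem (show v ∈ Set.Icc (-s) s from abs_le.1 hv),
            Set.indicator_of_mem (show |v| ∈ Set.Iic s from hv), Pi.one_apply, mul_one]
          exact ENNReal.ofReal_le_ofReal (Real.rpow_le_rpow (abs_nonneg _) hv (by positivity))
        · rw [Set.indicator_of_notMem (show |v| ∉ Set.Iic s from hv), mul_zero]
          exact zero_le
    _ = _ := by
        rw [lintegral_indicator_const measurableSet_Icc, Real.volume_Icc,
          ← ENNReal.ofReal_mul (by positivity)]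
        congr 1
        rw [show α + 2 = α + 1 + 1 by ring, Real.rpow_add_one hs.ne' (α + 1)]
        ring

lemma lintegral_comp_abs_le (F : ℝ → ℝ≥0∞) :
    ∫⁻ v : ℝ, F |v| ≤ 2 * ∫⁻ v in Set.Ioi 0, F v := by
  have h1 : ∫⁻ v in Set.Ioi (0 : ℝ), F |v| = ∫⁻ v in Set.Ioi 0, F v :=
    setLIntegral_congr_fun measurableSet_Ioi fun v hv => by rw [abs_of_pos hv]
  have h2 : ∫⁻ v in Set.Iio (0 : ℝ), F |v| = ∫⁻ v in Set.Ioi 0, F v := by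
    have hme : MeasurableEmbedding fun t : ℝ => -t := (Homeomorph.neg ℝ).measurableEmbedding
    rw [← h1, ← lintegral_indicator measurableSet_Ioi, ← lintegral_indicator measurableSet_Iio,
      ← (Measure.measurePreserving_neg (volume : Measure ℝ)).lintegral_comp_emb hme]
    refine lintegral_congr fun v => ?_
    by_cases hv : 0 < v
    · rw [Set.indicator_of_mem (by simpa using hv), Set.indicator_of_mem (by simpa using hv), abs_neg]
    · rw [Set.indicator_of_notMem (by simpa using hv), Set.indicator_of_notMem (by simpa using hv)]
  have h3 : ∫⁻ v : ℝ, F |v| ≤ (∫⁻ v in Set.Iio (0 : ℝ), F |v|) + ∫⁻ v in Set.Ioi (0 : ℝ), F |v| := by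
    rw [← setLIntegral_univ, ← Set.Iio_union_Ici (a := (0 : ℝ))]
    refine (lintegral_union_le _ _ _).trans ?_
    rw [restrict_Ioi_eq_restrict_Ici]
  rw [h1, h2] at h3
  rwa [two_mul]

lemma lintegral_dualNorm_rpow_le {α s β : ℝ} (hα : 0 ≤ α) (hs : 0 < s) (hβ : α + 2 < β) :
    ∫⁻ w, (Set.Ioi s).indicator (fun v => ENNReal.ofReal (v ^ (-β))) (dualNorm α w) ∂(plancherel α)
      ≤ dualConst α * ENNReal.ofReal (2 / (β - (α + 2)) * s ^ (α + 2 - β)) := by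
  rw [lintegral_comp_dualNorm hα (Measurable.indicator (by fun_prop) measurableSet_Ioi)]
  gcongr
  refine (lintegral_comp_abs_le (fun v => ENNReal.ofReal (v ^ (α + 1)) *
    (Set.Ioi s).indicator (fun v => ENNReal.ofReal (v ^ (-β))) v)).trans ?_
  have e : ∫⁻ v in Set.Ioi (0 : ℝ), ENNReal.ofReal (v ^ (α + 1)) *
      (Set.Ioi s).indicator (fun v => ENNReal.ofReal (v ^ (-β))) v ≤
      ∫⁻ v in Set.Ioi s, ENNReal.ofReal (v ^ (α + 1 - β)) := by
    rw [← lintegral_indicator measurableSet_Ioi, ← lintegral_indicator measurableSet_Ioi]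
    refine lintegral_mono fun v => ?_
    by_cases hv : s < v
    · have hv0 : 0 < v := hs.trans hv
      rw [Set.indicator_of_mem (by simpa using hv0), Set.indicator_of_mem (by simpa using hv),
        Set.indicator_of_mem (by simpa using hv), ← ENNReal.ofReal_mul (by positivity),
        ← Real.rpow_add hv0, sub_eq_add_neg]
    · rw [Set.indicator_of_notMem (a := v) (s := Set.Ioi s) (by simpa using hv)]
      have : (Set.Ioi (0 : ℝ)).indicator (fun v => ENNReal.ofReal (v ^ (α + 1)) *
        (Set.Ioi s).indicator (fun v => ENNReal.ofReal (v ^ (-β))) v) v = 0 := by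
        rw [Set.indicator_apply_eq_zero]
        intro _
        rw [Set.indicator_of_notMem (by simpa using hv), mul_zero]
      rw [this]
  have hint : IntegrableOn (fun v : ℝ => v ^ (α + 1 - β)) (Set.Ioi s) :=
    integrableOn_Ioi_rpow_of_lt (by linarith) hs
  rw [← ofReal_integral_eq_lintegral_ofReal hint ((ae_restrict_iff' measurableSet_Ioi).2
    (ae_of_all _ fun v hv => Real.rpow_nonneg (hs.le.trans (le_of_lt hv)) _)),
    integral_Ioi_rpow_of_lt (by linarith) hs] at e
  refine (mul_le_mul_right e 2).trans (le_of_eq ?_)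
  rw [show (2 : ℝ≥0∞) = ENNReal.ofReal 2 by simp, ← ENNReal.ofReal_mul (by norm_num)]
  congr 1
  rw [show α + 1 - β + 1 = α + 2 - β by ring]
  have h1 : α + 2 - β ≠ 0 := by linarith
  have h2 : β - (α + 2) ≠ 0 := by linarith
  field_simp
  ring

/-! ### Low and high frequencies -/

lemma IsTest.indicator {e : ℝ × ℕ → ℂ} (he : IsTest e) {S : Set (ℝ × ℕ)} (hS : MeasurableSet S) :
    IsTest (S.indicator e) where
  measurable := he.measurable.indicator hS
  bounded := he.bounded.imp fun _ hC w => (norm_indicator_le_norm_self _ _).trans (hC w)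
  support := he.support.imp fun _ hN w hw => hN w fun h => hw (by simp [h])

lemma indicator_mul_conj {X : Type*} (S : Set X) (g e : X → ℂ) (w : X) :
    S.indicator g w * conj (e w) = g w * conj (S.indicator e w) := by
  by_cases hw : w ∈ S
  · rw [Set.indicator_of_mem hw, Set.indicator_of_mem hw]
  · rw [Set.indicator_of_notMem hw, Set.indicator_of_notMem hw]; simp

lemma enorm_adjointTransform_le {α : ℝ} (hα : 0 ≤ α) (e : ℝ × ℕ → ℂ) (z : ℝ × ℝ) :
    ‖adjointTransform α e z‖ₑ ≤ ∫⁻ w, ‖e w‖ₑ ∂(plancherel α) := by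
  refine (enorm_integral_le_lintegral_enorm _).trans (lintegral_mono fun w => ?_)
  rw [enorm_mul]
  refine mul_le_of_le_one_right zero_le ?_
  rw [← ofReal_norm, ← ENNReal.ofReal_one]
  exact ENNReal.ofReal_le_ofReal (norm_laguerreFun_le hα _ _ _)

lemma enorm_integral_mul_conj_adjointTransform_le {α : ℝ} (hα : 0 ≤ α) (f : ℝ × ℝ → ℂ)
    {e : ℝ × ℕ → ℂ} (he : Integrable e (plancherel α)) :
    ‖∫ z, f z * conj (adjointTransform α e z) ∂(haar α)‖ₑ ≤
      (∫⁻ z, ‖f z‖ₑ ∂(haar α)) * ∫⁻ w, ‖e w‖ₑ ∂(plancherel α) := by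
  refine (enorm_integral_le_lintegral_enorm _).trans ?_
  rw [← lintegral_mul_const' _ _ he.2.ne]
  refine lintegral_mono fun z => ?_
  rw [enorm_mul]
  gcongr
  rw [← ofReal_norm, Complex.norm_conj, ofReal_norm]
  exact enorm_adjointTransform_le hα e z

/-- Substitute for Hausdorff–Young followed by Hölder. Test against e supported at low frequencies:
the integrable part of f is paired through |φ| ≤ 1 and ‖e‖₁ ≤ γ(low)^{1/2} ‖e‖₂, the square
integrable part through the isometry. -/
lemma eLpNorm_low_le {α p s : ℝ} (hα : 0 ≤ α) (hp1 : 1 ≤ p) (hp2 : p ≤ 2) (hs : 0 < s)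
    {f : ℝ × ℝ → ℂ} {g : ℝ × ℕ → ℂ} (hf : MemLp f (ENNReal.ofReal p) (haar α))
    (hw : IsWeakFourier α f g) :
    eLpNorm ({w | dualNorm α w ≤ s}.indicator g) 2 (plancherel α) ≤
      ((2 * dualConst α) ^ (1 / 2 : ℝ) + 1) * ENNReal.ofReal (s ^ ((α + 2) * (1 / p - 1 / 2)))
        * eLpNorm f (ENNReal.ofReal p) (haar α) := by
  have hp0 : 0 < p := by linarith
  set low : Set (ℝ × ℕ) := {w | dualNorm α w ≤ s}
  have hlow : MeasurableSet low := measurableSet_le (measurable_dualNorm α) measurable_const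
  refine eLpNorm_two_le_of_pairing hα (hw.1.indicator hlow) fun e he => ?_
  have he' := he.indicator hlow
  simp only [indicator_mul_conj]
  rw [← hw.pairing _ he']
  rcases eq_or_ne (eLpNorm f (ENNReal.ofReal p) (haar α)) 0 with hA | hA
  · rw [eLpNorm_eq_zero_iff hf.1 (by simpa using hp0)] at hA
    rw [integral_congr_ae (g := 0) (hA.mono fun z hz => by simp [hz])]
    simp
  set t := (eLpNorm f (ENNReal.ofReal p) (haar α)).toReal with ht
  have ht0 : 0 < t := ENNReal.toReal_pos hA hf.2.ne
  have htA : eLpNorm f (ENNReal.ofReal p) (haar α) = ENNReal.ofReal t :=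
    (ENNReal.ofReal_toReal hf.2.ne).symm
  -- This height gives both parts the same order t s^{(α+2)(1/p - 1/2)}, where t is the norm of f; t
  -- > 0 is needed, hence the separate case above.
  obtain ⟨f₁, f₂, m1, m2, hfe, i1, i2⟩ := exists_truncation hp1 hp2
    (by positivity : 0 < t * s ^ ((α + 2) / p)) hf.1
  rw [lintegral_rpow_eq_eLpNorm_rpow f hp0, htA, ENNReal.ofReal_rpow_of_pos ht0,
    ← ENNReal.ofReal_mul (by positivity)] at i1 i2
  have x1 : (t * s ^ ((α + 2) / p)) ^ (1 - p) * t ^ p = t * s ^ ((α + 2) / p * (1 - p)) := by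
    rw [Real.mul_rpow ht0.le (by positivity), ← Real.rpow_mul hs.le, mul_right_comm,
      ← Real.rpow_add ht0]
    simp
  have x2 : (t * s ^ ((α + 2) / p)) ^ (2 - p) * t ^ p =
      (t * s ^ ((α + 2) * (1 / p - 1 / 2))) ^ 2 := by
    rw [Real.mul_rpow ht0.le (by positivity), ← Real.rpow_mul hs.le, mul_right_comm,
      ← Real.rpow_add ht0, mul_pow, ← Real.rpow_natCast (s ^ _), ← Real.rpow_mul hs.le]
    congr 1
    · simp
    · congr 1; push_cast; field_simp
  rw [x1] at i1
  rw [x2, ENNReal.ofReal_pow (by positivity), ← eLpNorm_two_sq,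
    ENNReal.pow_le_pow_left_iff two_ne_zero] at i2
  have hf1 : Integrable f₁ (haar α) := ⟨m1, i1.trans_lt ENNReal.ofReal_lt_top⟩
  have hf2 : MemLp f₂ 2 (haar α) := ⟨m2, i2.trans_lt ENNReal.ofReal_lt_top⟩
  have hsplit : ∫ z, f z * conj (adjointTransform α (low.indicator e) z) ∂(haar α) =
      ∫ z, f₁ z * conj (adjointTransform α (low.indicator e) z) ∂(haar α) +
      ∫ z, f₂ z * conj (adjointTransform α (low.indicator e) z) ∂(haar α) := by
    rw [← integral_add (integrable_mul_conj_adjointTransform hα hf1 he'.measurable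
      (he'.integrable hα)) (integrable_mul_conj hf2 (he'.memLp_adjointTransform hα))]
    exact integral_congr_ae (hfe.mono fun z hz => by simp only [hz, Pi.add_apply, add_mul])
  have hL1 : ∫⁻ w, ‖low.indicator e w‖ₑ ∂(plancherel α) ≤
      eLpNorm e 2 (plancherel α) *
        ((2 * dualConst α) ^ (1 / 2 : ℝ) * ENNReal.ofReal (s ^ ((α + 2) / 2))) := by
    rw [← eLpNorm_one_eq_lintegral_enorm, eLpNorm_indicator_eq_eLpNorm_restrict hlow]
    refine (eLpNorm_le_eLpNorm_mul_rpow_measure_univ one_le_two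
      he.measurable.aestronglyMeasurable).trans ?_
    refine mul_le_mul' (eLpNorm_mono_measure _ Measure.restrict_le_self) ?_
    rw [Measure.restrict_apply_univ,
      show 1 / (1 : ℝ≥0∞).toReal - 1 / (2 : ℝ≥0∞).toReal = (1 / 2 : ℝ) by norm_num]
    refine (ENNReal.rpow_le_rpow (plancherel_dualNorm_le hα hs) (by norm_num)).trans (le_of_eq ?_)
    rw [ENNReal.ofReal_mul zero_le_two, ENNReal.ofReal_ofNat, ← mul_assoc,
      ENNReal.mul_rpow_of_nonneg _ _ (by norm_num), mul_comm (dualConst α),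
      ENNReal.ofReal_rpow_of_nonneg (by positivity) (by norm_num), ← Real.rpow_mul hs.le]
    congr 3
    ring
  rw [hsplit, htA]
  refine (enorm_add_le _ _).trans ?_
  have b1 := (enorm_integral_mul_conj_adjointTransform_le hα f₁ (he'.integrable hα)).trans
    (mul_le_mul' i1 hL1)
  have b2 : ‖∫ z, f₂ z * conj (adjointTransform α (low.indicator e) z) ∂(haar α)‖ₑ ≤
      ENNReal.ofReal (t * s ^ ((α + 2) * (1 / p - 1 / 2))) * eLpNorm e 2 (plancherel α) := by
    refine (enorm_integral_mul_conj_le m2 (he'.memLp_adjointTransform hα).1).trans ?_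
    refine mul_le_mul' i2 ?_
    rw [he'.eLpNorm_adjointTransform hα]
    exact eLpNorm_indicator_le _
  refine (add_le_add b1 b2).trans (le_of_eq ?_)
  have x3 : ENNReal.ofReal (t * s ^ ((α + 2) / p * (1 - p))) * ENNReal.ofReal (s ^ ((α + 2) / 2)) =
      ENNReal.ofReal (s ^ ((α + 2) * (1 / p - 1 / 2))) * ENNReal.ofReal t := by
    rw [← ENNReal.ofReal_mul (by positivity), ← ENNReal.ofReal_mul (by positivity), mul_assoc,
      ← Real.rpow_add hs, mul_comm t]
    congr 3
    field_simp
    ring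
  calc _ = (2 * dualConst α) ^ (1 / 2 : ℝ) * (ENNReal.ofReal (t * s ^ ((α + 2) / p * (1 - p)))
          * ENNReal.ofReal (s ^ ((α + 2) / 2))) * eLpNorm e 2 (plancherel α) +
        ENNReal.ofReal (t * s ^ ((α + 2) * (1 / p - 1 / 2))) * eLpNorm e 2 (plancherel α) := by ring
    _ = _ := by rw [x3, ENNReal.ofReal_mul ht0.le]; ring

/-- Hölder with 1/2 = δ + 1/p', where δ = 1/p - 1/2. The inverse weight on the high frequencies lies
in L^{1/δ} because b/(2δ) exceeds the dual dimension α + 2. -/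
lemma eLpNorm_high_le {α p s b : ℝ} (hα : 0 ≤ α) (hp1 : 1 ≤ p) (hp2 : p < 2) (hs : 0 < s)
    (hb : (α + 2) * (1 / p - 1 / 2) < b / 2) {g : ℝ × ℕ → ℂ}
    (hg : AEStronglyMeasurable g (plancherel α)) :
    eLpNorm ({w | dualNorm α w ≤ s}ᶜ.indicator g) 2 (plancherel α) ≤
      (dualConst α * ENNReal.ofReal (2 / (b / 2 / (1 / p - 1 / 2) - (α + 2)))) ^ (1 / p - 1 / 2)
        * ENNReal.ofReal (s ^ ((α + 2) * (1 / p - 1 / 2) - b / 2))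
        * eLpNorm (fun w => ((dualNorm α w ^ (b / 2) : ℝ) : ℂ) * g w)
            (ENNReal.ofReal p / (ENNReal.ofReal p - 1)) (plancherel α) := by
  have hp0 : 0 < p := by linarith
  set δ := 1 / p - 1 / 2 with hδ
  have hδ0 : 0 < δ := by
    have : 1 / 2 < 1 / p := one_div_lt_one_div_of_lt hp0 hp2
    linarith
  have hβ : α + 2 < b / 2 / δ := (lt_div_iff₀ hδ0).2 hb
  let φ : ℝ × ℕ → ℂ := fun w => (((Set.Ioi s).indicator (fun v => v ^ (-(b / 2))) (dualNorm α w) : ℝ) : ℂ)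
  have hφm : AEStronglyMeasurable φ (plancherel α) := by
    refine (Complex.measurable_ofReal.comp ?_).aestronglyMeasurable
    exact ((by fun_prop : Measurable fun v : ℝ => v ^ (-(b / 2))).indicator measurableSet_Ioi).comp
      (measurable_dualNorm α)
  have htriple : ENNReal.HolderTriple (ENNReal.ofReal (1 / δ))
      (ENNReal.ofReal p / (ENNReal.ofReal p - 1)) 2 := by
    constructor
    have e1 : (ENNReal.ofReal (1 / δ))⁻¹ = ENNReal.ofReal δ := by
      rw [← ENNReal.ofReal_inv_of_pos (by positivity)]; simp
    -- This covers p = 1, where the quotient 1/0 is ∞ and its inverse is 0.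
    have e2 : (ENNReal.ofReal p / (ENNReal.ofReal p - 1))⁻¹ = ENNReal.ofReal (1 - 1 / p) := by
      rw [ENNReal.inv_div (Or.inr (by simp)) (Or.inr (by simpa using hp0)), ← ENNReal.ofReal_one,
        ← ENNReal.ofReal_sub _ zero_le_one, ← ENNReal.ofReal_div_of_pos hp0]
      congr 1
      field_simp
    have h1p : 1 / p ≤ 1 := by rw [div_le_one hp0]; exact hp1
    rw [e1, e2, ← ENNReal.ofReal_add hδ0.le (by linarith), hδ,
      show 1 / p - 1 / 2 + (1 - 1 / p) = (2 : ℝ)⁻¹ by norm_num, ENNReal.ofReal_inv_of_pos two_pos]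
    simp
  have hm : AEStronglyMeasurable (fun w => ((dualNorm α w ^ (b / 2) : ℝ) : ℂ) * g w)
      (plancherel α) := by
    refine AEStronglyMeasurable.mul (Complex.measurable_ofReal.comp ?_).aestronglyMeasurable hg
    exact (measurable_dualNorm α).pow_const _
  have hprod : {w | dualNorm α w ≤ s}ᶜ.indicator g =
      φ • fun w => ((dualNorm α w ^ (b / 2) : ℝ) : ℂ) * g w := by
    funext w
    simp only [Pi.smul_apply', smul_eq_mul, φ]
    by_cases h : dualNorm α w ≤ s
    · rw [Set.indicator_of_notMem (by simpa using h), Set.indicator_of_notMem (by simpa using h)]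
      simp
    · have h' : s < dualNorm α w := not_le.1 h
      rw [Set.indicator_of_mem (by simpa using h), Set.indicator_of_mem (by simpa using h),
        ← mul_assoc, ← Complex.ofReal_mul, ← Real.rpow_add (hs.trans h')]
      simp
  rw [hprod]
  refine (eLpNorm_smul_le_mul_eLpNorm (p := ENNReal.ofReal (1 / δ))
    (q := ENNReal.ofReal p / (ENNReal.ofReal p - 1)) hm hφm).trans ?_
  refine mul_le_mul' ?_ le_rfl
  rw [eLpNorm_eq_lintegral_rpow_enorm_toReal (by simpa using hδ0) (by simp),
    ENNReal.toReal_ofReal (by positivity), one_div_one_div]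
  have hint : ∀ w, ‖φ w‖ₑ ^ (1 / δ) = (Set.Ioi s).indicator
      (fun v => ENNReal.ofReal (v ^ (-(b / 2 / δ)))) (dualNorm α w) := by
    intro w
    by_cases h : dualNorm α w ∈ Set.Ioi s
    · have h0 : 0 < dualNorm α w := hs.trans h
      simp only [φ, Set.indicator_of_mem h]
      rw [← ofReal_norm, Complex.norm_real, Real.norm_of_nonneg (by positivity),
        ENNReal.ofReal_rpow_of_pos (by positivity), ← Real.rpow_mul h0.le]
      congr 2
      ring
    · simp only [φ, Set.indicator_of_notMem h]
      simp [hδ0]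
  simp only [hint]
  refine (ENNReal.rpow_le_rpow (lintegral_dualNorm_rpow_le hα hs hβ) hδ0.le).trans (le_of_eq ?_)
  have h2 : 0 ≤ 2 / (b / 2 / δ - (α + 2)) := by
    have : 0 < b / 2 / δ - (α + 2) := by linarith
    positivity
  rw [ENNReal.ofReal_mul h2, ← mul_assoc, ENNReal.mul_rpow_of_nonneg _ _ hδ0.le,
    ENNReal.ofReal_rpow_of_pos (by positivity), ← Real.rpow_mul hs.le]
  congr 3
  field_simp

/-! ### Uniqueness for integrable functions from their characters -/

/-- The positive and negative parts of U are densities of finite measures whose images under Φ have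
the same characteristic function, hence coincide. The left inverse Ψ carries the equality back to X.
-/
lemma ae_eq_zero_of_integral_exp_eq_zero_real {X E : Type*} [MeasurableSpace X]
    [NormedAddCommGroup E] [NormedSpace ℝ E] [MeasurableSpace E] [BorelSpace E]
    [SecondCountableTopology E] [CompleteSpace E] {μ : Measure X} [SFinite μ] {U : X → ℝ} (hU : Integrable U μ)
    {Φ : X → E} {Ψ : E → X} (hΦ : Measurable Φ) (hΨ : Measurable Ψ) (hΨΦ : ∀ᵐ x ∂μ, Ψ (Φ x) = x)
    (h : ∀ L : StrongDual ℝ E, ∫ x, (U x : ℂ) * Complex.exp (L (Φ x) * Complex.I) ∂μ = 0) :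
    U =ᵐ[μ] 0 := by
  have hUm : AEMeasurable U μ := hU.1.aemeasurable
  have hfin : ∀ W : X → ℝ, Integrable W μ →
      IsFiniteMeasure (μ.withDensity fun x => ENNReal.ofReal (W x)) := fun W hW =>
    isFiniteMeasure_withDensity_ofReal hW.2
  have := hfin U hU
  have := hfin _ hU.neg
  have hint : ∀ W : X → ℝ, Integrable W μ → ∀ L : StrongDual ℝ E,
      Integrable (fun x => (W x : ℂ) * Complex.exp (L (Φ x) * Complex.I)) μ := by
    intro W hW L
    refine hW.ofReal.mul_bdd (c := 1) ?_ (ae_of_all _ fun x => ?_)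
    · have : Measurable fun x => Complex.exp (L (Φ x) * Complex.I) := by
        have := L.continuous.measurable.comp hΦ
        fun_prop
      exact this.aestronglyMeasurable
    · rw [Complex.norm_exp_ofReal_mul_I]
  have hchar : ∀ W : X → ℝ, Integrable W μ → ∀ L : StrongDual ℝ E,
      charFunDual ((μ.withDensity fun x => ENNReal.ofReal (W x)).map Φ) L =
        ∫ x, ((max (W x) 0 : ℝ) : ℂ) * Complex.exp (L (Φ x) * Complex.I) ∂μ := by
    intro W hW L
    rw [charFunDual_apply, integral_map hΦ.aemeasurable (by fun_prop),
      integral_withDensity_eq_integral_toReal_smul₀ hW.1.aemeasurable.ennreal_ofReal (by simp)]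
    simp only [ENNReal.toReal_ofReal', Complex.real_smul]
  have hmap : (μ.withDensity fun x => ENNReal.ofReal (U x)).map Φ =
      (μ.withDensity fun x => ENNReal.ofReal ((-U) x)).map Φ := by
    refine Measure.ext_of_charFunDual (funext fun L => ?_)
    rw [hchar U hU, hchar _ hU.neg, ← sub_eq_zero,
      ← integral_sub (hint _ hU.pos_part L) (hint _ hU.neg.pos_part L), ← h L]
    refine integral_congr_ae (ae_of_all _ fun x => ?_)
    simp only [← sub_mul, ← Complex.ofReal_sub, Pi.neg_apply]
    congr 2
    rcases le_total (U x) 0 with hx | hx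
    · rw [max_eq_right hx, max_eq_left (by linarith)]; ring
    · rw [max_eq_left hx, max_eq_right (by linarith)]; ring
  have hback : ∀ W : X → ℝ, ((μ.withDensity fun x => ENNReal.ofReal (W x)).map Φ).map Ψ =
      μ.withDensity fun x => ENNReal.ofReal (W x) := by
    intro W
    rw [Measure.map_map hΨ hΦ]
    have : (Ψ ∘ Φ) =ᵐ[μ.withDensity fun x => ENNReal.ofReal (W x)] id :=
      (withDensity_absolutelyContinuous _ _).ae_le hΨΦ
    rw [Measure.map_congr this, Measure.map_id]
  have heq := congrArg (Measure.map Ψ) hmap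
  rw [hback, hback] at heq
  have hae := (withDensity_eq_iff hUm.ennreal_ofReal (hUm.neg.ennreal_ofReal)
    (by simpa using (measure_lt_top (μ.withDensity fun x => ENNReal.ofReal (U x)) Set.univ).ne)).1 heq
  filter_upwards [hae] with x hx
  have hx : ENNReal.ofReal (U x) = ENNReal.ofReal (-(U x)) := hx
  rcases le_total (U x) 0 with h0 | h0
  · rw [ENNReal.ofReal_of_nonpos h0, eq_comm, ENNReal.ofReal_eq_zero] at hx
    simp only [Pi.zero_apply]; linarith
  · rw [ENNReal.ofReal_of_nonpos (neg_nonpos.2 h0), ENNReal.ofReal_eq_zero] at hx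
    simp only [Pi.zero_apply]; linarith

lemma ae_eq_zero_of_integral_exp_eq_zero {X E : Type*} [MeasurableSpace X]
    [NormedAddCommGroup E] [NormedSpace ℝ E] [MeasurableSpace E] [BorelSpace E]
    [SecondCountableTopology E] [CompleteSpace E] {μ : Measure X} [SFinite μ] {V : X → ℂ}
    (hV : Integrable V μ)
    {Φ : X → E} {Ψ : E → X} (hΦ : Measurable Φ) (hΨ : Measurable Ψ) (hΨΦ : ∀ᵐ x ∂μ, Ψ (Φ x) = x)
    (h : ∀ L : StrongDual ℝ E, ∫ x, V x * Complex.exp (L (Φ x) * Complex.I) ∂μ = 0) :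
    V =ᵐ[μ] 0 := by
  have hVc : Integrable (fun x => conj (V x)) μ :=
    (Complex.conjLIE : ℂ ≃ₗᵢ[ℝ] ℂ).toContinuousLinearEquiv.toContinuousLinearMap.integrable_comp hV
  have hmul : ∀ W : X → ℂ, Integrable W μ → ∀ L : StrongDual ℝ E,
      Integrable (fun x => W x * Complex.exp (L (Φ x) * Complex.I)) μ := by
    intro W hW L
    refine hW.mul_bdd (c := 1) ?_ (ae_of_all _ fun x => ?_)
    · have : Measurable fun x => Complex.exp (L (Φ x) * Complex.I) := by
        have := L.continuous.measurable.comp hΦ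
        fun_prop
      exact this.aestronglyMeasurable
    · rw [Complex.norm_exp_ofReal_mul_I]
  -- Conjugating the hypothesis at -L shows that conj V satisfies it too, so it passes to the real
  -- and imaginary parts.
  have hc : ∀ L : StrongDual ℝ E, ∫ x, conj (V x) * Complex.exp (L (Φ x) * Complex.I) ∂μ = 0 := by
    intro L
    have := congrArg conj (h (-L))
    rw [← integral_conj, map_zero] at this
    rw [← this]
    refine integral_congr_ae (ae_of_all _ fun x => ?_)
    simp [← Complex.exp_conj]
  have hre : (fun x => (V x).re) =ᵐ[μ] 0 := by
    refine ae_eq_zero_of_integral_exp_eq_zero_real hV.re hΦ hΨ hΨΦ fun L => ?_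
    have e : ∀ x, ((V x).re : ℂ) * Complex.exp (L (Φ x) * Complex.I) =
        (1 / 2) * (V x * Complex.exp (L (Φ x) * Complex.I) +
          conj (V x) * Complex.exp (L (Φ x) * Complex.I)) := by
      intro x
      rw [← add_mul, Complex.add_conj]; push_cast; ring
    simp only [e]
    rw [integral_const_mul, integral_add (hmul _ hV L) (hmul _ hVc L), h, hc]
    simp
  have him : (fun x => (V x).im) =ᵐ[μ] 0 := by
    refine ae_eq_zero_of_integral_exp_eq_zero_real hV.im hΦ hΨ hΨΦ fun L => ?_
    have e : ∀ x, ((V x).im : ℂ) * Complex.exp (L (Φ x) * Complex.I) =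
        (-Complex.I / 2) * (V x * Complex.exp (L (Φ x) * Complex.I) -
          conj (V x) * Complex.exp (L (Φ x) * Complex.I)) := by
      intro x
      rw [← sub_mul, Complex.sub_conj]
      push_cast
      linear_combination (((V x).im : ℂ) * Complex.exp (L (Φ x) * Complex.I)) * Complex.I_mul_I
    simp only [e]
    rw [integral_const_mul, integral_sub (hmul _ hV L) (hmul _ hVc L), h, hc]
    simp
  filter_upwards [hre, him] with x h1 h2
  exact Complex.ext h1 h2

lemma ae_haar_nonneg (α : ℝ) : ∀ᵐ z ∂(haar α), 0 ≤ z.1 := by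
  refine (withDensity_absolutelyContinuous _ _).ae_le ?_
  refine (ae_restrict_iff' (measurableSet_Ici.prod MeasurableSet.univ)).2 (ae_of_all _ fun z hz => ?_)
  exact hz.1

/-- Characters in (x², t) suffice, since x ≥ 0 is recovered from x². They suit the functions exp(-(1
+ iη) x²) available below. -/
lemma ae_eq_zero_of_integral_char {α : ℝ} {V : ℝ × ℝ → ℂ} (hV : Integrable V (haar α))
    (h : ∀ η s : ℝ, ∫ z, V z * Complex.exp ((η * z.1 ^ 2 + s * z.2) * Complex.I) ∂(haar α) = 0) :
    V =ᵐ[haar α] 0 := by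
  refine ae_eq_zero_of_integral_exp_eq_zero (E := ℝ × ℝ) (Φ := fun z => (z.1 ^ 2, z.2))
    (Ψ := fun z => (√z.1, z.2)) hV (by fun_prop) (by fun_prop) ?_ fun L => ?_
  · filter_upwards [ae_haar_nonneg α] with z hz
    simp [Real.sqrt_sq hz]
  · rw [← h (L (1, 0)) (L (0, 1))]
    refine integral_congr_ae (ae_of_all _ fun z => ?_)
    have : L (z.1 ^ 2, z.2) = L (1, 0) * z.1 ^ 2 + L (0, 1) * z.2 := by
      have e : ((z.1 ^ 2, z.2) : ℝ × ℝ) = z.1 ^ 2 • (1, 0) + z.2 • (0, 1) := by simp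
      rw [e, map_add, map_smul, map_smul]
      simp [mul_comm]
    simp only [this]
    push_cast
    rfl

/-! ### Adjoint transforms with Gaussian factors -/

/-- The pairing for `L²` functions extends to all of `L¹ ∩ L²` on the dual. -/
lemma IsFourierL2.pairing {α : ℝ} (hα : 0 ≤ α) {f : ℝ × ℝ → ℂ} {g e : ℝ × ℕ → ℂ}
    (h : IsFourierL2 α f g) (he : Measurable e) (hei : Integrable e (plancherel α))
    (he2 : MemLp e 2 (plancherel α)) :
    ∫ z, f z * conj (adjointTransform α e z) ∂(haar α) = ∫ w, g w * conj (e w) ∂(plancherel α) := by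
  obtain ⟨hf, hg, s, hs, h1, h2⟩ := h
  have hF2 : ∀ n, MemLp (fourierIntegral α (s n)) 2 (plancherel α) := fun n =>
    ⟨aestronglyMeasurable_fourierIntegral (hs n).1.1,
      (eLpNorm_fourierIntegral_le hα (hs n).1).trans_lt (hs n).2.2⟩
  have t1 := tendsto_integral_mul_conj (fun n => (hs n).2) hf
    (memLp_adjointTransform hα he hei he2) h1
  have t2 := tendsto_integral_mul_conj hF2 hg he2 h2
  exact tendsto_nhds_unique t1
    (t2.congr fun n => (integral_mul_conj_adjointTransform hα (hs n).1 hei).symm)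

/-- If `f₁ + f₂ ∈ L¹ + L²` annihilates the adjoint transforms of test functions, it annihilates
all adjoint transforms. -/
lemma integral_conj_adjointTransform_eq_zero {α : ℝ} (hα : 0 ≤ α) {f₁ f₂ : ℝ × ℝ → ℂ}
    (h1 : Integrable f₁ (haar α)) (h2 : MemLp f₂ 2 (haar α))
    (h : ∀ e, IsTest e → ∫ z, f₁ z * conj (adjointTransform α e z) ∂(haar α) +
      ∫ z, f₂ z * conj (adjointTransform α e z) ∂(haar α) = 0)
    {e : ℝ × ℕ → ℂ} (he : Measurable e) (hei : Integrable e (plancherel α))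
    (he2 : MemLp e 2 (plancherel α)) :
    ∫ z, f₁ z * conj (adjointTransform α e z) ∂(haar α) +
      ∫ z, f₂ z * conj (adjointTransform α e z) ∂(haar α) = 0 := by
  obtain ⟨g₂, hg2⟩ := exists_isFourierL2 hα h2
  have w1 := isWeakFourier_fourierIntegral hα h1
  have w2 := hg2.isWeakFourier hα
  -- The hypothesis says that the transform of f₁ + f₂ pairs to zero with all test functions, so it
  -- vanishes a.e. and pairs to zero with any e.
  have hz : eLpNorm (fourierIntegral α f₁ + g₂) 2 (plancherel α) ≤ 0 := by
    refine eLpNorm_two_le_of_pairing hα (w1.1.add w2.1) fun u hu => ?_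
    simp only [Pi.add_apply, add_mul]
    rw [integral_add (w1.integrable u hu) (w2.integrable u hu), ← w1.pairing u hu,
      ← w2.pairing u hu, h u hu]
    simp
  rw [nonpos_iff_eq_zero, eLpNorm_eq_zero_iff (w1.1.add w2.1) two_ne_zero] at hz
  have hb : Integrable (fun w => fourierIntegral α f₁ w * conj (e w)) (plancherel α) := by
    refine Integrable.bdd_mul (c := ∫ z, ‖f₁ z‖ ∂(haar α)) ?_
      (aestronglyMeasurable_fourierIntegral h1.1)
      (ae_of_all _ fun w => norm_fourierIntegral_le hα h1 w)
    exact (Complex.conjLIE : ℂ ≃ₗᵢ[ℝ] ℂ).toContinuousLinearEquiv.toContinuousLinearMap.integrable_comp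
      hei
  rw [integral_mul_conj_adjointTransform hα h1 hei, hg2.pairing hα he hei he2,
    ← integral_add hb (integrable_mul_conj hg2.2.1 he2)]
  rw [integral_congr_ae (g := fun _ => 0)]
  · simp
  · filter_upwards [hz] with w hw
    rw [← add_mul]
    simp only [Pi.add_apply, Pi.zero_apply] at hw
    rw [hw, zero_mul]

/-- The ratio of the geometric series that turns Laguerre functions into `exp (-c x²)`. -/
def laguerreRatio (c : ℂ) (y : ℝ) : ℂ := (c - y / 2) / (c + y / 2)

lemma add_ne_zero_of_re_pos {c : ℂ} (hc : 0 < c.re) {y : ℝ} (hy : 0 ≤ y) : c + y / 2 ≠ 0 := by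
  intro h
  have := congrArg Complex.re h
  simp at this
  linarith

/-- A Cayley transform: c lies in the right half-plane, so it is closer to y/2 than to -y/2. -/
lemma norm_laguerreRatio_lt_one {c : ℂ} (hc : 0 < c.re) {y : ℝ} (hy : 0 < y) :
    ‖laguerreRatio c y‖ < 1 := by
  have h0 := add_ne_zero_of_re_pos hc hy.le
  rw [laguerreRatio, norm_div, div_lt_one (norm_pos_iff.2 h0)]
  refine lt_of_pow_lt_pow_left₀ 2 (norm_nonneg _) ?_
  rw [← Complex.normSq_eq_norm_sq, ← Complex.normSq_eq_norm_sq, Complex.normSq_apply,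
    Complex.normSq_apply]
  simp
  nlinarith

/-- The function on the dual whose adjoint transform is `exp (-c x²)` times the inverse Fourier
integral of `e`. -/
def gaussianSymbol (α : ℝ) (c : ℂ) (e : ℝ → ℂ) (w : ℝ × ℕ) : ℂ :=
  e w.1 * ((|w.1| ^ (-(α + 1)) : ℝ) : ℂ) * (1 - laguerreRatio c |w.1|) ^ ((α + 1 : ℝ) : ℂ)
    * laguerreRatio c |w.1| ^ w.2

lemma measurable_gaussianSymbol (α : ℝ) (c : ℂ) {e : ℝ → ℂ} (he : Measurable e) :
    Measurable (gaussianSymbol α c e) := by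
  refine measurable_from_prod_countable_left fun m => ?_
  unfold gaussianSymbol laguerreRatio
  fun_prop

/-- The generating function at the ratio r. With y = |λ| one has 1 - r = y/(c + y/2) and y x² r/(1 -
r) = x²(c - y/2), so the factor exp(-y x²/2) completes the exponent to -c x². The remaining powers
in the symbol cancel (1 - r)^{-(α+1)} and |λ|^{α+1}. -/
lemma slice_gaussianSymbol {α : ℝ} (hα : 0 ≤ α) {c : ℂ} (hc : 0 < c.re) {e : ℝ → ℂ}
    (he0 : e 0 = 0) (x lam : ℝ) :
    slice α (gaussianSymbol α c e) x lam = Complex.exp (-c * x ^ 2) * e lam := by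
  rcases eq_or_ne lam 0 with rfl | hl
  · simp [slice, gaussianSymbol, he0]
  have hy : 0 < |lam| := abs_pos.2 hl
  have hr := norm_laguerreRatio_lt_one hc hy
  have h0 := add_ne_zero_of_re_pos hc hy.le
  have hyc : ((|lam| : ℝ) : ℂ) ≠ 0 := by exact_mod_cast hy.ne'
  have h1r : 1 - laguerreRatio c |lam| = (|lam| : ℝ) / (c + (|lam| : ℝ) / 2) := by
    rw [laguerreRatio, eq_div_iff h0, sub_mul, div_mul_cancel₀ _ h0]; ring
  have h1r0 : 1 - laguerreRatio c |lam| ≠ 0 := by rw [h1r]; exact div_ne_zero hyc h0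
  have hpow : (1 - laguerreRatio c |lam|) ^ ((α + 1 : ℝ) : ℂ) ≠ 0 := by
    rw [Complex.cpow_ne_zero_iff]; exact Or.inl h1r0
  have hs : ∑' m : ℕ, gaussianSymbol α c e (lam, m) * (laguerre α m (|lam| * x ^ 2) : ℂ) =
      e lam * ((|lam| ^ (-(α + 1)) : ℝ) : ℂ) *
        Complex.exp (-((|lam| * x ^ 2 : ℝ) * laguerreRatio c |lam| / (1 - laguerreRatio c |lam|))) := by
    have h := (hasSum_laguerre hα hr (|lam| * x ^ 2)).mul_left
      (e lam * ((|lam| ^ (-(α + 1)) : ℝ) : ℂ) * (1 - laguerreRatio c |lam|) ^ ((α + 1 : ℝ) : ℂ))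
    have e1 : ∀ m : ℕ, gaussianSymbol α c e (lam, m) * (laguerre α m (|lam| * x ^ 2) : ℂ) =
        e lam * ((|lam| ^ (-(α + 1)) : ℝ) : ℂ) * (1 - laguerreRatio c |lam|) ^ ((α + 1 : ℝ) : ℂ) *
          ((laguerre α m (|lam| * x ^ 2) : ℂ) * laguerreRatio c |lam| ^ m) := by
      intro m; simp only [gaussianSymbol]; ring
    simp only [e1]
    rw [h.tsum_eq]
    field_simp
  rw [slice, hs, Real.rpow_neg hy.le]
  have hp : ((|lam| ^ (α + 1) : ℝ) : ℂ) ≠ 0 := by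
    exact_mod_cast (by positivity : |lam| ^ (α + 1) ≠ 0)
  have hexp : Complex.exp (-c * x ^ 2) = (Real.exp (-(|lam| * x ^ 2 / 2)) : ℝ) *
      Complex.exp (-((|lam| * x ^ 2 : ℝ) * laguerreRatio c |lam| / (1 - laguerreRatio c |lam|))) := by
    have hq : ((|lam| * x ^ 2 : ℝ) : ℂ) * laguerreRatio c |lam| / (1 - laguerreRatio c |lam|) =
        x ^ 2 * (c - (|lam| : ℝ) / 2) := by
      rw [h1r, div_eq_iff (div_ne_zero hyc h0), laguerreRatio]
      push_cast
      ring
    rw [hq, Complex.ofReal_exp, ← Complex.exp_add]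
    congr 1
    push_cast
    ring
  rw [hexp, Complex.ofReal_mul, Complex.ofReal_inv]
  field_simp

/-- The ratio tends to 1 as y → 0 and to -1 as y → ∞, so uniform geometric decay in m needs
frequencies in an annulus. -/
lemma exists_norm_laguerreRatio_le {c : ℂ} (hc : 0 < c.re) {d R : ℝ} (hd : 0 < d) :
    ∃ ρ : ℝ, 0 ≤ ρ ∧ ρ < 1 ∧ ∀ y, d ≤ y → y ≤ R → ‖laguerreRatio c y‖ ≤ ρ := by
  rcases le_or_gt d R with h | h
  · have hcont : ContinuousOn (fun y : ℝ => ‖laguerreRatio c y‖) (Set.Icc d R) := by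
      refine ContinuousOn.norm (ContinuousOn.div (by fun_prop) (by fun_prop) fun y hy => ?_)
      exact add_ne_zero_of_re_pos hc (hd.le.trans hy.1)
    obtain ⟨y, hy, hmax⟩ := isCompact_Icc.exists_isMaxOn (Set.nonempty_Icc.2 h) hcont
    exact ⟨_, norm_nonneg _, norm_laguerreRatio_lt_one hc (hd.trans_le hy.1), fun z h1 h2 =>
      hmax ⟨h1, h2⟩⟩
  · exact ⟨0, le_rfl, one_pos, fun y h1 h2 => absurd (h1.trans h2) (not_le.2 h)⟩

lemma exists_norm_gaussianSymbol_le {α : ℝ} (hα : 0 ≤ α) {c : ℂ} (hc : 0 < c.re) {e : ℝ → ℂ}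
    {d R M : ℝ} (hd : 0 < d) (hM : ∀ lam, ‖e lam‖ ≤ M)
    (hsupp : ∀ lam, e lam ≠ 0 → d ≤ |lam| ∧ |lam| ≤ R) :
    ∃ K ρ : ℝ, 0 ≤ K ∧ 0 ≤ ρ ∧ ρ < 1 ∧
      ∀ lam m, ‖gaussianSymbol α c e (lam, m)‖ ≤ (Set.Icc (-R) R).indicator 1 lam * (K * ρ ^ m) := by
  obtain ⟨ρ, h0, h1, hρ⟩ := exists_norm_laguerreRatio_le hc (R := R) hd
  have hM0 : 0 ≤ M := (norm_nonneg _).trans (hM 0)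
  refine ⟨M * d ^ (-(α + 1)) * 2 ^ (α + 1), ρ, by positivity, h0, h1, fun lam m => ?_⟩
  by_cases he : e lam = 0
  · simp only [gaussianSymbol, he, zero_mul, norm_zero]
    exact mul_nonneg (Set.indicator_nonneg (fun _ _ => zero_le_one) _) (by positivity)
  obtain ⟨hdl, hlR⟩ := hsupp lam he
  have hr := hρ _ hdl hlR
  rw [Set.indicator_of_mem (Set.mem_Icc.2 (abs_le.1 hlR)), Pi.one_apply, one_mul, gaussianSymbol,
    norm_mul, norm_mul, norm_mul, norm_pow, Complex.norm_cpow_real, Complex.norm_real,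
    Real.norm_of_nonneg (by positivity)]
  have h2 : ‖1 - laguerreRatio c |lam|‖ ≤ 2 := by
    refine (norm_sub_le _ _).trans ?_
    rw [norm_one]; linarith
  have h3 : |lam| ^ (-(α + 1)) ≤ d ^ (-(α + 1)) :=
    Real.rpow_le_rpow_of_nonpos hd hdl (by linarith)
  have h4 : ‖1 - laguerreRatio c |lam|‖ ^ (α + 1) ≤ 2 ^ (α + 1) :=
    Real.rpow_le_rpow (norm_nonneg _) h2 (by linarith)
  have := hM lam
  gcongr

lemma integrable_gaussianSymbol {α : ℝ} (hα : 0 ≤ α) {c : ℂ} (hc : 0 < c.re) {e : ℝ → ℂ}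
    (he : Measurable e) {d R M : ℝ} (hd : 0 < d) (hM : ∀ lam, ‖e lam‖ ≤ M)
    (hsupp : ∀ lam, e lam ≠ 0 → d ≤ |lam| ∧ |lam| ≤ R) :
    Integrable (gaussianSymbol α c e) (plancherel α) := by
  obtain ⟨K, ρ, hK, h0, h1, hb⟩ := exists_norm_gaussianSymbol_le hα hc hd hM hsupp
  have hm := measurable_gaussianSymbol α c he
  have hsum := (hasSum_risingBinom_real (α + 1) h0 h1).summable
  have hnn : ∀ m, 0 ≤ risingBinom (α + 1) m * ρ ^ m := fun m =>
    mul_nonneg (risingBinom_nonneg (by linarith) m) (by positivity)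
  refine ⟨hm.aestronglyMeasurable, ?_⟩
  rw [HasFiniteIntegral, lintegral_plancherel α hm.enorm]
  have hle : ∀ lam : ℝ, ∑' m : ℕ, ENNReal.ofReal (laguerre α m 0 * |lam| ^ (α + 1)) *
      ‖gaussianSymbol α c e (lam, m)‖ₑ ≤ (Set.Icc (-R) R).indicator (fun _ =>
        ENNReal.ofReal (R ^ (α + 1) * K * ∑' m : ℕ, risingBinom (α + 1) m * ρ ^ m)) lam := by
    intro lam
    by_cases hl : lam ∈ Set.Icc (-R) R
    · rw [Set.indicator_of_mem hl, ENNReal.ofReal_mul (by have := abs_le.2 hl; have := (abs_nonneg _).trans this; positivity),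
        ENNReal.ofReal_tsum_of_nonneg hnn hsum, ← ENNReal.tsum_mul_left]
      refine ENNReal.tsum_le_tsum fun m => ?_
      have hlR := abs_le.2 hl
      have hR := (abs_nonneg _).trans hlR
      rw [← ofReal_norm, ← ENNReal.ofReal_mul (mul_nonneg (laguerre_zero_right_pos hα m).le
        (by positivity)), ← ENNReal.ofReal_mul (by positivity)]
      refine ENNReal.ofReal_le_ofReal ?_
      have := hb lam m
      rw [Set.indicator_of_mem hl, Pi.one_apply, one_mul] at this
      rw [laguerre_zero_right hα]
      have h3 : |lam| ^ (α + 1) ≤ R ^ (α + 1) := Real.rpow_le_rpow (abs_nonneg _) hlR (by linarith)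
      have h4 := risingBinom_nonneg (show 0 ≤ α + 1 by linarith) m
      calc risingBinom (α + 1) m * |lam| ^ (α + 1) * ‖gaussianSymbol α c e (lam, m)‖
          ≤ risingBinom (α + 1) m * R ^ (α + 1) * (K * ρ ^ m) := by gcongr
        _ = _ := by ring
    · rw [Set.indicator_of_notMem hl]
      refine le_of_eq ?_
      rw [ENNReal.tsum_eq_zero]
      intro m
      have := hb lam m
      rw [Set.indicator_of_notMem hl, zero_mul] at this
      rw [← ofReal_norm, le_antisymm this (norm_nonneg _)]
      simp
  refine (lintegral_mono hle).trans_lt ?_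
  rw [lintegral_indicator measurableSet_Icc, lintegral_const, Measure.restrict_apply_univ,
    Real.volume_Icc]
  exact ENNReal.mul_lt_top ENNReal.ofReal_lt_top ENNReal.ofReal_lt_top

lemma memLp_gaussianSymbol {α : ℝ} (hα : 0 ≤ α) {c : ℂ} (hc : 0 < c.re) {e : ℝ → ℂ}
    (he : Measurable e) {d R M : ℝ} (hd : 0 < d) (hM : ∀ lam, ‖e lam‖ ≤ M)
    (hsupp : ∀ lam, e lam ≠ 0 → d ≤ |lam| ∧ |lam| ≤ R) :
    MemLp (gaussianSymbol α c e) 2 (plancherel α) := by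
  obtain ⟨K, ρ, hK, h0, h1, hb⟩ := exists_norm_gaussianSymbol_le hα hc hd hM hsupp
  have hm := measurable_gaussianSymbol α c he
  have hi := integrable_gaussianSymbol hα hc he hd hM hsupp
  rw [memLp_two_iff_integrable_sq_norm hm.aestronglyMeasurable]
  refine (hi.norm.const_mul K).mono' (hm.norm.pow_const 2).aestronglyMeasurable
    (ae_of_all _ fun w => ?_)
  have hw : ‖gaussianSymbol α c e w‖ ≤ K := by
    refine (hb w.1 w.2).trans ?_
    have h2 : (Set.Icc (-R) R).indicator (1 : ℝ → ℝ) w.1 ≤ 1 :=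
      Set.indicator_le_self' (fun _ _ => zero_le_one) _
    have h3 : K * ρ ^ w.2 ≤ K := mul_le_of_le_one_right hK (pow_le_one₀ h0 h1.le)
    calc _ ≤ 1 * K := by gcongr
      _ = K := one_mul K
  rw [Real.norm_of_nonneg (by positivity), sq]
  gcongr

lemma adjointTransform_gaussianSymbol {α : ℝ} (hα : 0 ≤ α) {c : ℂ} (hc : 0 < c.re) {e : ℝ → ℂ}
    (he : Measurable e) {d R M : ℝ} (hd : 0 < d) (hM : ∀ lam, ‖e lam‖ ≤ M)
    (hsupp : ∀ lam, e lam ≠ 0 → d ≤ |lam| ∧ |lam| ≤ R) (z : ℝ × ℝ) :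
    adjointTransform α (gaussianSymbol α c e) z =
      Complex.exp (-c * z.1 ^ 2) * invFourier e z.2 := by
  have he0 : e 0 = 0 := by
    by_contra h
    have := (hsupp 0 h).1
    rw [abs_zero] at this
    linarith
  rw [adjointTransform_eq hα (integrable_gaussianSymbol hα hc he hd hM hsupp), invFourier,
    invFourier, ← integral_const_mul]
  refine integral_congr_ae (ae_of_all _ fun lam => ?_)
  simp only [slice_gaussianSymbol hα hc he0]
  ring

/-! ### Passage to the Gaussian limit -/

lemma lintegral_mul_prod_haar (α : ℝ) {φ ψ : ℝ → ℂ} (hφ : Measurable φ) (hψ : Measurable ψ) :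
    ∫⁻ z, ‖φ z.1 * ψ z.2‖ₑ ^ 2 ∂(haar α) =
      (∫⁻ x, ‖φ x‖ₑ ^ 2 ∂(radialMeasure α)) * ∫⁻ t, ‖ψ t‖ₑ ^ 2 := by
  simp only [enorm_mul, mul_pow]
  rw [haar_eq_prod]
  exact lintegral_prod_mul (f := fun x => ‖φ x‖ₑ ^ 2) (g := fun t => ‖ψ t‖ₑ ^ 2)
    (by fun_prop) (by fun_prop)

lemma laguerre_zero_left {α : ℝ} (hα : 0 ≤ α) (u : ℝ) : laguerre α 0 u = 1 := by
  have hG := Real.Gamma_pos_of_pos (by positivity : 0 < α + 1)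
  simp [laguerre, hG.ne']

lemma norm_cexp_neg_mul_sq (c : ℂ) (x : ℝ) :
    ‖Complex.exp (-c * x ^ 2)‖ = Real.exp (-c.re * x ^ 2) := by
  rw [Complex.norm_exp, show -c * (x : ℂ) ^ 2 = -c * ((x ^ 2 : ℝ) : ℂ) by push_cast; rfl,
    Complex.re_mul_ofReal, Complex.neg_re]

lemma lintegral_radial_gaussian_lt_top {α : ℝ} (hα : 0 ≤ α) {c : ℂ} (hc : 0 < c.re) :
    ∫⁻ x : ℝ, ‖Complex.exp (-c * x ^ 2)‖ₑ ^ 2 ∂(radialMeasure α) < ∞ := by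
  -- The modulus of the Gaussian is the m = 0 Laguerre function at frequency 2 Re c.
  have h := lintegral_radial_laguerre_sq hα (b := 2 * c.re) (by linarith) (fun _ => 1) 1
  simp only [Finset.sum_range_one, laguerre_zero_left hα] at h
  refine lt_of_eq_of_lt ?_ (h.trans_lt ENNReal.ofReal_lt_top)
  refine lintegral_congr fun x => ?_
  rw [← ofReal_norm, ← ofReal_norm, norm_cexp_neg_mul_sq]
  congr 2
  simp only [Complex.ofReal_one, mul_one, Complex.norm_real, Real.norm_eq_abs, Real.abs_exp]
  congr 1
  ring

/-- The annuli exhausting the punctured line. -/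
def annulus (n : ℕ) : Set ℝ := {lam | ((n : ℝ) + 1)⁻¹ ≤ |lam| ∧ |lam| ≤ n + 1}

lemma measurableSet_annulus (n : ℕ) : MeasurableSet (annulus n) :=
  (measurableSet_le measurable_const continuous_abs.measurable).inter
    (measurableSet_le continuous_abs.measurable measurable_const)

lemma eventually_mem_annulus {lam : ℝ} (h : lam ≠ 0) : ∀ᶠ n in atTop, lam ∈ annulus n := by
  have h1 : Tendsto (fun n : ℕ => ((n : ℝ) + 1)⁻¹) atTop (𝓝 0) :=
    (tendsto_natCast_atTop_atTop.atTop_add tendsto_const_nhds).inv_tendsto_atTop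
  have h2 : Tendsto (fun n : ℕ => (n : ℝ) + 1) atTop atTop :=
    tendsto_natCast_atTop_atTop.atTop_add tendsto_const_nhds
  filter_upwards [h1.eventually_le_const (abs_pos.2 h), h2.eventually_ge_atTop |lam|] with n a b
  exact ⟨a, b⟩

lemma tendsto_lintegral_compl_annulus {φ : ℝ → ℂ} (hφ : Measurable φ) {q : ℕ} (hq : q ≠ 0)
    (hfin : ∫⁻ x, ‖φ x‖ₑ ^ q ≠ ∞) :
    Tendsto (fun n => ∫⁻ x, ‖(annulus n)ᶜ.indicator φ x‖ₑ ^ q) atTop (𝓝 0) := by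
  have h := tendsto_lintegral_of_dominated_convergence (μ := (volume : Measure ℝ))
    (F := fun n x => ‖(annulus n)ᶜ.indicator φ x‖ₑ ^ q) (f := fun _ => 0)
    (fun x => ‖φ x‖ₑ ^ q) (fun n => (hφ.indicator (measurableSet_annulus n).compl).enorm.pow_const q)
    (fun n => ae_of_all _ fun x => ?_) hfin ?_
  · simpa using h
  · by_cases hx : x ∈ (annulus n)ᶜ
    · simp only [Set.indicator_of_mem hx, le_refl]
    · simp [Set.indicator_of_notMem hx, hq]
  · have h0 : ∀ᵐ x : ℝ, x ≠ 0 := by simp [ae_iff]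
    filter_upwards [h0] with x hx
    refine tendsto_const_nhds.congr' ?_
    filter_upwards [eventually_mem_annulus hx] with n hn
    rw [Set.indicator_of_notMem (by simpa using hn)]
    simp [hq]

lemma invFourier_indicator_sub {a : ℝ → ℂ} (ha : Integrable a) {S : Set ℝ} (hS : MeasurableSet S)
    (t : ℝ) : invFourier (S.indicator a) t - invFourier a t = -invFourier (Sᶜ.indicator a) t := by
  have hint : ∀ {u : ℝ → ℂ}, Integrable u →
      Integrable fun lam : ℝ => u lam * Complex.exp (Complex.I * lam * t) := by
    intro u hu
    refine hu.mul_bdd (c := 1) (by fun_prop) (ae_of_all _ fun lam => ?_)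
    rw [show Complex.I * lam * t = ((lam * t : ℝ) : ℂ) * Complex.I by push_cast; ring,
      Complex.norm_exp_ofReal_mul_I]
  rw [sub_eq_iff_eq_add, neg_add_eq_sub, eq_sub_iff_add_eq, invFourier, invFourier, invFourier,
    ← integral_add (hint (ha.indicator hS)) (hint (ha.indicator hS.compl))]
  refine integral_congr_ae (ae_of_all _ fun lam => ?_)
  simp only [← add_mul]
  congr 1
  exact congrFun (Set.indicator_self_add_compl S a) lam

lemma memLp_gaussian_mul_invFourier {α : ℝ} (hα : 0 ≤ α) {c : ℂ} (hc : 0 < c.re) {a : ℝ → ℂ}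
    (hai : Integrable a) (ha2 : MemLp a 2) :
    MemLp (fun z : ℝ × ℝ => Complex.exp (-c * z.1 ^ 2) * invFourier a z.2) 2 (haar α) := by
  have hm := (continuous_invFourier hai).measurable
  refine ⟨by fun_prop, ?_⟩
  have h := lintegral_mul_prod_haar α (φ := fun x : ℝ => Complex.exp (-c * x ^ 2)) (by fun_prop) hm
  refine (ENNReal.pow_lt_top_iff.1 ?_).resolve_right two_ne_zero
  rw [eLpNorm_two_sq, h, lintegral_invFourier_sq hai ha2,
    ← eLpNorm_two_sq (f := a)]
  exact ENNReal.mul_lt_top (lintegral_radial_gaussian_lt_top hα hc)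
    (ENNReal.mul_lt_top ENNReal.ofReal_lt_top (ENNReal.pow_lt_top ha2.2))

/-- If `f₁ + f₂` annihilates the adjoint transforms of test functions, it annihilates the functions
`exp (-c x²)` times an inverse Fourier integral in `t`. -/
lemma integral_gaussian_mul_invFourier_eq_zero {α : ℝ} (hα : 0 ≤ α) {f₁ f₂ : ℝ × ℝ → ℂ}
    (h1 : Integrable f₁ (haar α)) (h2 : MemLp f₂ 2 (haar α))
    (h : ∀ e, IsTest e → ∫ z, f₁ z * conj (adjointTransform α e z) ∂(haar α) +
      ∫ z, f₂ z * conj (adjointTransform α e z) ∂(haar α) = 0)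
    {c : ℂ} (hc : 0 < c.re) {a : ℝ → ℂ} (ha : Measurable a) {M : ℝ} (hM : ∀ lam, ‖a lam‖ ≤ M)
    (hai : Integrable a) (ha2 : MemLp a 2) :
    ∫ z, f₁ z * conj (Complex.exp (-c * z.1 ^ 2) * invFourier a z.2) ∂(haar α) +
      ∫ z, f₂ z * conj (Complex.exp (-c * z.1 ^ 2) * invFourier a z.2) ∂(haar α) = 0 := by
  -- On annuli the Gaussian symbols are integrable and square integrable, so annihilation is known
  -- there. The limit is taken by dominated convergence against f₁ and by L² convergence against f₂.
  set A : ℕ → ℝ → ℂ := fun n => (annulus n).indicator a with hA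
  have hAi : ∀ n, Integrable (A n) := fun n => hai.indicator (measurableSet_annulus n)
  have hA2 : ∀ n, MemLp (A n) 2 := fun n => ha2.indicator (measurableSet_annulus n)
  have hzero : ∀ n, ∫ z, f₁ z * conj (Complex.exp (-c * z.1 ^ 2) * invFourier (A n) z.2) ∂(haar α) +
      ∫ z, f₂ z * conj (Complex.exp (-c * z.1 ^ 2) * invFourier (A n) z.2) ∂(haar α) = 0 := by
    intro n
    have hm : Measurable (A n) := ha.indicator (measurableSet_annulus n)
    have hd : 0 < ((n : ℝ) + 1)⁻¹ := by positivity
    have hb : ∀ lam, ‖A n lam‖ ≤ M := fun lam => (norm_indicator_le_norm_self _ _).trans (hM lam)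
    have hs : ∀ lam, A n lam ≠ 0 → ((n : ℝ) + 1)⁻¹ ≤ |lam| ∧ |lam| ≤ n + 1 := fun lam hl =>
      (Set.mem_of_indicator_ne_zero hl : lam ∈ annulus n)
    have := integral_conj_adjointTransform_eq_zero hα h1 h2 h (measurable_gaussianSymbol α c hm)
      (integrable_gaussianSymbol hα hc hm hd hb hs) (memLp_gaussianSymbol hα hc hm hd hb hs)
    simpa only [adjointTransform_gaussianSymbol hα hc hm hd hb hs] using this
  have hlim1 : ∀ t, Tendsto (fun n => invFourier (A n) t) atTop (𝓝 (invFourier a t)) := by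
    intro t
    rw [tendsto_iff_norm_sub_tendsto_zero]
    have hL := tendsto_lintegral_compl_annulus ha one_ne_zero
      (by simpa using hai.2.ne)
    have hL' := (ENNReal.continuousAt_toReal ENNReal.zero_ne_top).tendsto.comp hL
    rw [ENNReal.toReal_zero] at hL'
    refine squeeze_zero (fun _ => norm_nonneg _) (fun n => ?_) hL'
    rw [invFourier_indicator_sub hai (measurableSet_annulus n), norm_neg]
    refine (norm_invFourier_le _ _).trans (le_of_eq ?_)
    rw [integral_norm_eq_lintegral_enorm
      (ha.indicator (measurableSet_annulus n).compl).aestronglyMeasurable]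
    simp
  have hexp1 : ∀ x : ℝ, ‖Complex.exp (-c * x ^ 2)‖ ≤ 1 := fun x => by
    rw [norm_cexp_neg_mul_sq, Real.exp_le_one_iff]
    nlinarith [sq_nonneg x]
  have t1 : Tendsto (fun n => ∫ z, f₁ z * conj (Complex.exp (-c * z.1 ^ 2) *
      invFourier (A n) z.2) ∂(haar α)) atTop
      (𝓝 (∫ z, f₁ z * conj (Complex.exp (-c * z.1 ^ 2) * invFourier a z.2) ∂(haar α))) := by
    refine tendsto_integral_of_dominated_convergence (fun z => ‖f₁ z‖ * ∫ lam, ‖a lam‖) (fun n => ?_)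
      (h1.norm.mul_const _) (fun n => ae_of_all _ fun z => ?_) (ae_of_all _ fun z => ?_)
    · have := (continuous_invFourier (hAi n)).measurable
      have : Measurable fun z : ℝ × ℝ => conj (Complex.exp (-c * z.1 ^ 2) * invFourier (A n) z.2) :=
        Complex.continuous_conj.measurable.comp (by fun_prop)
      exact h1.1.mul this.aestronglyMeasurable
    · rw [norm_mul, Complex.norm_conj, norm_mul]
      refine mul_le_mul_of_nonneg_left ?_ (norm_nonneg _)
      calc _ ≤ 1 * ∫ lam, ‖A n lam‖ :=
            mul_le_mul (hexp1 _) (norm_invFourier_le _ _) (norm_nonneg _) zero_le_one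
        _ ≤ ∫ lam, ‖a lam‖ := by
            rw [one_mul]
            exact integral_mono (hAi n).norm hai.norm fun lam => norm_indicator_le_norm_self _ _
    · exact (((hlim1 z.2).const_mul _).star).const_mul _
  have t2 : Tendsto (fun n => ∫ z, f₂ z * conj (Complex.exp (-c * z.1 ^ 2) *
      invFourier (A n) z.2) ∂(haar α)) atTop
      (𝓝 (∫ z, f₂ z * conj (Complex.exp (-c * z.1 ^ 2) * invFourier a z.2) ∂(haar α))) := by
    have hcv := tendsto_integral_mul_conj
      (fun n => memLp_gaussian_mul_invFourier hα hc (hAi n) (hA2 n))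
      (memLp_gaussian_mul_invFourier hα hc hai ha2) h2 ?_
    · have := hcv.star
      simp only [← starRingEnd_apply, ← integral_conj] at this
      simpa only [map_mul, Complex.conj_conj, mul_comm, mul_left_comm] using this
    · have hsq : ∀ n, eLpNorm ((fun z : ℝ × ℝ => Complex.exp (-c * z.1 ^ 2) * invFourier (A n) z.2) -
          fun z => Complex.exp (-c * z.1 ^ 2) * invFourier a z.2) 2 (haar α) ^ 2 =
          (∫⁻ x : ℝ, ‖Complex.exp (-c * x ^ 2)‖ₑ ^ 2 ∂(radialMeasure α)) *
            (ENNReal.ofReal (2 * Real.pi) * ∫⁻ lam, ‖(annulus n)ᶜ.indicator a lam‖ₑ ^ 2) := by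
        intro n
        have hSi := hai.indicator (measurableSet_annulus n).compl
        rw [← lintegral_invFourier_sq hSi (ha2.indicator (measurableSet_annulus n).compl),
          ← lintegral_mul_prod_haar α (φ := fun x : ℝ => Complex.exp (-c * x ^ 2)) (by fun_prop)
            (continuous_invFourier hSi).measurable, eLpNorm_two_sq]
        refine lintegral_congr fun z => ?_
        rw [Pi.sub_apply, ← mul_sub, invFourier_indicator_sub hai (measurableSet_annulus n),
          mul_neg, enorm_neg]
      have hL := tendsto_lintegral_compl_annulus ha two_ne_zero
        (by rw [← eLpNorm_two_sq]; exact (ENNReal.pow_lt_top ha2.2).ne)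
      have hL2 := ENNReal.Tendsto.const_mul (ENNReal.Tendsto.const_mul hL
        (Or.inr (ENNReal.ofReal_ne_top (r := 2 * Real.pi))))
        (Or.inr (lintegral_radial_gaussian_lt_top hα hc).ne)
      simp only [← hsq, mul_zero] at hL2
      have hr := hL2.ennrpow_const (1 / 2 : ℝ)
      rw [ENNReal.zero_rpow_of_pos (by norm_num)] at hr
      refine hr.congr fun n => ?_
      rw [← ENNReal.rpow_natCast, ← ENNReal.rpow_mul]
      norm_num
  exact tendsto_nhds_unique (t1.add t2) (by simp only [hzero]; exact tendsto_const_nhds)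

/-- Translating the Gaussian by s in frequency produces the character exp(i s t) times a fixed
Gaussian. -/
lemma invFourier_gaussian (s t : ℝ) :
    invFourier (fun lam : ℝ => Complex.exp (-(1 / 2 : ℂ) * lam ^ 2 + s * lam + -s ^ 2 / 2)) t =
      (2 * Real.pi : ℂ) ^ (1 / 2 : ℂ) * Complex.exp (Complex.I * s * t - t ^ 2 / 2) := by
  have h := integral_cexp_quadratic (b := -(1 / 2)) (by norm_num) (s + Complex.I * t) (-s ^ 2 / 2)
  rw [invFourier]
  simp only [← Complex.exp_add]
  rw [show (2 * Real.pi : ℂ) = Real.pi / -(-(1 / 2)) by ring]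
  convert h using 2
  · funext lam; congr 1; ring
  · congr 1
    linear_combination (-(t : ℂ) ^ 2 / 2) * Complex.I_mul_I

lemma integrable_memLp_norm_le_shifted_gaussian (s : ℝ) :
    Integrable (fun lam : ℝ => Complex.exp (-(1 / 2 : ℂ) * lam ^ 2 + s * lam + -s ^ 2 / 2)) ∧
    MemLp (fun lam : ℝ => Complex.exp (-(1 / 2 : ℂ) * lam ^ 2 + s * lam + -s ^ 2 / 2)) 2 ∧
    ∀ lam : ℝ, ‖Complex.exp (-(1 / 2 : ℂ) * lam ^ 2 + s * lam + -s ^ 2 / 2)‖ ≤ 1 := by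
  have hi : Integrable (fun lam : ℝ => Complex.exp (-(1 / 2 : ℂ) * lam ^ 2 + s * lam + -s ^ 2 / 2)) :=
    integrable_cexp_quadratic (by norm_num) s (-s ^ 2 / 2)
  have hb : ∀ lam : ℝ, ‖Complex.exp (-(1 / 2 : ℂ) * lam ^ 2 + s * lam + -s ^ 2 / 2)‖ ≤ 1 := by
    intro lam
    rw [show -(1 / 2 : ℂ) * lam ^ 2 + s * lam + -s ^ 2 / 2 = ((-(lam - s) ^ 2 / 2 : ℝ) : ℂ) by
      push_cast; ring, Complex.norm_exp_ofReal, Real.exp_le_one_iff]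
    nlinarith [sq_nonneg (lam - s)]
  refine ⟨hi, ?_, hb⟩
  rw [memLp_two_iff_integrable_sq_norm hi.1]
  refine hi.norm.mono' (hi.1.norm.pow 2) (ae_of_all _ fun lam => ?_)
  rw [Real.norm_of_nonneg (by positivity), sq]
  exact mul_le_of_le_one_left (norm_nonneg _) (hb lam)

/-- A function in `L¹ + L²` that annihilates the adjoint transforms of all test functions
vanishes. -/
theorem add_ae_eq_zero_of_annihilates {α : ℝ} (hα : 0 ≤ α) {f₁ f₂ : ℝ × ℝ → ℂ}
    (h1 : Integrable f₁ (haar α)) (h2 : MemLp f₂ 2 (haar α))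
    (h : ∀ e, IsTest e → ∫ z, f₁ z * conj (adjointTransform α e z) ∂(haar α) +
      ∫ z, f₂ z * conj (adjointTransform α e z) ∂(haar α) = 0) :
    f₁ + f₂ =ᵐ[haar α] 0 := by
  -- A nowhere vanishing weight, bounded and in L², which makes (f₁ + f₂) w integrable.
  set w : ℝ × ℝ → ℂ := fun z => Complex.exp (-z.1 ^ 2 - z.2 ^ 2 / 2) with hw
  have hwm : Measurable w := by fun_prop
  have hk : (2 * Real.pi : ℂ) ^ (1 / 2 : ℂ) ≠ 0 := by
    rw [Complex.cpow_ne_zero_iff]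
    left
    exact_mod_cast (by positivity : 2 * Real.pi ≠ 0)
  -- The weight times a character is an annihilated function: c = 1 + iη supplies the frequency in
  -- x², and the shift -s, after conjugation, the one in t.
  have key : ∀ η s : ℝ, ∀ z : ℝ × ℝ,
      w z * Complex.exp ((η * z.1 ^ 2 + s * z.2) * Complex.I) =
      (conj ((2 * Real.pi : ℂ) ^ (1 / 2 : ℂ)))⁻¹ * conj (Complex.exp (-(1 + η * Complex.I) * z.1 ^ 2) *
        invFourier (fun lam : ℝ => Complex.exp
          (-(1 / 2 : ℂ) * lam ^ 2 + (-s : ℝ) * lam + -((-s : ℝ) : ℂ) ^ 2 / 2)) z.2) := by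
    intro η s z
    rw [invFourier_gaussian, mul_left_comm, map_mul, inv_mul_cancel_left₀ ((map_ne_zero _).2 hk), hw]
    simp only
    rw [← Complex.exp_add, ← Complex.exp_add, ← Complex.exp_conj]
    congr 1
    simp [map_ofNat]
    ring
  have hw2 : MemLp w 2 (haar α) := by
    have := (memLp_gaussian_mul_invFourier hα (c := 1) (by simp) (integrable_memLp_norm_le_shifted_gaussian 0).1
      (integrable_memLp_norm_le_shifted_gaussian 0).2.1).const_mul ((2 * Real.pi : ℂ) ^ (1 / 2 : ℂ))⁻¹
    refine this.congr_norm hwm.aestronglyMeasurable (ae_of_all _ fun z => ?_)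
    rw [invFourier_gaussian, mul_left_comm, inv_mul_cancel_left₀ hk, ← Complex.exp_add, hw]
    simp only
    congr 2
    push_cast
    ring
  have hwb : ∀ z, ‖w z‖ ≤ 1 := fun z => by
    simp only [hw]
    rw [show -(z.1 : ℂ) ^ 2 - (z.2 : ℂ) ^ 2 / 2 = ((-z.1 ^ 2 - z.2 ^ 2 / 2 : ℝ) : ℂ) by
      push_cast; ring, Complex.norm_exp_ofReal, Real.exp_le_one_iff]
    nlinarith [sq_nonneg z.1, sq_nonneg z.2]
  have i1 : Integrable (fun z => f₁ z * w z) (haar α) :=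
    h1.mul_bdd hwm.aestronglyMeasurable (ae_of_all _ hwb)
  have i2 : Integrable (fun z => f₂ z * w z) (haar α) := h2.integrable_mul hw2
  have hexp : ∀ η s : ℝ, ∀ {u : ℝ × ℝ → ℂ}, Integrable u (haar α) →
      Integrable (fun z => u z * Complex.exp ((η * z.1 ^ 2 + s * z.2) * Complex.I)) (haar α) := by
    intro η s u hu
    refine hu.mul_bdd (c := 1) (by fun_prop) (ae_of_all _ fun z => ?_)
    rw [show (η * (z.1 : ℂ) ^ 2 + s * z.2) = ((η * z.1 ^ 2 + s * z.2 : ℝ) : ℂ) by push_cast; rfl,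
      Complex.norm_exp_ofReal_mul_I]
  have hV := ae_eq_zero_of_integral_char (V := fun z => f₁ z * w z + f₂ z * w z) (i1.add i2)
    fun η s => by
      simp only [add_mul (f₁ _ * w _)]
      rw [integral_add (hexp η s i1) (hexp η s i2)]
      simp only [mul_assoc, key]
      simp only [mul_left_comm _ (conj ((2 * Real.pi : ℂ) ^ (1 / 2 : ℂ)))⁻¹]
      rw [integral_const_mul, integral_const_mul, ← mul_add,
        integral_gaussian_mul_invFourier_eq_zero hα h1 h2 h (by simp) (by fun_prop)
          (integrable_memLp_norm_le_shifted_gaussian (-s)).2.2 (integrable_memLp_norm_le_shifted_gaussian (-s)).1 (integrable_memLp_norm_le_shifted_gaussian (-s)).2.1, mul_zero]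
  filter_upwards [hV] with z hz
  rw [← add_mul] at hz
  exact (mul_eq_zero.1 hz).resolve_right (Complex.exp_ne_zero _)

/-! ### The L² norm of a function is bounded by that of its transform -/

/-- A functional bounded by `‖T v‖` is the pairing of `T v` with a vector. -/
lemma exists_inner_eq_of_norm_le {V H : Type*} [AddCommGroup V] [Module ℂ V]
    [NormedAddCommGroup H] [InnerProductSpace ℂ H] [CompleteSpace H]
    (T : V →ₗ[ℂ] H) (l : V →ₗ[ℂ] ℂ) {A : ℝ} (hA : 0 ≤ A) (h : ∀ v, ‖l v‖ ≤ A * ‖T v‖) :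
    ∃ F : H, ‖F‖ ≤ A ∧ ∀ v, l v = inner ℂ F (T v) := by
  -- The bound makes l vanish on ker T, so l descends to the range of T along any linear section.
  -- Hahn–Banach extends it, and Riesz represents it.
  obtain ⟨s, hs⟩ := T.rangeRestrict.exists_rightInverse_of_surjective T.range_rangeRestrict
  have hs' : ∀ y, T (s y) = y := fun y => congrArg Subtype.val (LinearMap.congr_fun hs y)
  set L : StrongDual ℂ (LinearMap.range T) := (l ∘ₗ s).mkContinuous A fun y => by
    have := h (s y)
    rwa [hs'] at this
  obtain ⟨E, hE, hEn⟩ := exists_extension_norm_eq _ L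
  refine ⟨(InnerProductSpace.toDual ℂ H).symm E, ?_, fun v => ?_⟩
  · rw [LinearIsometryEquiv.norm_map, hEn]
    exact LinearMap.mkContinuous_norm_le _ hA _
  · rw [InnerProductSpace.toDual_symm_apply]
    have h1 : E (T v) = l (s (T.rangeRestrict v)) := hE (T.rangeRestrict v)
    rw [h1]
    have h0 : T (v - s (T.rangeRestrict v)) = 0 := by
      rw [map_sub, hs']
      exact sub_self _
    have h2 := h (v - s (T.rangeRestrict v))
    rw [h0, norm_zero, mul_zero] at h2
    have h3 := norm_le_zero_iff.1 h2
    rw [map_sub, sub_eq_zero] at h3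
    exact h3

lemma IsTest.add {e e' : ℝ × ℕ → ℂ} (h : IsTest e) (h' : IsTest e') : IsTest (e + e') where
  measurable := h.measurable.add h'.measurable
  bounded := by
    obtain ⟨C, hC⟩ := h.bounded
    obtain ⟨C', hC'⟩ := h'.bounded
    exact ⟨C + C', fun w => (norm_add_le _ _).trans (add_le_add (hC w) (hC' w))⟩
  support := by
    obtain ⟨N, hN⟩ := h.support
    obtain ⟨N', hN'⟩ := h'.support
    refine ⟨max N N', fun w hw => ?_⟩
    have h1 : ((max N N' : ℕ) : ℝ) = max (N : ℝ) N' := Nat.cast_max _ _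
    rw [h1]
    by_cases h0 : e w = 0
    · have := hN' w fun h2 => hw (by simp [h0, h2])
      exact ⟨this.1.trans (le_max_right _ _), this.2.trans (le_max_right _ _)⟩
    · have := hN w h0
      exact ⟨this.1.trans (le_max_left _ _), this.2.trans (le_max_left _ _)⟩

lemma IsTest.const_smul {e : ℝ × ℕ → ℂ} (h : IsTest e) (k : ℂ) : IsTest (k • e) where
  measurable := h.measurable.const_smul k
  bounded := by
    obtain ⟨C, hC⟩ := h.bounded
    refine ⟨‖k‖ * C, fun w => ?_⟩
    rw [Pi.smul_apply, norm_smul]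
    exact mul_le_mul_of_nonneg_left (hC w) (norm_nonneg k)
  support := by
    obtain ⟨N, hN⟩ := h.support
    exact ⟨N, fun w hw => hN w fun h0 => hw (by simp [h0])⟩

/-- The space of test functions. -/
def testSpace : Submodule ℂ (ℝ × ℕ → ℂ) where
  carrier := {e | IsTest e}
  add_mem' := IsTest.add
  zero_mem' := ⟨measurable_const, ⟨0, by simp⟩, ⟨0, by simp⟩⟩
  smul_mem' k _ h := IsTest.const_smul h k

/-- The adjoint transform as a linear map from test functions to `L²`. -/
def adjointLinear {α : ℝ} (hα : 0 ≤ α) : testSpace →ₗ[ℂ] Lp ℂ 2 (haar α) where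
  toFun e := (IsTest.memLp_adjointTransform hα e.2).toLp
  map_add' e e' := by
    rw [← MemLp.toLp_add]
    congr 1
    funext z
    simp only [adjointTransform, Pi.add_apply, Submodule.coe_add, add_mul]
    exact integral_add (integrable_mul_laguerreFun hα (IsTest.integrable hα e.2) z)
      (integrable_mul_laguerreFun hα (IsTest.integrable hα e'.2) z)
  map_smul' k e := by
    rw [RingHom.id_apply, ← MemLp.toLp_const_smul]
    congr 1
    funext z
    simp only [adjointTransform, Pi.smul_apply, Submodule.coe_smul, smul_eq_mul, mul_assoc]
    exact integral_const_mul _ _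

/-- The pairing with an `L²` function as a linear functional on test functions. -/
def pairingLinear {α : ℝ} (hα : 0 ≤ α) {g : ℝ × ℕ → ℂ} (hg : MemLp g 2 (plancherel α)) :
    testSpace →ₗ[ℂ] ℂ where
  toFun e := ∫ w, e.1 w * conj (g w) ∂(plancherel α)
  map_add' e e' := by
    simp only [Pi.add_apply, Submodule.coe_add, add_mul]
    exact integral_add (integrable_mul_conj (IsTest.memLp hα e.2 2) hg)
      (integrable_mul_conj (IsTest.memLp hα e'.2 2) hg)
  map_smul' k e := by
    simp only [Pi.smul_apply, Submodule.coe_smul, smul_eq_mul, mul_assoc, RingHom.id_apply]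
    exact integral_const_mul _ _

/-- If the transform of `f ∈ L^p`, `1 ≤ p ≤ 2`, is in `L²`, then `f` is in `L²`, with at most the
norm of its transform. -/
theorem IsWeakFourier.eLpNorm_two_le {α : ℝ} (hα : 0 ≤ α) {f : ℝ × ℝ → ℂ} {g : ℝ × ℕ → ℂ}
    (hw : IsWeakFourier α f g) (hg : MemLp g 2 (plancherel α)) {p : ℝ} (hp1 : 1 ≤ p) (hp2 : p ≤ 2)
    (hf : MemLp f (ENNReal.ofReal p) (haar α)) :
    eLpNorm f 2 (haar α) ≤ eLpNorm g 2 (plancherel α) := by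
  obtain ⟨f₁, f₂, h1, h2, hsum⟩ := exists_integrable_add_memLp_two hp1 hp2 hf
  -- The isometry ‖e‖₂ = ‖adjoint transform of e‖₂ turns Cauchy–Schwarz on the dual into the
  -- required bound. F is the L² candidate for f.
  obtain ⟨F, hF, hFe⟩ := exists_inner_eq_of_norm_le (adjointLinear hα) (pairingLinear hα hg)
    (A := (eLpNorm g 2 (plancherel α)).toReal) ENNReal.toReal_nonneg fun e => by
      have h := enorm_integral_mul_conj_le (IsTest.memLp hα e.2 2).1 hg.1
      have he : ‖adjointLinear hα e‖ = (eLpNorm e.1 2 (plancherel α)).toReal := by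
        rw [← IsTest.eLpNorm_adjointTransform hα e.2]
        exact Lp.norm_toLp _ (IsTest.memLp_adjointTransform hα e.2)
      rw [he, mul_comm, ← ENNReal.toReal_mul, ← toReal_enorm]
      exact ENNReal.toReal_mono
        (ENNReal.mul_lt_top (IsTest.memLp hα e.2 2).2 hg.2).ne h
  have hF2 : MemLp F 2 (haar α) := Lp.memLp F
  have hpair : ∀ e, IsTest e → ∫ w, g w * conj (e w) ∂(plancherel α) =
      ∫ z, F z * conj (adjointTransform α e z) ∂(haar α) := by
    intro e he
    have h := congrArg conj (hFe ⟨e, he⟩)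
    rw [L2.inner_def] at h
    have h' : conj (∫ w, e w * conj (g w) ∂(plancherel α)) =
      conj (∫ z, inner ℂ (F z) (adjointLinear hα ⟨e, he⟩ z) ∂(haar α)) := h
    rw [← integral_conj, ← integral_conj] at h'
    simp only [map_mul, Complex.conj_conj] at h'
    rw [integral_congr_ae (ae_of_all _ fun w => mul_comm (g w) (conj (e w))), h']
    refine integral_congr_ae ?_
    filter_upwards [MemLp.coeFn_toLp (IsTest.memLp_adjointTransform hα he)] with z hz
    have hz : adjointLinear hα ⟨e, he⟩ z = adjointTransform α e z := hz
    rw [hz]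
    simp [mul_comm]
  -- f and F have the same pairings, so f - F = f₁ + (f₂ - F) in L¹ + L² annihilates every adjoint
  -- transform.
  have hzero := add_ae_eq_zero_of_annihilates hα h1 (h2.sub hF2) fun e he => by
    have i1 := integrable_mul_conj_adjointTransform hα h1 he.measurable (he.integrable hα)
    have hm2 := he.memLp_adjointTransform hα
    have i2 := integrable_mul_conj h2 hm2
    have i3 := integrable_mul_conj hF2 hm2
    simp only [Pi.sub_apply, sub_mul]
    rw [integral_sub i2 i3, ← hpair e he, ← hw.pairing e he, add_sub_assoc', ← integral_add i1 i2,
      sub_eq_zero]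
    refine integral_congr_ae ?_
    filter_upwards [hsum] with z hz
    rw [hz, Pi.add_apply, add_mul]
  have hfF : f =ᵐ[haar α] F := by
    filter_upwards [hsum, hzero] with z h3 h4
    rw [h3]
    have h4 : f₁ z + (f₂ z - F z) = 0 := h4
    rw [Pi.add_apply]
    linear_combination h4
  rw [eLpNorm_congr_ae hfF, ← ENNReal.ofReal_toReal hg.2.ne, ← ENNReal.ofReal_toReal hF2.2.ne]
  exact ENNReal.ofReal_le_ofReal hF

/-! ### Balls of the homogeneous norm -/

lemma measurable_homNorm : Measurable homNorm := by
  unfold homNorm; fun_prop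

lemma homNorm_pos {z : ℝ × ℝ} (hz : z ≠ 0) : 0 < homNorm z := by
  refine Real.rpow_pos_of_pos ?_ _
  rcases eq_or_ne z.1 0 with h1 | h1
  · have h2 : z.2 ≠ 0 := fun h2 => hz (Prod.ext h1 h2)
    positivity
  · positivity

lemma homNorm_nonneg (z : ℝ × ℝ) : 0 ≤ homNorm z :=
  Real.rpow_nonneg (by positivity) _

lemma homNorm_pow_four (z : ℝ × ℝ) : homNorm z ^ 4 = z.1 ^ 4 + 4 * z.2 ^ 2 := by
  rw [homNorm, ← Real.rpow_natCast, ← Real.rpow_mul (by positivity)]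
  norm_num

lemma radialMeasure_Iic_le {α : ℝ} (hα : 0 ≤ α) {r : ℝ} (hr : 0 < r) :
    radialMeasure α (Set.Iic r) ≤
      ENNReal.ofReal (r ^ (2 * α + 2) / (Real.pi * Real.Gamma (α + 1))) := by
  have hG := Real.Gamma_pos_of_pos (by positivity : 0 < α + 1)
  rw [radialMeasure, withDensity_apply _ measurableSet_Iic, Measure.restrict_restrict measurableSet_Iic,
    Set.Iic_inter_Ici]
  calc _ ≤ ∫⁻ _ in Set.Icc 0 r, ENNReal.ofReal (r ^ (2 * α + 1) / (Real.pi * Real.Gamma (α + 1))) := by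
        refine setLIntegral_mono measurable_const fun x hx => ENNReal.ofReal_le_ofReal ?_
        have := Real.rpow_le_rpow hx.1 hx.2 (by positivity : 0 ≤ 2 * α + 1)
        gcongr
    _ = _ := by
        rw [lintegral_const, Measure.restrict_apply_univ, Real.volume_Icc, sub_zero,
          ← ENNReal.ofReal_mul (by positivity), show 2 * α + 2 = 2 * α + 1 + 1 by ring,
          Real.rpow_add_one hr.ne' (2 * α + 1)]
        congr 1
        ring

/-- The ball lies in the box x ≤ r, |t| ≤ r²/2, whose two sides contribute r^{2α+2} and r². -/
lemma haar_ball_le {α : ℝ} (hα : 0 ≤ α) {r : ℝ} (hr : 0 < r) :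
    haar α {z | homNorm z ≤ r} ≤
      ENNReal.ofReal (1 / (Real.pi * Real.Gamma (α + 1))) * ENNReal.ofReal (r ^ (2 * α + 4)) := by
  have hG := Real.Gamma_pos_of_pos (by positivity : 0 < α + 1)
  have hsub : {z | homNorm z ≤ r} ⊆ Set.Iic r ×ˢ Set.Icc (-(r ^ 2 / 2)) (r ^ 2 / 2) := by
    intro z hz
    have h4 : z.1 ^ 4 + 4 * z.2 ^ 2 ≤ r ^ 4 := by
      rw [← homNorm_pow_four]
      exact pow_le_pow_left₀ (homNorm_nonneg z) hz 4
    refine ⟨?_, abs_le.1 (abs_le_of_sq_le_sq (by nlinarith [sq_nonneg (z.1 ^ 2)]) (by positivity))⟩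
    by_contra hx
    have := pow_lt_pow_left₀ (not_le.1 hx) hr.le four_ne_zero
    nlinarith [sq_nonneg z.2]
  refine (measure_mono hsub).trans ?_
  rw [haar_eq_prod, Measure.prod_prod, Real.volume_Icc]
  refine (mul_le_mul_left (radialMeasure_Iic_le hα hr) _).trans (le_of_eq ?_)
  rw [← ENNReal.ofReal_mul (by positivity), ← ENNReal.ofReal_mul (by positivity),
    show 2 * α + 4 = 2 * α + 2 + (2 : ℕ) by push_cast; ring, Real.rpow_add_natCast hr.ne' (2 * α + 2)]
  congr 1
  ring

lemma ae_homNorm_pos (α : ℝ) : ∀ᵐ z ∂(haar α), 0 < homNorm z := by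
  have h : haar α ≪ volume :=
    (withDensity_absolutelyContinuous _ _).trans Measure.absolutelyContinuous_restrict
  have h0 : ∀ᵐ z : ℝ × ℝ, z ≠ 0 := by simp [ae_iff]
  filter_upwards [h.ae_le h0] with z hz using homNorm_pos hz

lemma ae_dualNorm_pos {α : ℝ} (hα : 0 ≤ α) : ∀ᵐ w ∂(plancherel α), 0 < dualNorm α w := by
  refine (withDensity_absolutelyContinuous _ _).ae_le ?_
  have h0 : ∀ᵐ w ∂((volume : Measure ℝ).prod (Measure.count : Measure ℕ)), w.1 ≠ 0 := by
    rw [ae_iff]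
    have : {w : ℝ × ℕ | ¬ w.1 ≠ 0} = {0} ×ˢ Set.univ := by ext w; simp
    rw [this, Measure.prod_prod]
    simp
  filter_upwards [h0] with w hw
  have := abs_pos.2 hw
  unfold dualNorm
  positivity

lemma eLpNorm_indicator_ball_compl_le (α : ℝ) {a r : ℝ} (ha : 0 < a) (hr : 0 < r) (q : ℝ≥0∞)
    (f : ℝ × ℝ → ℂ) :
    eLpNorm ({z | homNorm z ≤ r}ᶜ.indicator f) q (haar α) ≤ ENNReal.ofReal (r ^ (-a)) *
      eLpNorm (fun z => ((homNorm z ^ a : ℝ) : ℂ) * f z) q (haar α) := by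
  refine eLpNorm_le_mul_eLpNorm_of_ae_le_mul (ae_of_all _ fun z => ?_) q
  rw [norm_mul, Complex.norm_real, Real.norm_of_nonneg (Real.rpow_nonneg (homNorm_nonneg z) _)]
  by_cases hz : z ∈ {z | homNorm z ≤ r}ᶜ
  · rw [Set.indicator_of_mem hz, ← mul_assoc]
    have hlt : r < homNorm z := not_le.1 hz
    refine le_mul_of_one_le_left (norm_nonneg _) ?_
    rw [Real.rpow_neg hr.le, ← div_eq_inv_mul, one_le_div (Real.rpow_pos_of_pos hr a)]
    exact Real.rpow_le_rpow hr.le hlt.le ha.le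
  · rw [Set.indicator_of_notMem hz, norm_zero]
    have := homNorm_nonneg z
    positivity

lemma eLpNorm_indicator_ball_le {α : ℝ} (hα : 0 ≤ α) {p r : ℝ} (hp1 : 1 ≤ p) (hp2 : p ≤ 2)
    (hr : 0 < r) {f : ℝ × ℝ → ℂ} (hf : AEStronglyMeasurable f (haar α)) :
    eLpNorm ({z | homNorm z ≤ r}.indicator f) (ENNReal.ofReal p) (haar α) ≤
      ENNReal.ofReal (1 / (Real.pi * Real.Gamma (α + 1))) ^ (1 / p - 1 / 2) *
        ENNReal.ofReal (r ^ (2 * ((α + 2) * (1 / p - 1 / 2)))) * eLpNorm f 2 (haar α) := by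
  have hd : 0 ≤ 1 / p - 1 / 2 := by
    have := one_div_le_one_div_of_le (by linarith : 0 < p) hp2
    linarith
  rw [eLpNorm_indicator_eq_eLpNorm_restrict (measurableSet_le measurable_homNorm measurable_const)]
  have h := eLpNorm_le_eLpNorm_mul_rpow_measure_univ (p := ENNReal.ofReal p) (q := 2)
    (μ := (haar α).restrict {z | homNorm z ≤ r}) (by
      rw [← ENNReal.ofReal_ofNat]; exact ENNReal.ofReal_le_ofReal hp2) hf.restrict
  rw [ENNReal.toReal_ofReal (by linarith), ENNReal.toReal_ofNat, Measure.restrict_apply_univ] at h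
  refine h.trans ?_
  rw [mul_comm]
  refine mul_le_mul' ?_ (eLpNorm_mono_measure f Measure.restrict_le_self)
  refine (ENNReal.rpow_le_rpow (haar_ball_le hα hr) hd).trans (le_of_eq ?_)
  rw [ENNReal.mul_rpow_of_nonneg _ _ hd, ENNReal.ofReal_rpow_of_nonneg (by positivity : 0 ≤ r ^ (2 * α + 4)) hd,
    ← Real.rpow_mul hr.le]
  congr 3
  ring

/-! ### Absorption and optimization over the radius -/

/-- The optimization over the radius. -/
lemma rpow_le_of_forall_radius {a b : ℝ} (ha : 0 < a) (hb : 0 < b) {A B D K : ℝ≥0∞}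
    (hB : B = 0 → A = 0) (hD : D = 0 → A = 0) (hK : 1 ≤ K)
    (h : D ≠ ∞ → ∀ r : ℝ, 0 < r →
      A ≤ K * (ENNReal.ofReal (r ^ b) * D + ENNReal.ofReal (r ^ (-a)) * B)) :
    A ^ (a + b) ≤ (2 * K) ^ (a + b) * B ^ b * D ^ a := by
  have hab : 0 < a + b := by linarith
  -- With 0 · ∞ = 0 the right side vanishes when B or D does, even if the other is infinite; the
  -- hypotheses `hB` and `hD` cover this. Once both are nonzero, an infinite one makes the claim
  -- trivial.
  rcases eq_or_ne B 0 with hB0 | hB0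
  · rw [hB hB0, ENNReal.zero_rpow_of_pos hab]; exact zero_le
  rcases eq_or_ne D 0 with hD0 | hD0
  · rw [hD hD0, ENNReal.zero_rpow_of_pos hab]; exact zero_le
  have hK0 : (2 * K) ^ (a + b) ≠ 0 := by
    rw [Ne, ENNReal.rpow_eq_zero_iff_of_pos hab]
    exact mul_ne_zero two_ne_zero (one_pos.trans_le hK).ne'
  have hBb : B ^ b ≠ 0 := by rwa [Ne, ENNReal.rpow_eq_zero_iff_of_pos hb]
  have hDa : D ^ a ≠ 0 := by rwa [Ne, ENNReal.rpow_eq_zero_iff_of_pos ha]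
  rcases eq_or_ne B ∞ with hBt | hBt
  · rw [hBt, ENNReal.top_rpow_of_pos hb, ENNReal.mul_top hK0, ENNReal.top_mul hDa]
    exact le_top
  rcases eq_or_ne D ∞ with hDt | hDt
  · rw [hDt, ENNReal.top_rpow_of_pos ha, ENNReal.mul_top (mul_ne_zero hK0 hBb)]
    exact le_top
  set B' := B.toReal with hB'
  set D' := D.toReal with hD'
  have hB'0 : 0 < B' := ENNReal.toReal_pos hB0 hBt
  have hD'0 : 0 < D' := ENNReal.toReal_pos hD0 hDt
  -- The radius at which r^b D = r^{-a} B.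
  set r := (B' / D') ^ (1 / (a + b)) with hr
  have hr0 : 0 < r := by positivity
  have hrab : r ^ (a + b) = B' / D' := by
    rw [hr, ← Real.rpow_mul (by positivity), one_div_mul_cancel hab.ne', Real.rpow_one]
  have e1 : r ^ b * D' = r ^ (-a) * B' := by
    rw [show b = -a + (a + b) by ring, Real.rpow_add hr0 (-a), hrab]
    field_simp
  have e2 : (r ^ b * D') ^ (a + b) = B' ^ b * D' ^ a := by
    rw [Real.mul_rpow (by positivity) hD'0.le, ← Real.rpow_mul hr0.le, mul_comm b, Real.rpow_mul hr0.le,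
      hrab, Real.div_rpow hB'0.le hD'0.le, Real.rpow_add hD'0]
    field_simp
  have hA := h hDt r hr0
  rw [← ENNReal.ofReal_toReal hBt, ← ENNReal.ofReal_toReal hDt, ← ENNReal.ofReal_mul (by positivity),
    ← ENNReal.ofReal_mul (by positivity), ← hB', ← hD', ← e1, ← two_mul, ← mul_assoc,
    mul_comm K] at hA
  calc A ^ (a + b) ≤ (2 * K * ENNReal.ofReal (r ^ b * D')) ^ (a + b) :=
        ENNReal.rpow_le_rpow hA hab.le
    _ = _ := by
        rw [ENNReal.mul_rpow_of_nonneg _ _ hab.le, ENNReal.ofReal_rpow_of_nonneg (by positivity) hab.le,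
          e2, ENNReal.ofReal_mul (by positivity), ← ENNReal.ofReal_rpow_of_nonneg hB'0.le hb.le,
          ← ENNReal.ofReal_rpow_of_nonneg hD'0.le ha.le, ENNReal.ofReal_toReal hBt,
          ENNReal.ofReal_toReal hDt, mul_assoc]

lemma exists_mul_ofReal_rpow_le_half {M : ℝ≥0∞} (hM : M ≠ ∞) {σ : ℝ} (hσ : 0 < σ) :
    ∃ ε : ℝ, 0 < ε ∧ M * ENNReal.ofReal (ε ^ σ) ≤ 1 / 2 := by
  have hM0 := ENNReal.toReal_nonneg (a := M)
  refine ⟨(1 / (2 * (M.toReal + 1))) ^ (1 / σ), by positivity, ?_⟩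
  rw [← Real.rpow_mul (by positivity), one_div_mul_cancel hσ.ne', Real.rpow_one]
  nth_rw 1 [← ENNReal.ofReal_toReal hM]
  rw [← ENNReal.ofReal_mul hM0]
  refine (ENNReal.ofReal_le_ofReal (q := 1 / 2) ?_).trans (le_of_eq ?_)
  · rw [mul_one_div, div_le_div_iff₀ (by positivity) two_pos]
    linarith
  · rw [ENNReal.ofReal_div_of_pos two_pos]; simp

/-- Injectivity of the transform, needed for the degenerate case of a vanishing dual norm. -/
lemma IsWeakFourier.eLpNorm_eq_zero {α : ℝ} (hα : 0 ≤ α) {f : ℝ × ℝ → ℂ} {g : ℝ × ℕ → ℂ}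
    (hw : IsWeakFourier α f g) {p : ℝ} (hp1 : 1 ≤ p) (hp2 : p ≤ 2)
    (hf : MemLp f (ENNReal.ofReal p) (haar α)) (hg : g =ᵐ[plancherel α] 0) :
    eLpNorm f (ENNReal.ofReal p) (haar α) = 0 := by
  have h0 : eLpNorm g 2 (plancherel α) = 0 := by rw [eLpNorm_congr_ae hg]; simp
  have h := hw.eLpNorm_two_le hα ⟨hw.1, by rw [h0]; exact ENNReal.zero_lt_top⟩ hp1 hp2 hf
  rw [h0, nonpos_iff_eq_zero, eLpNorm_eq_zero_iff hf.1 two_ne_zero] at h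
  rw [eLpNorm_congr_ae h]
  simp

/-- The inequality between the norm of `f` and its two weighted norms at a fixed radius. -/
lemma exists_eLpNorm_le_radius {α p a b : ℝ} (hα : 0 ≤ α) (hp1 : 1 ≤ p) (hp2 : p < 2) (ha : 0 < a)
    (hbQ : (2 * α + 4) * (1 / p - 1 / 2) < b) :
    ∃ K : ℝ≥0∞, 1 ≤ K ∧ K ≠ ∞ ∧ ∀ (f : ℝ × ℝ → ℂ) (g : ℝ × ℕ → ℂ),
      MemLp f (ENNReal.ofReal p) (haar α) → IsWeakFourier α f g →
      eLpNorm (fun w => ((dualNorm α w ^ (b / 2) : ℝ) : ℂ) * g w)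
        (ENNReal.ofReal p / (ENNReal.ofReal p - 1)) (plancherel α) ≠ ∞ → ∀ r : ℝ, 0 < r →
      eLpNorm f (ENNReal.ofReal p) (haar α) ≤
        K * (ENNReal.ofReal (r ^ b) * eLpNorm (fun w => ((dualNorm α w ^ (b / 2) : ℝ) : ℂ) * g w)
          (ENNReal.ofReal p / (ENNReal.ofReal p - 1)) (plancherel α) +
          ENNReal.ofReal (r ^ (-a)) *
            eLpNorm (fun z => ((homNorm z ^ a : ℝ) : ℂ) * f z) (ENNReal.ofReal p) (haar α)) := by
  have hδ : 0 < 1 / p - 1 / 2 := by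
    have := one_div_lt_one_div_of_lt (by linarith : 0 < p) hp2
    linarith
  set σ := (α + 2) * (1 / p - 1 / 2) with hσ
  have hσ0 : 0 < σ := by positivity
  have hσb : σ < b / 2 := by rw [hσ]; linarith
  have hC := (dualConst_lt_top hα).ne
  set c₁ : ℝ≥0∞ := (2 * dualConst α) ^ (1 / 2 : ℝ) + 1 with hc₁
  set c₂ : ℝ≥0∞ := (dualConst α * ENNReal.ofReal (2 / (b / 2 / (1 / p - 1 / 2) - (α + 2)))) ^
    (1 / p - 1 / 2) with hc₂
  set k : ℝ≥0∞ := ENNReal.ofReal (1 / (Real.pi * Real.Gamma (α + 1))) ^ (1 / p - 1 / 2) with hk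
  have hc₁t : c₁ ≠ ∞ := by
    refine ENNReal.add_ne_top.2 ⟨ENNReal.rpow_ne_top_of_nonneg (by norm_num) ?_, ENNReal.one_ne_top⟩
    exact ENNReal.mul_ne_top ENNReal.ofNat_ne_top hC
  have hc₂t : c₂ ≠ ∞ :=
    ENNReal.rpow_ne_top_of_nonneg hδ.le (ENNReal.mul_ne_top hC ENNReal.ofReal_ne_top)
  have hkt : k ≠ ∞ := ENNReal.rpow_ne_top_of_nonneg hδ.le ENNReal.ofReal_ne_top
  -- Chosen so that the low frequencies contribute at most half of the norm of f, whatever the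
  -- radius.
  obtain ⟨ε, hε, hεk⟩ := exists_mul_ofReal_rpow_le_half (ENNReal.mul_ne_top hkt hc₁t) hσ0
  set K : ℝ≥0∞ := k * c₂ * ENNReal.ofReal (ε ^ (σ - b / 2)) + 1 with hKdef
  have hKt : K ≠ ∞ := ENNReal.add_ne_top.2
    ⟨ENNReal.mul_ne_top (ENNReal.mul_ne_top hkt hc₂t) ENNReal.ofReal_ne_top, ENNReal.one_ne_top⟩
  have hK1 : 1 ≤ K := le_add_self
  refine ⟨2 * K, hK1.trans (le_mul_of_one_le_left zero_le one_le_two),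
    ENNReal.mul_ne_top ENNReal.ofNat_ne_top hKt, fun f g hf hw hD r hr => ?_⟩
  set A := eLpNorm f (ENNReal.ofReal p) (haar α) with hA
  set B := eLpNorm (fun z => ((homNorm z ^ a : ℝ) : ℂ) * f z) (ENNReal.ofReal p) (haar α) with hB
  set D := eLpNorm (fun w => ((dualNorm α w ^ (b / 2) : ℝ) : ℂ) * g w)
    (ENNReal.ofReal p / (ENNReal.ofReal p - 1)) (plancherel α) with hDdef
  have hAt : A ≠ ∞ := hf.2.ne
  -- The dual quasi-norm scales like the inverse square of the homogeneous norm: s^σ cancels r^{2σ},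
  -- and s^{σ - b/2} leaves r^b.
  set s := ε * r ^ (-2 : ℝ) with hs
  have hs0 : 0 < s := by positivity
  have hg2 : eLpNorm g 2 (plancherel α) ≤
      c₁ * ENNReal.ofReal (s ^ σ) * A + c₂ * ENNReal.ofReal (s ^ (σ - b / 2)) * D := by
    have hms : MeasurableSet {w | dualNorm α w ≤ s} :=
      measurableSet_le (measurable_dualNorm α) measurable_const
    rw [← Set.indicator_self_add_compl {w | dualNorm α w ≤ s} g]
    refine (eLpNorm_add_le (hw.1.indicator hms) (hw.1.indicator hms.compl) one_le_two).trans ?_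
    exact add_le_add (eLpNorm_low_le hα hp1 hp2.le hs0 hf hw) (eLpNorm_high_le hα hp1 hp2 hs0 hσb hw.1)
  have hg : MemLp g 2 (plancherel α) := ⟨hw.1, hg2.trans_lt (ENNReal.add_lt_top.2
    ⟨ENNReal.mul_lt_top (ENNReal.mul_lt_top hc₁t.lt_top ENNReal.ofReal_lt_top) hAt.lt_top,
      ENNReal.mul_lt_top (ENNReal.mul_lt_top hc₂t.lt_top ENNReal.ofReal_lt_top) hD.lt_top⟩)⟩
  have hf2 := (hw.eLpNorm_two_le hα hg hp1 hp2.le hf).trans hg2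
  have hsum : A ≤ k * ENNReal.ofReal (r ^ (2 * σ)) * eLpNorm f 2 (haar α) +
      ENNReal.ofReal (r ^ (-a)) * B := by
    have hms : MeasurableSet {z | homNorm z ≤ r} :=
      measurableSet_le measurable_homNorm measurable_const
    rw [hA, ← Set.indicator_self_add_compl {z | homNorm z ≤ r} f]
    refine (eLpNorm_add_le (hf.1.indicator hms) (hf.1.indicator hms.compl) (by simpa using hp1)).trans ?_
    rw [Set.indicator_self_add_compl]
    exact add_le_add (eLpNorm_indicator_ball_le hα hp1 hp2.le hr hf.1)
      (eLpNorm_indicator_ball_compl_le α ha hr _ f)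
  have hs1 : ENNReal.ofReal (r ^ (2 * σ)) * ENNReal.ofReal (s ^ σ) = ENNReal.ofReal (ε ^ σ) := by
    rw [← ENNReal.ofReal_mul (by positivity), hs, Real.mul_rpow hε.le (by positivity),
      ← Real.rpow_mul hr.le, mul_left_comm, ← Real.rpow_add hr]
    rw [show 2 * σ + -2 * σ = 0 by ring, Real.rpow_zero, mul_one]
  have hs2 : ENNReal.ofReal (r ^ (2 * σ)) * ENNReal.ofReal (s ^ (σ - b / 2)) =
      ENNReal.ofReal (ε ^ (σ - b / 2)) * ENNReal.ofReal (r ^ b) := by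
    rw [← ENNReal.ofReal_mul (by positivity), ← ENNReal.ofReal_mul (by positivity), hs,
      Real.mul_rpow hε.le (by positivity), ← Real.rpow_mul hr.le, mul_left_comm, ← Real.rpow_add hr]
    rw [show 2 * σ + -2 * (σ - b / 2) = b by ring]
  have hmain : A / 2 + A / 2 ≤
      A / 2 + K * (ENNReal.ofReal (r ^ b) * D + ENNReal.ofReal (r ^ (-a)) * B) := by
    rw [ENNReal.add_halves]
    calc A ≤ k * ENNReal.ofReal (r ^ (2 * σ)) *
          (c₁ * ENNReal.ofReal (s ^ σ) * A + c₂ * ENNReal.ofReal (s ^ (σ - b / 2)) * D) +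
          ENNReal.ofReal (r ^ (-a)) * B := hsum.trans (by gcongr)
      _ = k * c₁ * (ENNReal.ofReal (r ^ (2 * σ)) * ENNReal.ofReal (s ^ σ)) * A +
          (k * c₂ * (ENNReal.ofReal (r ^ (2 * σ)) * ENNReal.ofReal (s ^ (σ - b / 2))) * D +
          1 * (ENNReal.ofReal (r ^ (-a)) * B)) := by ring
      _ = k * c₁ * ENNReal.ofReal (ε ^ σ) * A +
          (k * c₂ * ENNReal.ofReal (ε ^ (σ - b / 2)) * (ENNReal.ofReal (r ^ b) * D) +
          1 * (ENNReal.ofReal (r ^ (-a)) * B)) := by rw [hs1, hs2]; ring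
      _ ≤ 1 / 2 * A + (K * (ENNReal.ofReal (r ^ b) * D) + K * (ENNReal.ofReal (r ^ (-a)) * B)) := by
          gcongr
          exact le_self_add
      _ = _ := by rw [mul_add, ENNReal.div_eq_inv_mul (a := A), one_div]
  -- Absorption: A/2 may be cancelled because f ∈ L^p makes A finite.
  have hhalf := (ENNReal.add_le_add_iff_left (ENNReal.div_ne_top hAt two_ne_zero)).1 hmain
  calc A = 2 * (A / 2) := (ENNReal.mul_div_cancel two_ne_zero ENNReal.ofNat_ne_top).symm
    _ ≤ 2 * (K * (ENNReal.ofReal (r ^ b) * D + ENNReal.ofReal (r ^ (-a)) * B)) := by gcongr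
    _ = _ := by rw [mul_assoc]

end LaguerreHypergroup

end

theorem theorem1p5 (α p a b : ℝ) (hα : 0 ≤ α) (hp1 : 1 ≤ p) (hp2 : p < 2)
    (ha : 0 < a) (hb : 0 < b) (hbQ : (2 * α + 4) * (1 / p - 1 / 2) < b) :
    ∃ C : ℝ, 0 < C ∧ ∀ f : ℝ × ℝ → ℂ,
      MemLp f (ENNReal.ofReal p) (LaguerreHypergroup.haar α) →
      eLpNorm f (ENNReal.ofReal p) (LaguerreHypergroup.haar α) ^ (a + b) ≤
        ENNReal.ofReal C
          * eLpNorm (fun z => ((LaguerreHypergroup.homNorm z ^ a : ℝ) : ℂ) * f z)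
              (ENNReal.ofReal p) (LaguerreHypergroup.haar α) ^ b
          * eLpNorm (fun w => ((LaguerreHypergroup.dualNorm α w ^ (b / 2) : ℝ) : ℂ)
                * LaguerreHypergroup.fourier α f w)
              (ENNReal.ofReal p / (ENNReal.ofReal p - 1))
              (LaguerreHypergroup.plancherel α) ^ a := by
  open LaguerreHypergroup in
  obtain ⟨K, hK1, hKt, hK⟩ := exists_eLpNorm_le_radius hα hp1 hp2 ha hbQ
  have hab : 0 < a + b := by linarith
  have hp0 : ENNReal.ofReal p ≠ 0 := (ENNReal.ofReal_pos.2 (by linarith)).ne'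
  have hCt : (2 * K) ^ (a + b) ≠ ∞ :=
    ENNReal.rpow_ne_top_of_nonneg hab.le (ENNReal.mul_ne_top ENNReal.ofNat_ne_top hKt)
  have hC0 : (2 * K) ^ (a + b) ≠ 0 := by
    rw [Ne, ENNReal.rpow_eq_zero_iff_of_pos hab]
    exact mul_ne_zero two_ne_zero (one_pos.trans_le hK1).ne'
  refine ⟨((2 * K) ^ (a + b)).toReal, ENNReal.toReal_pos hC0 hCt, fun f hf => ?_⟩
  have hw := isWeakFourier_fourier hα hp1 hp2.le hf
  rw [ENNReal.ofReal_toReal hCt]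
  -- The two side goals are the degenerate cases. Both weights are positive a.e., so a vanishing
  -- weighted norm forces f = 0, directly or through injectivity of the transform.
  refine rpow_le_of_forall_radius ha hb (fun hB => ?_) (fun hD => ?_) hK1
    fun hD r hr => hK f _ hf hw hD r hr
  · have hm : Measurable fun z => ((homNorm z ^ a : ℝ) : ℂ) := by
      have := measurable_homNorm
      fun_prop
    replace hB := (eLpNorm_eq_zero_iff (hm.aestronglyMeasurable.mul hf.1) hp0).1 hB
    have h0 : f =ᵐ[haar α] 0 := by
      filter_upwards [hB, ae_homNorm_pos α] with z h1 h2
      exact (mul_eq_zero.1 h1).resolve_left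
        (Complex.ofReal_ne_zero.2 (Real.rpow_pos_of_pos h2 a).ne')
    rw [eLpNorm_congr_ae h0]
    simp
  · have hm : Measurable fun w => ((dualNorm α w ^ (b / 2) : ℝ) : ℂ) := by
      have := measurable_dualNorm α
      fun_prop
    have hq : ENNReal.ofReal p / (ENNReal.ofReal p - 1) ≠ 0 :=
      (ENNReal.div_pos hp0 (ENNReal.sub_ne_top ENNReal.ofReal_ne_top)).ne'
    replace hD :=
      (eLpNorm_eq_zero_iff (hm.aestronglyMeasurable.mul hw.aestronglyMeasurable) hq).1 hD
    refine hw.eLpNorm_eq_zero hα hp1 hp2.le hf ?_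
    filter_upwards [hD, ae_dualNorm_pos hα] with w h1 h2
    exact (mul_eq_zero.1 h1).resolve_left
      (Complex.ofReal_ne_zero.2 (Real.rpow_pos_of_pos h2 (b / 2)).ne')
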